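/- Let $\mathbf F_q$ be a finite field of odd characteristic. For $n>0$ let $\mathscr P_n$ be the set of monic squarefree polynomials of degree $n$ in $\mathbf F_q[x]$. For $d\in\mathscr P_n$ let $\chi_d(m)=\left(\frac{d}{m}\right)$ be the quadratic residue symbol in $\mathbf F_q[x]$, and put $\mathcal L(t,\chi_d)=\sum_{m\text{ monic}}\chi_d(m)\,t^{\deg m}$. This is a polynomial of degree at most $n-1$ in $t$ with constant term $1$, and there is a multiset $\Theta_d$ of $n-1$ complex numbers, its inverse roots, with $$\mathcal L(t,\chi_d)=\prod_{\omega\in\Theta_d}(1-\omega t).$$ Let $s_\lambda$ denote the Schur function of a partition $\lambda$, let $\lambda'$ be the conjugate partition, and let $h_r$ be the $r$th complete homogeneous symmetric function. In the completed ring of symmetric functions with complex coefficients put $$\mathcal Z_n=q^{-n}\sum_{d\in\mathscr P_n}\sum_\lambda s_\lambda(\Theta_d)\,s_{\lambda'} .$$ Then $\mathcal Z_n$ converges coefficientwise as $n\to\infty$ (for every $\lambda$ the coefficient $q^{-n}\sum_{d\in\mathscr P_n}s_\lambda(\Theta_d)$ of $s_{\lambda'}$ converges), and $$\lim_{n\to\infty}\mathcal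 Z_n=\mathbf{Exp}\Big(q\,\mathbf{Log}\Big(q^{-1}+\sum_{k\ge 0}h_{2k}\Big)-1\Big).$$ Here the right-hand side is first formed with $q^{-1}$ replaced by a formal variable $z$ (and $q$ by $z^{-1}$), in the completed ring of symmetric functions in $x_0,x_1,\dots$ over the field $\mathbf Q(\!(z)\!)$ of Laurent series, with coefficientwise $z$-adic convergence of infinite sums, where $$\mathbf{Exp}(f)=\exp\Big(\sum_{k\ge1}\frac{\psi_k(f)}{k}\Big),\qquad \mathbf{Log}(g)=\sum_{k\ge1}\frac{\mu(k)}{k}\log\big(\psi_k(g)\big),$$ $\mu$ is the Möbius function and $\psi_k$ is the Adams operation $x_i\mapsto x_i^k$, $z\mapsto z^k$; each coefficient of the resulting series is a Laurent series in $z$ that converges at $z=q^{-1}$, and the right-hand side denotes the series of the values at $z=q^{-1}$. -/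

import Mathlib

open Polynomial Filter Topology
open scoped LaurentSeries MvPowerSeries.WithPiTopology

namespace StableTraces

noncomputable section

/-! ### Quadratic characters and L-functions over `F[x]` -/

section LFunctions

variable {F : Type*} [Field F]

open Classical in
/-- The quadratic residue symbol `(d / p)` for an irreducible polynomial `p`. -/
def residueSymbol (d p : F[X]) : ℤ :=
  if p ∣ d then 0 else if ∃ a : F[X], p ∣ a ^ 2 - d then 1 else -1

open Classical in
/-- `χ_d(m) = (d / m)` for nonzero `m`, extended multiplicatively from irreducible `m`. -/
def chi (d m : F[X]) : ℤ :=
  ((UniqueFactorizationMonoid.normalizedFactors m).map (residueSymbol d)).prod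

/-- The L-function `𝓛(t, χ_d) = ∑ χ_d(m) t ^ (deg m)`, the sum being over monic `m`. -/
def lFunction (d : F[X]) : PowerSeries ℤ :=
  PowerSeries.mk fun k => ∑ᶠ (m : F[X]) (_ : m.Monic ∧ m.natDegree = k), chi d m

/-- The multiset `Θ_d` of the `n - 1` inverse roots of `𝓛(t, χ_d)`, where `n = deg d > 0`:
the complex roots of the monic polynomial `t ^ (n - 1) 𝓛(1 / t, χ_d)`.
(For `d` monic and squarefree, `𝓛(t, χ_d)` is a polynomial of degree at most `n - 1`.) -/
def inverseRoots (d : F[X]) : Multiset ℂ :=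
  (((PowerSeries.trunc d.natDegree (lFunction d)).reflect (d.natDegree - 1)).map
    (Int.castRingHom ℂ)).roots

end LFunctions

/-! ### Symmetric functions

Symmetric functions are symmetric power series in the variables `x_0, x_1, x_2, …`. -/

/-- The content of a tableau `T`: the number of occurrences of each entry. -/
def content {μ : YoungDiagram} (T : SemistandardYoungTableau μ) : ℕ →₀ ℕ :=
  ∑ c ∈ μ.cells, Finsupp.single (T c.1 c.2) 1

/-- The Schur function `s_μ = ∑_T x ^ T`, the sum being over the semistandard tableaux of
shape `μ`. -/
def schur (R : Type*) [CommSemiring R] (μ : YoungDiagram) : MvPowerSeries ℕ R :=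
  fun m => (Nat.card {T : SemistandardYoungTableau μ // content T = m} : R)

/-- The Schur polynomial `s_μ(ω_0, …, ω_{N-1})` in `N` variables evaluated at a list of length `N`.
Entries `≥ N` of a tableau contribute a factor `0`. -/
def schurEval {R : Type*} [CommSemiring R] (μ : YoungDiagram) (l : List R) : R :=
  ∑ᶠ T : SemistandardYoungTableau μ, ∏ c ∈ μ.cells, l.getD (T c.1 c.2) 0

/-- The series `∑_μ a_μ s_{μ'}`, where `μ'` is the conjugate partition of `μ`. Each coefficient is
a finite sum, since `s_{μ'}` is homogeneous of degree `|μ|`. -/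
def schurSum (a : YoungDiagram → ℂ) : MvPowerSeries ℕ ℂ :=
  fun m => ∑ᶠ μ : YoungDiagram, a μ * MvPowerSeries.coeff m (schur ℂ μ.transpose)

/-- The complete homogeneous symmetric function `h_r`. -/
def hsymm (R : Type*) [CommSemiring R] (r : ℕ) : MvPowerSeries ℕ R :=
  fun m => if m.degree = r then 1 else 0

/-! ### The series `𝓩_n` -/

/-- The coefficient `q ^ (-n) ∑_{d ∈ P_n} s_μ(Θ_d)` of `s_{μ'}` in `𝓩_n`. (Since `s_μ` is symmetric,
the enumeration of `Θ_d` does not matter.) -/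
def traceCoeff (F : Type*) [Field F] (n : ℕ) (μ : YoungDiagram) : ℂ :=
  ((Nat.card F : ℂ) ^ n)⁻¹ *
    ∑ᶠ (d : F[X]) (_ : d.Monic ∧ Squarefree d ∧ d.natDegree = n),
      schurEval μ (inverseRoots d).toList

/-- `𝓩_n = q ^ (-n) ∑_{d ∈ P_n} ∑_μ s_μ(Θ_d) s_{μ'}`. -/
def traceSeries (F : Type*) [Field F] (n : ℕ) : MvPowerSeries ℕ ℂ :=
  schurSum (traceCoeff F n)

/-! ### Plethystic exponential and logarithm

These act on symmetric functions with coefficients in the field `ℚ⸨X⸩` of Laurent series in a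
variable `z`. All infinite sums are taken in the topology of coefficientwise `z`-adic convergence. -/

/-- The substitution `z ↦ z ^ k` on Laurent series in `z`. -/
def laurentExpand (k : ℕ+) : ℚ⸨X⸩ →+* ℚ⸨X⸩ :=
  HahnSeries.embDomainRingHom (AddMonoidHom.mulLeft (k : ℤ))
    (fun a b h => by
      have hk : (0 : ℤ) < (k : ℤ) := by exact_mod_cast k.pos
      exact mul_left_cancel₀ hk.ne' h)
    (fun a b => by
      have hk : (0 : ℤ) < (k : ℤ) := by exact_mod_cast k.pos
      exact mul_le_mul_iff_right₀ hk)

/-- The Adams operation `ψ_k = p_k ∘ -`: it sends `z` to `z ^ k` and every `x_i` to `x_i ^ k`. -/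
def adams (k : ℕ+) : MvPowerSeries ℕ ℚ⸨X⸩ →+* MvPowerSeries ℕ ℚ⸨X⸩ :=
  (MvPowerSeries.expand (σ := ℕ) (R := ℚ⸨X⸩) (k : ℕ) k.ne_zero).toRingHom.comp
    (MvPowerSeries.map (laurentExpand k))

/-- The exponential series `∑_{n ≥ 0} y ^ n / n!`. -/
def expSeries (y : MvPowerSeries ℕ ℚ⸨X⸩) : MvPowerSeries ℕ ℚ⸨X⸩ :=
  ∑' n : ℕ, ((n.factorial : ℚ)⁻¹) • y ^ n

/-- The logarithm series `∑_{n ≥ 1} (-1) ^ (n - 1) (g - 1) ^ n / n`. -/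
def logSeries (g : MvPowerSeries ℕ ℚ⸨X⸩) : MvPowerSeries ℕ ℚ⸨X⸩ :=
  ∑' n : ℕ, ((-1 : ℚ) ^ n / (n + 1 : ℚ)) • (g - 1) ^ (n + 1)

/-- The plethystic exponential `Exp(f) = E ∘ f`, where
`E = ∑_{r ≥ 0} h_r = exp (∑_{k ≥ 1} p_k / k)`. -/
def plethysticExp (f : MvPowerSeries ℕ ℚ⸨X⸩) : MvPowerSeries ℕ ℚ⸨X⸩ :=
  expSeries (∑' k : ℕ+, ((k : ℚ)⁻¹) • adams k f)

/-- The plethystic logarithm `Log(g) = L ∘ (g - 1)`, where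
`L = ∑_{k ≥ 1} (μ(k) / k) log (1 + p_k)`. -/
def plethysticLog (g : MvPowerSeries ℕ ℚ⸨X⸩) : MvPowerSeries ℕ ℚ⸨X⸩ :=
  ∑' k : ℕ+, ((ArithmeticFunction.moebius (k : ℕ) : ℚ) / (k : ℚ)) • logSeries (adams k g)

/-- The element `z ^ j` of the coefficient ring. -/
def zPow (j : ℤ) : MvPowerSeries ℕ ℚ⸨X⸩ :=
  MvPowerSeries.C (HahnSeries.single j (1 : ℚ))

/-- The series `Exp(q Log(q⁻¹ + ∑_{k ≥ 0} h_{2k}) - 1)`, where `q⁻¹` is the formal variable `z`. -/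
def stableSeries : MvPowerSeries ℕ ℚ⸨X⸩ :=
  plethysticExp (zPow (-1) * plethysticLog (zPow 1 + ∑' k : ℕ, hsymm ℚ⸨X⸩ (2 * k)) - 1)

end

end StableTraces

/-! The dual Cauchy identity gives ∑_λ s_λ(Θ_d) s_{λ'}(x) = ∏_j ∏_{ω ∈ Θ_d} (1 + ω x_j) = ∏_j
𝓛(-x_j, χ_d). Inserting the Euler product of 𝓛 and exchanging products turns this into ∏_P ∏_j (1 -
ε_P x_j^{deg P})⁻¹, over monic irreducible P, with ε_P = (-1)^{deg P} χ_d(P). Since ε_P is 0 or ±1,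
the factor at P is 1 + ε_P ψ_k(h_1 + h_3 + ⋯) + ε_P² ψ_k(h_2 + h_4 + ⋯), where k = deg P
(`coeff_prod_substX_geomSeries`). A coefficient of x-degree at most N involves only P of degree at
most N (`coeff_schurSum_inverseRoots`), so it is a finite combination of averages over d of ∏_{P ∈
B} χ_d(P) ∏_{P ∈ D} χ_d(P)² with B and D disjoint.

As n → ∞ such an average tends to 0 unless B = ∅, and then to (1 - q⁻¹) ∏_{P ∈ D} (1 + q^{-deg P})⁻¹
(`tendsto_average`). This comes from the generating series of squarefree polynomials, by means of
the unique factorization d = a²b with b squarefree and the vanishing of complete character sums.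
Resumming over D, the limit is the Euler product (1 - q⁻¹) ∏_P (1 + q^{-deg P})⁻¹ (q^{-deg P} +
ψ_{deg P}(∑ h_{2k})), see `eulerProduct`.

This product is identified with the plethystic expression through logarithmic derivatives for the
Euler derivation E. Put g = z + ∑ h_{2k}. The stable series has logarithmic derivative ∑_{k,j} μ(j)
z^{-k} ψ_{kj}(Eg/g) (`euler_stableSeries`), and the Euler product has ∑_n n N_n ψ_n(Eg/g) evaluated
at z = q⁻¹, N_n being the number of monic irreducibles of degree n. They agree by the formula n N_n
= ∑_{kj=n} μ(j) q^k (`natCast_mul_primeCount`). The constant coefficients agree because Log(1 + z) =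
z - z², so that the constant coefficient of the stable series is Exp(-z) = 1 - z. The recursion that
recovers a series from these two data also propagates convergence at z = q⁻¹
(`EvalsToCoeff.of_euler_eq`).

Two further ingredients are needed. That 𝓛 is a polynomial with n - 1 inverse roots rests on
reciprocity, proved by writing χ_d(m) as the quadratic character of a resultant
(`chi_eq_resultant`). Convergence of each coefficient of s_{λ'}, rather than of each monomial
coefficient, follows from unitriangularity of the Kostka numbers
(`tendsto_of_tendsto_coeff_schurSum`). -/

namespace StableTraces

/-! ### Strips of Young diagrams -/

/-- `μ / ν` is a horizontal strip. -/
def IsHStrip (ν μ : YoungDiagram) : Prop :=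
  ν ≤ μ ∧ ∀ i j, (i + 1, j) ∈ μ → (i, j) ∈ ν

/-- `μ / ν` is a vertical strip. -/
def IsVStrip (ν μ : YoungDiagram) : Prop :=
  ν ≤ μ ∧ ∀ i j, (i, j + 1) ∈ μ → (i, j) ∈ ν

theorem isHStrip_transpose {ν μ : YoungDiagram} :
    IsHStrip ν.transpose μ.transpose ↔ IsVStrip ν μ := by
  unfold IsHStrip IsVStrip
  rw [YoungDiagram.transpose_le_iff]
  simp only [YoungDiagram.mem_transpose, Prod.swap_prod_mk]
  exact and_congr_right fun _ => forall_comm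

theorem le_iff_rowLen {ν μ : YoungDiagram} : ν ≤ μ ↔ ∀ i, ν.rowLen i ≤ μ.rowLen i := by
  constructor
  · intro h i
    by_contra! hc
    have := h (YoungDiagram.mem_iff_lt_rowLen.2 hc)
    exact lt_irrefl _ (YoungDiagram.mem_iff_lt_rowLen.1 this)
  · rintro h ⟨i, j⟩ hc
    exact YoungDiagram.mem_iff_lt_rowLen.2 ((YoungDiagram.mem_iff_lt_rowLen.1 hc).trans_le (h i))

theorem youngDiagram_ext_rowLen {ν μ : YoungDiagram} (h : ∀ i, ν.rowLen i = μ.rowLen i) : ν = μ :=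
  le_antisymm (le_iff_rowLen.2 fun i => (h i).le) (le_iff_rowLen.2 fun i => (h i).ge)

/-- Horizontal strips are interlacing conditions μ_{i+1} ≤ ν_i ≤ μ_i. In this form, and in the
analogous one for vertical strips, a diagram wedged between two fixed ones has rows that can be
chosen independently. -/
theorem isHStrip_iff_rowLen {ν μ : YoungDiagram} :
    IsHStrip ν μ ↔ ∀ i, ν.rowLen i ≤ μ.rowLen i ∧ μ.rowLen (i + 1) ≤ ν.rowLen i := by
  rw [IsHStrip, le_iff_rowLen, forall_and]
  refine and_congr_right fun _ => forall_congr' fun i => ?_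
  simp only [YoungDiagram.mem_iff_lt_rowLen]
  exact ⟨fun h => not_lt.1 fun hc => lt_irrefl _ (h _ hc), fun h j hj => hj.trans_le h⟩

theorem isVStrip_iff_rowLen {ν μ : YoungDiagram} :
    IsVStrip ν μ ↔ ∀ i, ν.rowLen i ≤ μ.rowLen i ∧ μ.rowLen i ≤ ν.rowLen i + 1 := by
  rw [IsVStrip, le_iff_rowLen, forall_and]
  refine and_congr_right fun _ => forall_congr' fun i => ?_
  simp only [YoungDiagram.mem_iff_lt_rowLen]
  refine ⟨fun h => not_lt.1 fun hc => lt_irrefl _ (h _ hc), fun h j hj => ?_⟩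
  omega

/-- The rectangular diagram with `R` rows and `C` columns. -/
def rectangle (R C : ℕ) : YoungDiagram where
  cells := Finset.range R ×ˢ Finset.range C
  isLowerSet := by
    rintro ⟨a, b⟩ ⟨c, d⟩ ⟨h1, h2⟩ h
    simp only [Finset.coe_product, Finset.coe_range, Set.mem_prod, Set.mem_Iio] at h ⊢
    exact ⟨lt_of_le_of_lt h1 h.1, lt_of_le_of_lt h2 h.2⟩

theorem mem_rectangle {R C : ℕ} {c : ℕ × ℕ} : c ∈ rectangle R C ↔ c.1 < R ∧ c.2 < C := by
  rw [← YoungDiagram.mem_cells]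
  simp [rectangle]

theorem finite_setOf_le (μ : YoungDiagram) : {ν : YoungDiagram | ν ≤ μ}.Finite := by
  refine Set.Finite.of_finite_image (f := YoungDiagram.cells)
    ((μ.cells.powerset.finite_toSet).subset ?_) ?_
  · rintro _ ⟨ν, hν, rfl⟩
    simpa using YoungDiagram.cells_subset_iff.2 hν
  · intro a _ b _ h
    exact YoungDiagram.ext h

/-- The finite set of diagrams with at most `R` rows and `C` columns. -/
noncomputable def box (R C : ℕ) : Finset YoungDiagram :=
  (finite_setOf_le (rectangle R C)).toFinset

theorem mem_box {R C : ℕ} {μ : YoungDiagram} :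
    μ ∈ box R C ↔ μ.rowLen R = 0 ∧ μ.rowLen 0 ≤ C := by
  simp only [box, Set.Finite.mem_toFinset, Set.mem_ofPred_eq]
  constructor
  · intro h
    constructor
    · by_contra hc
      have := mem_rectangle.1 (h (YoungDiagram.mem_iff_lt_rowLen.2 (Nat.pos_of_ne_zero hc)))
      simp at this
    · by_contra! hc
      have := mem_rectangle.1 (h (YoungDiagram.mem_iff_lt_rowLen.2 hc))
      simp at this
  · rintro ⟨h1, h2⟩ ⟨i, j⟩ h
    have h := YoungDiagram.mem_iff_lt_rowLen.1 h
    rw [mem_rectangle]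
    constructor
    · by_contra! hc
      have := μ.rowLen_anti _ _ hc
      simp only at this
      omega
    · exact h.trans_le ((μ.rowLen_anti 0 i (Nat.zero_le _)).trans h2)

theorem box_mono {R R' C C' : ℕ} (hR : R ≤ R') (hC : C ≤ C') : box R C ⊆ box R' C' := by
  intro μ h
  rw [mem_box] at h ⊢
  have := μ.rowLen_anti R R' hR
  omega

theorem mem_box_of_le {R C : ℕ} {μ ν : YoungDiagram} (h : ν ≤ μ) (hμ : μ ∈ box R C) :
    ν ∈ box R C := by
  rw [mem_box] at hμ ⊢
  have h1 := le_iff_rowLen.1 h R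
  have h2 := le_iff_rowLen.1 h 0
  omega

theorem rowLen_eq_zero_of_mem_box {R C i : ℕ} {μ : YoungDiagram} (h : μ ∈ box R C) (hi : R ≤ i) :
    μ.rowLen i = 0 := by
  have := μ.rowLen_anti R i hi
  have := (mem_box.1 h).1
  omega

theorem card_eq_sum_rowLen {R C : ℕ} {μ : YoungDiagram} (h : μ ∈ box R C) :
    μ.card = ∑ i ∈ Finset.range R, μ.rowLen i := by
  rw [YoungDiagram.card, Finset.card_eq_sum_card_fiberwise (f := Prod.fst) (t := Finset.range R)]
  · exact Finset.sum_congr rfl fun i _ => (YoungDiagram.rowLen_eq_card μ).symm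
  · rintro ⟨i, j⟩ hc
    by_contra hi
    simp only [Finset.coe_range, Set.mem_Iio, not_lt] at hi
    have h1 := YoungDiagram.mem_iff_lt_rowLen.1 ((YoungDiagram.mem_cells _).1 hc)
    have := rowLen_eq_zero_of_mem_box h hi
    omega

/-- The diagram with row lengths `p 0 ≥ p 1 ≥ ⋯ ≥ p (R - 1)`. -/
def diagramOfRows (R : ℕ) (p : ℕ → ℕ) (hp : ∀ i, i + 1 < R → p (i + 1) ≤ p i) : YoungDiagram where
  cells := (Finset.range R ×ˢ Finset.range (p 0)).filter fun c => c.2 < p c.1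
  isLowerSet := by
    have hanti : ∀ i k, i + k < R → p (i + k) ≤ p i := by
      intro i k
      induction k with
      | zero => simp
      | succ k ih => intro h; exact (hp _ h).trans (ih (by omega))
    rintro ⟨a, b⟩ ⟨c, d⟩ ⟨h1, h2⟩ h
    simp only [Finset.coe_filter, Finset.mem_product, Finset.mem_range, Set.mem_ofPred_eq] at h h1 h2 ⊢
    obtain ⟨k, rfl⟩ := Nat.exists_eq_add_of_le h1
    have := hanti _ _ h.1.1
    omega

theorem rowLen_diagramOfRows {R : ℕ} {p : ℕ → ℕ} (hp : ∀ i, i + 1 < R → p (i + 1) ≤ p i) (i : ℕ) :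
    (diagramOfRows R p hp).rowLen i = if i < R then p i else 0 := by
  have hanti : ∀ i, i < R → p i ≤ p 0 := by
    intro i
    induction i with
    | zero => simp
    | succ k ih => intro h; exact (hp _ h).trans (ih (by omega))
  have key : ∀ j, j < (diagramOfRows R p hp).rowLen i ↔ j < if i < R then p i else 0 := by
    intro j
    rw [← YoungDiagram.mem_iff_lt_rowLen, ← YoungDiagram.mem_cells]
    simp only [diagramOfRows, Finset.mem_filter, Finset.mem_product, Finset.mem_range]
    have := hanti i
    split_ifs with h
    · have := this h
      omega
    · omega
  have h1 := key (if i < R then p i else 0)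
  have h2 := key ((diagramOfRows R p hp).rowLen i)
  omega

/-! ### Commutation of horizontal and vertical strips -/

section Commutation

variable {R : Type*} [CommRing R] (x y : R)

/-- Sums over diagrams whose rows may be chosen independently factor. -/
theorem sum_box_eq_prod (m C : ℕ) (t : ℕ → Finset ℕ) (f : ℕ → ℕ → R)
    (ht : ∀ i, i + 1 < m → ∀ a ∈ t i, ∀ b ∈ t (i + 1), b ≤ a) (hC : ∀ a ∈ t 0, a ≤ C)
    [DecidablePred fun μ : YoungDiagram => ∀ i < m, μ.rowLen i ∈ t i] :
    ∑ μ ∈ (box m C).filter (fun μ => ∀ i < m, μ.rowLen i ∈ t i),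
      ∏ i ∈ Finset.range m, f i (μ.rowLen i) = ∏ i ∈ Finset.range m, ∑ n ∈ t i, f i n := by
  rw [Finset.prod_range, Finset.prod_univ_sum]
  refine Finset.sum_bij (fun μ _ i => μ.rowLen i) ?_ ?_ ?_ ?_
  · intro μ hμ
    rw [Finset.mem_filter] at hμ
    rw [Fintype.mem_piFinset]
    exact fun i => hμ.2 i i.2
  · intro μ hμ ν hν h
    rw [Finset.mem_filter] at hμ hν
    refine youngDiagram_ext_rowLen fun i => ?_
    by_cases hi : i < m
    · exact congrFun h ⟨i, hi⟩
    · rw [rowLen_eq_zero_of_mem_box hμ.1 (not_lt.1 hi), rowLen_eq_zero_of_mem_box hν.1 (not_lt.1 hi)]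
  · intro p hp
    rw [Fintype.mem_piFinset] at hp
    have hp' : ∀ i, i + 1 < m → (if h : i + 1 < m then p ⟨i + 1, h⟩ else 0) ≤
        (if h : i < m then p ⟨i, h⟩ else 0) := by
      intro i hi
      rw [dif_pos hi, dif_pos (by omega)]
      exact ht i hi _ (hp ⟨i, by omega⟩) _ (hp ⟨i + 1, hi⟩)
    have key : ∀ i (hi : i < m), (diagramOfRows m (fun i => if h : i < m then p ⟨i, h⟩ else 0)
        hp').rowLen i = p ⟨i, hi⟩ := by
      intro i hi
      rw [rowLen_diagramOfRows, if_pos hi, dif_pos hi]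
    refine ⟨diagramOfRows m (fun i => if h : i < m then p ⟨i, h⟩ else 0) hp', ?_, ?_⟩
    · rw [Finset.mem_filter, mem_box]
      refine ⟨⟨?_, ?_⟩, ?_⟩
      · rw [rowLen_diagramOfRows, if_neg (lt_irrefl _)]
      · rcases m.eq_zero_or_pos with rfl | hm
        · rw [rowLen_diagramOfRows]; simp
        · rw [key 0 hm]; exact hC _ (hp ⟨0, hm⟩)
      · intro i hi; rw [key i hi]; exact hp ⟨i, hi⟩
    · funext i; exact key i i.2
  · intro μ _
    rw [Finset.prod_range]

/-- Choices for a row added vertically to a row of length `s`, of length at least `k`. -/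
def upChoices (s k : ℕ) : Finset ℕ := (Finset.Icc s (s + 1)).filter (k ≤ ·)

/-- Choices for a row from which a row of length `k` is obtained vertically. -/
def downChoices (k s s' : ℕ) : Finset ℕ :=
  (Finset.range (k + 1)).filter fun n => k ≤ n + 1 ∧ s' ≤ n ∧ n ≤ s

/-- The factor of a pair of adjacent rows. -/
def adjFactor (s' k : ℕ) : R := if s' < k then 1 + x * y else if s' = k then 1 else 0

/-- The only candidates are n = k and n = k - 1; the bound s' ≤ n admits both, only the first, or
neither, according to the comparison of s' with k. This is the case distinction in `adjFactor`. -/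
theorem sum_downChoices_of_le {s k s' : ℕ} (h : k ≤ s) :
    ∑ n ∈ downChoices k s s', y ^ (s - n) * x ^ (k - n) = y ^ (s - k) * adjFactor x y s' k := by
  unfold adjFactor
  split_ifs with h1 h2
  · have : downChoices k s s' = {k, k - 1} := by
      ext n; simp only [downChoices, Finset.mem_filter, Finset.mem_range, Finset.mem_insert,
        Finset.mem_singleton]; omega
    rw [this, Finset.sum_pair (by omega), show s - (k - 1) = (s - k) + 1 by omega,
      show k - (k - 1) = 1 by omega, Nat.sub_self]
    ring
  · have : downChoices k s s' = {k} := by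
      ext n; simp only [downChoices, Finset.mem_filter, Finset.mem_range,
        Finset.mem_singleton]; omega
    rw [this, Finset.sum_singleton]
    simp
  · have : downChoices k s s' = ∅ := by
      ext n; simp only [downChoices, Finset.mem_filter, Finset.mem_range,
        Finset.notMem_empty,
        iff_false]; omega
    simp [this]

theorem sum_downChoices_of_eq {s s' : ℕ} (h : s' ≤ s) :
    ∑ n ∈ downChoices (s + 1) s s', y ^ (s - n) * x ^ (s + 1 - n) = x := by
  have : downChoices (s + 1) s s' = {s} := by
    ext n; simp only [downChoices, Finset.mem_filter, Finset.mem_range,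
      Finset.mem_singleton]; omega
  simp [this]

theorem downChoices_of_lt {s k s' : ℕ} (h : s + 1 < k) : downChoices k s s' = ∅ := by
  ext n; simp only [downChoices, Finset.mem_filter, Finset.mem_range, Finset.notMem_empty,
        iff_false]; omega

theorem sum_upChoices_of_le {s k : ℕ} (h : k ≤ s) :
    ∑ n ∈ upChoices s k, y ^ (n - k) * x ^ (n - s) = y ^ (s - k) * (1 + x * y) := by
  have : upChoices s k = {s, s + 1} := by
    ext n; simp only [upChoices, Finset.mem_filter, Finset.mem_Icc, Finset.mem_insert,
      Finset.mem_singleton]; omega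
  rw [this, Finset.sum_pair (by omega), show s + 1 - k = (s - k) + 1 by omega, Nat.sub_self,
    Nat.add_sub_cancel_left]
  ring

theorem sum_upChoices_filter_of_le {s k k' : ℕ} (h : k ≤ s) :
    ∑ n ∈ (upChoices s k).filter (· ≤ k'), y ^ (n - k) * x ^ (n - s) =
      y ^ (s - k) * adjFactor x y s k' := by
  unfold adjFactor
  split_ifs with h1 h2
  · rw [← sum_upChoices_of_le x y h, Finset.filter_true_of_mem]
    intro n hn
    simp only [upChoices, Finset.mem_filter, Finset.mem_Icc] at hn
    omega
  · have : (upChoices s k).filter (· ≤ k') = {s} := by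
      ext n; simp only [upChoices, Finset.mem_filter, Finset.mem_Icc, Finset.mem_singleton]; omega
    simp [this]
  · have : (upChoices s k).filter (· ≤ k') = ∅ := by
      ext n; simp only [upChoices, Finset.mem_filter, Finset.mem_Icc, Finset.notMem_empty,
        iff_false]; omega
    simp [this]

/-- The top row has no row above to bound it, so its choices contribute the full factor 1 + xy; this
is the origin of that factor in the commutation relation. -/
theorem sum_upChoices_zero {s k s' : ℕ} (hs : s' ≤ s) :
    (∑ n ∈ upChoices s k, y ^ (n - k) * x ^ (n - s)) * adjFactor x y s' k =
      (1 + x * y) * ∑ n ∈ downChoices k s s', y ^ (s - n) * x ^ (k - n) := by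
  rcases lt_trichotomy k (s + 1) with h | rfl | h
  · rw [sum_downChoices_of_le _ _ (by omega), sum_upChoices_of_le _ _ (by omega)]
    ring
  · have : upChoices s (s + 1) = {s + 1} := by
      ext n; simp only [upChoices, Finset.mem_filter, Finset.mem_Icc, Finset.mem_singleton]; omega
    rw [sum_downChoices_of_eq _ _ hs, this, Finset.sum_singleton, adjFactor, if_pos (by omega)]
    simp [mul_comm]
  · have : upChoices s k = ∅ := by
      ext n; simp only [upChoices, Finset.mem_filter, Finset.mem_Icc, Finset.notMem_empty,
        iff_false]; omega
    rw [this, downChoices_of_lt h]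
    simp

/-- The telescoping step: trading an upward row sum for a downward one replaces the interaction of
this row with the row below by its interaction with the row above. -/
theorem sum_upChoices_succ {s k s' k' : ℕ} (hs : s' ≤ s) (hk : k ≤ k') :
    (∑ n ∈ (upChoices s k).filter (· ≤ k'), y ^ (n - k) * x ^ (n - s)) * adjFactor x y s' k =
      adjFactor x y s k' * ∑ n ∈ downChoices k s s', y ^ (s - n) * x ^ (k - n) := by
  rcases lt_trichotomy k (s + 1) with h | rfl | h
  · rw [sum_downChoices_of_le _ _ (by omega), sum_upChoices_filter_of_le _ _ (by omega)]
    ring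
  · have : (upChoices s (s + 1)).filter (· ≤ k') = {s + 1} := by
      ext n; simp only [upChoices, Finset.mem_filter, Finset.mem_Icc, Finset.mem_singleton]; omega
    rw [sum_downChoices_of_eq _ _ hs, this, Finset.sum_singleton, adjFactor, if_pos (by omega),
      adjFactor, if_pos (by omega)]
    simp [mul_comm]
  · have : (upChoices s k).filter (· ≤ k') = ∅ := by
      ext n; simp only [upChoices, Finset.mem_filter, Finset.mem_Icc, Finset.notMem_empty,
        iff_false]; omega
    rw [this, downChoices_of_lt h]
    simp

/-- The choices for row `i` of a diagram `ρ` such that `ρ / κ` is a horizontal strip and `ρ / σ` is a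
vertical strip. -/
def rowChoices (σ κ : YoungDiagram) : ℕ → Finset ℕ
  | 0 => upChoices (σ.rowLen 0) (κ.rowLen 0)
  | i + 1 => (upChoices (σ.rowLen (i + 1)) (κ.rowLen (i + 1))).filter (· ≤ κ.rowLen i)

theorem prod_rowChoices (σ κ : YoungDiagram) (m : ℕ) :
    (∏ i ∈ Finset.range (m + 1), ∑ n ∈ rowChoices σ κ i,
        y ^ (n - κ.rowLen i) * x ^ (n - σ.rowLen i)) *
        adjFactor x y (σ.rowLen (m + 1)) (κ.rowLen m) =
      (1 + x * y) * ∏ i ∈ Finset.range (m + 1),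
        ∑ n ∈ downChoices (κ.rowLen i) (σ.rowLen i) (σ.rowLen (i + 1)),
          y ^ (σ.rowLen i - n) * x ^ (κ.rowLen i - n) := by
  induction m with
  | zero =>
    simp only [zero_add, Finset.prod_range_one, rowChoices]
    exact sum_upChoices_zero _ _ (σ.rowLen_anti _ _ (by omega))
  | succ m ih =>
    rw [Finset.prod_range_succ, mul_assoc]
    conv_lhs => rw [rowChoices]
    rw [sum_upChoices_succ _ _ (σ.rowLen_anti _ _ (by omega)) (κ.rowLen_anti _ _ (by omega)),
      ← mul_assoc, ih, Finset.prod_range_succ _ (m + 1)]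
    ring

/-- In the last row κ is empty, so the row sum is y^{σ_m} times exactly the interaction factor that
the telescoped product of the rows above consumes. The power y^{σ_m} accounts for row m of σ, which
the smaller diagram lacks altogether. -/
theorem prod_rowChoices_of_rowLen_eq_zero {σ κ : YoungDiagram} {m : ℕ} (hκ : κ.rowLen m = 0) :
    ∏ i ∈ Finset.range (m + 1), ∑ n ∈ rowChoices σ κ i,
        y ^ (n - κ.rowLen i) * x ^ (n - σ.rowLen i) =
      (1 + x * y) * (y ^ σ.rowLen m * ∏ i ∈ Finset.range m,
        ∑ n ∈ downChoices (κ.rowLen i) (σ.rowLen i) (σ.rowLen (i + 1)),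
          y ^ (σ.rowLen i - n) * x ^ (κ.rowLen i - n)) := by
  cases m with
  | zero =>
    simp only [zero_add, Finset.prod_range_one, rowChoices, Finset.prod_range_zero, hκ]
    rw [sum_upChoices_of_le _ _ (Nat.zero_le _)]
    simp [mul_comm]
  | succ m =>
    rw [Finset.prod_range_succ]
    conv_lhs => enter [2]; rw [rowChoices, hκ]
    rw [sum_upChoices_filter_of_le _ _ (Nat.zero_le _), mul_left_comm, prod_rowChoices,
      Nat.sub_zero]
    ring

theorem mem_rowChoices {σ κ ρ : YoungDiagram} {m C C' : ℕ} (hκ : κ ∈ box m C')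
    (hσ : σ ∈ box (m + 1) C) (hρ : ρ ∈ box (m + 1) (C + 1)) :
    (IsHStrip κ ρ ∧ IsVStrip σ ρ) ↔ ∀ i < m + 1, ρ.rowLen i ∈ rowChoices σ κ i := by
  rw [isHStrip_iff_rowLen, isVStrip_iff_rowLen]
  constructor
  · rintro ⟨h1, h2⟩ i _
    have := h1 i
    have := h2 i
    cases i with
    | zero =>
      simp only [rowChoices, upChoices, Finset.mem_filter, Finset.mem_Icc]; omega
    | succ i =>
      have := h1 i
      simp only [rowChoices, upChoices, Finset.mem_filter, Finset.mem_Icc]; omega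
  · intro h
    have hκ0 : ∀ i, m + 1 ≤ i → κ.rowLen i = 0 :=
      fun i hi => rowLen_eq_zero_of_mem_box hκ (by omega)
    have hσ0 : ∀ i, m + 1 ≤ i → σ.rowLen i = 0 := fun i hi => rowLen_eq_zero_of_mem_box hσ hi
    have hρ0 : ∀ i, m + 1 ≤ i → ρ.rowLen i = 0 := fun i hi => rowLen_eq_zero_of_mem_box hρ hi
    have h1 : ∀ i, κ.rowLen i ≤ ρ.rowLen i ∧ σ.rowLen i ≤ ρ.rowLen i ∧
        ρ.rowLen i ≤ σ.rowLen i + 1 := by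
      intro i
      by_cases hi : i < m + 1
      · have := h i hi
        cases i <;> simp only [rowChoices, upChoices, Finset.mem_filter, Finset.mem_Icc] at this <;>
          omega
      · simp [hκ0 i (by omega), hσ0 i (by omega), hρ0 i (by omega)]
    refine ⟨fun i => ⟨(h1 i).1, ?_⟩, fun i => (h1 i).2⟩
    by_cases hi : i + 1 < m + 1
    · have := h (i + 1) hi
      simp only [rowChoices, upChoices, Finset.mem_filter, Finset.mem_Icc] at this
      omega
    · simp [hρ0 (i + 1) (by omega)]

theorem mem_downChoices {σ κ τ : YoungDiagram} {m C C' : ℕ} (hκ : κ ∈ box m C')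
    (hσ : σ ∈ box (m + 1) C) (hτ : τ ∈ box m C') :
    (IsHStrip τ σ ∧ IsVStrip τ κ) ↔
      ∀ i < m, τ.rowLen i ∈ downChoices (κ.rowLen i) (σ.rowLen i) (σ.rowLen (i + 1)) := by
  rw [isHStrip_iff_rowLen, isVStrip_iff_rowLen]
  simp only [downChoices, Finset.mem_filter, Finset.mem_range]
  constructor
  · rintro ⟨h1, h2⟩ i _
    have := h1 i
    have := h2 i
    omega
  · intro h
    have key : ∀ i, (τ.rowLen i ≤ σ.rowLen i ∧ σ.rowLen (i + 1) ≤ τ.rowLen i) ∧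
        (τ.rowLen i ≤ κ.rowLen i ∧ κ.rowLen i ≤ τ.rowLen i + 1) := by
      intro i
      by_cases hi : i < m
      · have := h i hi
        omega
      · rw [rowLen_eq_zero_of_mem_box hκ (by omega), rowLen_eq_zero_of_mem_box hτ (by omega),
          rowLen_eq_zero_of_mem_box hσ (show m + 1 ≤ i + 1 by omega)]
        omega
    exact ⟨fun i => (key i).1, fun i => (key i).2⟩

theorem card_sub_card {m C : ℕ} {μ ν : YoungDiagram} (h : ν ≤ μ) (hμ : μ ∈ box m C) :
    μ.card - ν.card = ∑ i ∈ Finset.range m, (μ.rowLen i - ν.rowLen i) := by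
  rw [card_eq_sum_rowLen hμ, card_eq_sum_rowLen (mem_box_of_le h hμ),
    Finset.sum_tsub_distrib _ fun i _ => le_iff_rowLen.1 h i]

open Classical in
/-- Adding a horizontal strip and then removing a vertical one, against the opposite order. -/
theorem strip_commutation {m C C' : ℕ} {σ κ : YoungDiagram} (hκ : κ ∈ box m C')
    (hσ : σ ∈ box (m + 1) C) :
    (∑ ρ ∈ box (m + 1) (C + 1), if IsHStrip κ ρ ∧ IsVStrip σ ρ then
        y ^ (ρ.card - κ.card) * x ^ (ρ.card - σ.card) else 0) =
      (1 + x * y) * ∑ τ ∈ box m C', if IsHStrip τ σ ∧ IsVStrip τ κ then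
        y ^ (σ.card - τ.card) * x ^ (κ.card - τ.card) else 0 := by
  have h1 : (∑ ρ ∈ box (m + 1) (C + 1), if IsHStrip κ ρ ∧ IsVStrip σ ρ then
        y ^ (ρ.card - κ.card) * x ^ (ρ.card - σ.card) else 0) =
      ∑ ρ ∈ (box (m + 1) (C + 1)).filter (fun ρ => ∀ i < m + 1, ρ.rowLen i ∈ rowChoices σ κ i),
        ∏ i ∈ Finset.range (m + 1), y ^ (ρ.rowLen i - κ.rowLen i) *
          x ^ (ρ.rowLen i - σ.rowLen i) := by
    -- Both strip conditions are conditions row by row, and the two exponents are sums of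
    -- differences of row lengths, so the weight factors over the rows.
    rw [Finset.sum_filter]
    refine Finset.sum_congr rfl fun ρ hρ => ?_
    refine if_ctx_congr (mem_rowChoices hκ hσ hρ) (fun h => ?_) fun _ => rfl
    rw [← mem_rowChoices hκ hσ hρ] at h
    rw [Finset.prod_mul_distrib, Finset.prod_pow_eq_pow_sum, Finset.prod_pow_eq_pow_sum,
      card_sub_card h.1.1 hρ, card_sub_card h.2.1 hρ]
  have h2 : (∑ τ ∈ box m C', if IsHStrip τ σ ∧ IsVStrip τ κ then
        y ^ (σ.card - τ.card) * x ^ (κ.card - τ.card) else 0) =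
      ∑ τ ∈ (box m C').filter (fun τ => ∀ i < m, τ.rowLen i ∈
          downChoices (κ.rowLen i) (σ.rowLen i) (σ.rowLen (i + 1))),
        y ^ σ.rowLen m * ∏ i ∈ Finset.range m, y ^ (σ.rowLen i - τ.rowLen i) *
          x ^ (κ.rowLen i - τ.rowLen i) := by
    rw [Finset.sum_filter]
    refine Finset.sum_congr rfl fun τ hτ => ?_
    refine if_ctx_congr (mem_downChoices hκ hσ hτ) (fun h => ?_) fun _ => rfl
    rw [← mem_downChoices hκ hσ hτ] at h
    rw [Finset.prod_mul_distrib, Finset.prod_pow_eq_pow_sum, Finset.prod_pow_eq_pow_sum,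
      card_sub_card h.1.1 hσ, card_sub_card h.2.1 hκ, Finset.sum_range_succ,
      rowLen_eq_zero_of_mem_box hτ le_rfl, Nat.sub_zero, pow_add]
    ring
  rw [h1, h2, ← Finset.mul_sum]
  rw [sum_box_eq_prod (m + 1) (C + 1) (rowChoices σ κ)
    (fun i n => y ^ (n - κ.rowLen i) * x ^ (n - σ.rowLen i)),
    sum_box_eq_prod m C' (fun i => downChoices (κ.rowLen i) (σ.rowLen i) (σ.rowLen (i + 1)))
    (fun i n => y ^ (σ.rowLen i - n) * x ^ (κ.rowLen i - n)),
    prod_rowChoices_of_rowLen_eq_zero _ _ (mem_box.1 hκ).1]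
  · intro i _ a ha b hb
    simp only [downChoices, Finset.mem_filter, Finset.mem_range] at ha hb
    omega
  · intro a ha
    have := (mem_box.1 hκ).2
    simp only [downChoices, Finset.mem_filter, Finset.mem_range] at ha
    omega
  · intro i _ a ha b hb
    cases i <;> simp only [rowChoices, upChoices, Finset.mem_filter, Finset.mem_Icc] at ha hb <;>
      omega
  · intro a ha
    have := (mem_box.1 hσ).2
    simp only [rowChoices, upChoices, Finset.mem_filter, Finset.mem_Icc] at ha
    omega

end Commutation


/-! ### Schur polynomials -/

/-- The semistandard tableaux of shape `μ` with entries `< N`, as functions. -/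
def boundedTableaux (μ : YoungDiagram) (N : ℕ) : Set (ℕ → ℕ → ℕ) :=
  {t | (∀ i j, (i, j + 1) ∈ μ → t i j ≤ t i (j + 1)) ∧ (∀ i j, (i + 1, j) ∈ μ → t i j < t (i + 1) j) ∧
    (∀ i j, (i, j) ∉ μ → t i j = 0) ∧ ∀ i j, (i, j) ∈ μ → t i j < N}

theorem coe_mem_boundedTableaux {μ : YoungDiagram} (T : SemistandardYoungTableau μ) {N : ℕ}
    (h : ∀ i j, (i, j) ∈ μ → T i j < N) : ⇑T ∈ boundedTableaux μ N :=
  ⟨fun _ _ hc => T.row_weak (Nat.lt_succ_self _) hc,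
    fun _ _ hc => T.col_strict (Nat.lt_succ_self _) hc, fun _ _ hc => T.zeros hc, h⟩

theorem exists_coe_eq_of_mem_boundedTableaux {μ : YoungDiagram} {N : ℕ} {t : ℕ → ℕ → ℕ}
    (h : t ∈ boundedTableaux μ N) : ∃ T : SemistandardYoungTableau μ, ⇑T = t := by
  obtain ⟨h1, h2, h3, -⟩ := h
  refine ⟨⟨t, ?_, ?_, fun {i j} => h3 i j⟩, rfl⟩
  · intro i j1 j2 hj hc
    obtain ⟨k, rfl⟩ := Nat.exists_eq_add_of_lt hj
    clear hj
    induction k with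
    | zero => exact h1 _ _ hc
    | succ k ih =>
      exact (ih (μ.up_left_mem le_rfl (Nat.le_succ _) hc)).trans (h1 i (j1 + k + 1) hc)
  · intro i1 i2 j hi hc
    obtain ⟨k, rfl⟩ := Nat.exists_eq_add_of_lt hi
    clear hi
    induction k with
    | zero => exact h2 _ _ hc
    | succ k ih =>
      exact (ih (μ.up_left_mem (Nat.le_succ _) le_rfl hc)).trans (h2 (i1 + k + 1) j hc)

theorem boundedTableaux_finite (μ : YoungDiagram) (N : ℕ) : (boundedTableaux μ N).Finite := by
  refine Set.Finite.of_finite_image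
    (f := fun t (c : μ.cells) => (t c.1.1 c.1.2)) (Set.Finite.subset
    (Set.Finite.pi (fun _ : μ.cells => Set.finite_Iio N)) ?_) ?_
  · rintro _ ⟨t, ht, rfl⟩ c _
    exact ht.2.2.2 _ _ c.2
  · intro t ht s hs h
    funext i j
    by_cases hc : (i, j) ∈ μ
    · exact congrFun h ⟨(i, j), hc⟩
    · rw [ht.2.2.1 i j hc, hs.2.2.1 i j hc]

section

variable {R : Type*} [CommRing R]

/-- The Schur polynomial in `w 0, …, w (N - 1)`. -/
noncomputable def schurPoly (μ : YoungDiagram) (N : ℕ) (w : ℕ → R) : R :=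
  ∑ t ∈ (boundedTableaux_finite μ N).toFinset, ∏ c ∈ μ.cells, w (t c.1 c.2)

/-- The cells of a tableau with entries `< N`. -/
def subTableauShape (μ : YoungDiagram) (N : ℕ) (t : ℕ → ℕ → ℕ)
    (h : t ∈ boundedTableaux μ (N + 1)) : YoungDiagram where
  cells := μ.cells.filter fun c => t c.1 c.2 < N
  isLowerSet := by
    obtain ⟨T, rfl⟩ := exists_coe_eq_of_mem_boundedTableaux h
    rintro ⟨a, b⟩ ⟨c, d⟩ ⟨h1, h2⟩ h
    simp only [Finset.coe_filter, Set.mem_ofPred_eq, YoungDiagram.mem_cells] at h h1 h2 ⊢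
    have hm := μ.up_left_mem h1 h2 h.1
    have hm' := μ.up_left_mem h1 le_rfl h.1
    exact ⟨hm, (T.row_weak_of_le h2 hm').trans_lt ((T.col_weak h1 h.1).trans_lt h.2)⟩

theorem mem_subTableauShape {μ : YoungDiagram} {N : ℕ} {t : ℕ → ℕ → ℕ}
    (h : t ∈ boundedTableaux μ (N + 1)) {c : ℕ × ℕ} :
    c ∈ subTableauShape μ N t h ↔ c ∈ μ ∧ t c.1 c.2 < N := by
  rw [← YoungDiagram.mem_cells]
  simp [subTableauShape]

theorem isHStrip_subTableauShape {μ : YoungDiagram} {N : ℕ} {t : ℕ → ℕ → ℕ}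
    (h : t ∈ boundedTableaux μ (N + 1)) : IsHStrip (subTableauShape μ N t h) μ := by
  refine ⟨fun c hc => ((mem_subTableauShape h).1 hc).1, fun i j hc => ?_⟩
  rw [mem_subTableauShape h]
  have h1 := h.2.1 i j hc
  have h2 := h.2.2.2 _ _ hc
  exact ⟨μ.up_left_mem (Nat.le_succ _) le_rfl hc, by simp only; omega⟩

-- The branching rule: in each column the largest letter N occurs at most once, so the cells
-- containing it form a horizontal strip, and the remaining cells carry a tableau with entries below
-- N. The inverse fills the strip with N.
open Classical in
theorem schurPoly_succ {μ : YoungDiagram} {P Q : ℕ} (hμ : μ ∈ box P Q) (N : ℕ) (w : ℕ → R) :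
    schurPoly μ (N + 1) w = ∑ ν ∈ box P Q, if IsHStrip ν μ then
      w N ^ (μ.card - ν.card) * schurPoly ν N w else 0 := by
  rw [← Finset.sum_filter]
  simp only [schurPoly, Finset.mul_sum]
  rw [Finset.sum_sigma']
  refine Finset.sum_bij'
    (fun t ht => ⟨subTableauShape μ N t ((Set.Finite.mem_toFinset _).1 ht),
      fun i j => if (i, j) ∈ subTableauShape μ N t ((Set.Finite.mem_toFinset _).1 ht)
        then t i j else 0⟩)
    (fun p _ i j => if (i, j) ∈ p.1 then p.2 i j else if (i, j) ∈ μ then N else 0) ?_ ?_ ?_ ?_ ?_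
  · intro t ht
    have ht := (Set.Finite.mem_toFinset _).1 ht
    have hs := isHStrip_subTableauShape ht
    simp only [Finset.mem_sigma, Finset.mem_filter, Set.Finite.mem_toFinset]
    refine ⟨⟨mem_box_of_le hs.1 hμ, hs⟩, ?_, ?_, ?_, ?_⟩
    · intro i j hc
      beta_reduce
      rw [if_pos hc, if_pos (YoungDiagram.up_left_mem _ le_rfl (Nat.le_succ _) hc)]
      exact ht.1 i j (hs.1 hc)
    · intro i j hc
      beta_reduce
      rw [if_pos hc, if_pos (YoungDiagram.up_left_mem _ (Nat.le_succ _) le_rfl hc)]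
      exact ht.2.1 i j (hs.1 hc)
    · intro i j hc
      exact if_neg hc
    · intro i j hc
      beta_reduce
      rw [if_pos hc]
      exact ((mem_subTableauShape ht).1 hc).2
  · rintro ⟨ν, t⟩ hp
    simp only [Finset.mem_sigma, Finset.mem_filter, Set.Finite.mem_toFinset] at hp ⊢
    obtain ⟨⟨-, hs⟩, h1, h2, h3, h4⟩ := hp
    refine ⟨?_, ?_, ?_, ?_⟩
    · intro i j hc
      have hc' := μ.up_left_mem le_rfl (Nat.le_succ _) hc
      simp only [hc, hc', if_true]
      by_cases hν : (i, j + 1) ∈ ν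
      · rw [if_pos hν, if_pos (ν.up_left_mem le_rfl (Nat.le_succ _) hν)]
        exact h1 i j hν
      · rw [if_neg hν]
        split_ifs with h
        · exact (h4 _ _ h).le
        · exact le_rfl
    · intro i j hc
      have hc' := μ.up_left_mem (Nat.le_succ _) le_rfl hc
      have hν' := hs.2 i j hc
      simp only [hc, hν', if_true]
      by_cases hν : (i + 1, j) ∈ ν
      · rw [if_pos hν]
        exact h2 i j hν
      · rw [if_neg hν]
        exact h4 _ _ hν'
    · intro i j hc
      beta_reduce
      rw [if_neg fun h => hc (hs.1 h), if_neg hc]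
    · intro i j hc
      beta_reduce
      split_ifs with h
      · exact (h4 _ _ h).trans (Nat.lt_succ_self _)
      · exact Nat.lt_succ_self _
  · intro t ht
    have ht := (Set.Finite.mem_toFinset _).1 ht
    funext i j
    simp only [mem_subTableauShape ht]
    by_cases hc : (i, j) ∈ μ
    · have := ht.2.2.2 i j hc
      simp only [hc, true_and, if_true]
      split_ifs <;> omega
    · simp [hc, ht.2.2.1 i j hc]
  · rintro ⟨ν, t⟩ hp
    simp only [Finset.mem_sigma, Finset.mem_filter, Set.Finite.mem_toFinset] at hp
    obtain ⟨⟨-, hs⟩, h1, h2, h3, h4⟩ := hp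
    -- Equality of dependent pairs is reduced to two pointwise facts about an arbitrary filling:
    -- which of its entries are below N, and its values there.
    have key : ∀ (t' : ℕ → ℕ → ℕ) (ht' : t' ∈ boundedTableaux μ (N + 1)),
        (∀ i j, (i, j) ∈ μ → (t' i j < N ↔ (i, j) ∈ ν)) → (∀ i j, (i, j) ∈ ν → t' i j = t i j) →
        (⟨subTableauShape μ N t' ht', fun i j => if (i, j) ∈ subTableauShape μ N t' ht'
          then t' i j else 0⟩ : Σ _ : YoungDiagram, ℕ → ℕ → ℕ) = ⟨ν, t⟩ := by
      intro t' ht' ha hb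
      have h0 : subTableauShape μ N t' ht' = ν := by
        refine SetLike.ext fun c => ?_
        rw [mem_subTableauShape]
        exact ⟨fun h => (ha _ _ h.1).1 h.2, fun h => ⟨hs.1 h, (ha _ _ (hs.1 h)).2 h⟩⟩
      simp only [h0]
      congr 1
      funext i j
      split_ifs with h
      · exact hb i j h
      · exact (h3 i j h).symm
    apply key
    · intro i j hc
      simp only [hc, if_true]
      split_ifs with h
      · simp [h, h4 i j h]
      · simp [h]
    · intro i j hc
      simp [hc]
  · intro t ht
    have ht := (Set.Finite.mem_toFinset _).1 ht
    have hle := (isHStrip_subTableauShape ht).1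
    simp only
    rw [← Finset.prod_sdiff (YoungDiagram.cells_subset_iff.2 hle)]
    congr 1
    · rw [Finset.prod_congr rfl (g := fun _ => w N), Finset.prod_const,
        Finset.card_sdiff_of_subset (YoungDiagram.cells_subset_iff.2 hle)]
      rintro ⟨i, j⟩ hc
      simp only [Finset.mem_sdiff, YoungDiagram.mem_cells, mem_subTableauShape ht] at hc
      have := ht.2.2.2 _ _ hc.1
      congr 1
      simp only at hc ⊢
      have := hc.2
      simp only [hc.1, true_and] at this
      omega
    · refine Finset.prod_congr rfl fun c hc => ?_
      rw [if_pos]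
      exact hc

theorem le_of_mem_boundedTableaux {μ : YoungDiagram} {N : ℕ} {t : ℕ → ℕ → ℕ}
    (h : t ∈ boundedTableaux μ N) {i j : ℕ} (hc : (i, j) ∈ μ) : i ≤ t i j := by
  induction i with
  | zero => exact Nat.zero_le _
  | succ i ih =>
    have h1 := ih (μ.up_left_mem (Nat.le_succ _) le_rfl hc)
    have h2 := h.2.1 i j hc
    omega

/-- Entries increase strictly down the first column, so more than N rows would need more than N
letters. -/
theorem schurPoly_eq_zero {μ : YoungDiagram} {N : ℕ} (w : ℕ → R) (h : N < μ.colLen 0) :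
    schurPoly μ N w = 0 := by
  rw [schurPoly, Finset.sum_eq_zero]
  intro t ht
  have ht := (Set.Finite.mem_toFinset _).1 ht
  have hc := YoungDiagram.mem_iff_lt_colLen.2 h
  have h1 := le_of_mem_boundedTableaux ht hc
  have h2 := ht.2.2.2 _ _ hc
  omega

theorem schurPoly_bot (N : ℕ) (w : ℕ → R) : schurPoly ⊥ N w = 1 := by
  have : (boundedTableaux_finite ⊥ N).toFinset = {fun _ _ => 0} := by
    ext t
    simp only [Set.Finite.mem_toFinset, Finset.mem_singleton]
    constructor
    · intro h
      funext i j
      exact h.2.2.1 i j (YoungDiagram.notMem_bot _)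
    · rintro rfl
      exact ⟨fun _ _ _ => le_rfl, fun _ _ h => absurd h (YoungDiagram.notMem_bot _),
        fun _ _ _ => rfl, fun _ _ h => absurd h (YoungDiagram.notMem_bot _)⟩
  rw [schurPoly, this]
  simp

theorem schurPoly_zero (μ : YoungDiagram) (w : ℕ → R) [Decidable (μ = ⊥)] :
    schurPoly μ 0 w = if μ = ⊥ then 1 else 0 := by
  split_ifs with h
  · rw [h, schurPoly_bot]
  · refine schurPoly_eq_zero w (Nat.pos_of_ne_zero fun h0 => h ?_)
    refine SetLike.ext fun ⟨i, j⟩ => ?_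
    simp only [YoungDiagram.notMem_bot, iff_false]
    intro hc
    have := YoungDiagram.mem_iff_lt_colLen.1 (μ.up_left_mem le_rfl (Nat.zero_le j) hc)
    omega

/-! ### The dual Cauchy identity -/

theorem transpose_mem_box {μ : YoungDiagram} {P Q : ℕ} :
    μ.transpose ∈ box Q P ↔ μ ∈ box P Q := by
  have key : ∀ {μ : YoungDiagram} {P Q : ℕ}, μ ∈ box P Q → μ.transpose ∈ box Q P := by
    intro μ P Q h
    simp only [box, Set.Finite.mem_toFinset, Set.mem_ofPred_eq] at h ⊢
    intro c hc
    have := h (YoungDiagram.mem_transpose.1 hc)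
    rw [mem_rectangle] at this ⊢
    exact this.symm
  exact ⟨fun h => μ.transpose_transpose ▸ key h, key⟩

theorem card_transpose (μ : YoungDiagram) : μ.transpose.card = μ.card := by
  simp [YoungDiagram.card, YoungDiagram.transpose]

open Classical in
theorem schurPoly_transpose_succ {μ : YoungDiagram} {P Q : ℕ} (hμ : μ ∈ box P Q) (N : ℕ)
    (w : ℕ → R) :
    schurPoly μ.transpose (N + 1) w = ∑ ν ∈ box P Q, if IsVStrip ν μ then
      w N ^ (μ.card - ν.card) * schurPoly ν.transpose N w else 0 := by
  rw [schurPoly_succ (transpose_mem_box.2 hμ)]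
  refine Finset.sum_nbij' YoungDiagram.transpose YoungDiagram.transpose ?_ ?_ ?_ ?_ ?_
  · exact fun ν hν => transpose_mem_box.2 hν
  · exact fun ν hν => transpose_mem_box.2 hν
  · exact fun ν _ => ν.transpose_transpose
  · exact fun ν _ => ν.transpose_transpose
  · intro ν _
    rw [← isHStrip_transpose, ν.transpose_transpose, card_transpose, card_transpose]

theorem schurPoly_transpose_eq_zero {μ : YoungDiagram} {M : ℕ} (w : ℕ → R)
    (h : M < μ.rowLen 0) : schurPoly μ.transpose M w = 0 :=
  schurPoly_eq_zero w (by rwa [YoungDiagram.colLen_transpose])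

theorem sum_box_schurPoly_transpose {P Q Q' M : ℕ} (hM : M ≤ Q) (hQ : Q ≤ Q') (x : ℕ → R)
    (f : YoungDiagram → R) :
    ∑ σ ∈ box P Q', f σ * schurPoly σ.transpose M x =
      ∑ σ ∈ box P Q, f σ * schurPoly σ.transpose M x := by
  symm
  refine Finset.sum_subset (box_mono le_rfl hQ) fun σ h1 h2 => ?_
  rw [schurPoly_transpose_eq_zero, mul_zero]
  simp only [mem_box] at h1 h2
  omega

theorem bot_mem_box (P Q : ℕ) : (⊥ : YoungDiagram) ∈ box P Q := by
  rw [box, Set.Finite.mem_toFinset]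
  exact bot_le (a := rectangle P Q)

open Classical in
/-- The dual Pieri rule. -/
theorem dual_pieri (y : R) (x : ℕ → R) (M : ℕ) : ∀ {P Q : ℕ} {κ : YoungDiagram}, κ ∈ box P Q →
    ∑ ρ ∈ box (P + 1) M, (if IsHStrip κ ρ then y ^ (ρ.card - κ.card) else 0) *
      schurPoly ρ.transpose M x =
    (∏ j ∈ Finset.range M, (1 + x j * y)) * schurPoly κ.transpose M x := by
  induction M with
  | zero =>
    intro P Q κ hκ
    rw [Finset.prod_range_zero, one_mul, Finset.sum_eq_single_of_mem ⊥ (bot_mem_box _ _)]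
    · rw [show (⊥ : YoungDiagram).transpose = ⊥ from rfl, schurPoly_bot]
      by_cases h : κ = ⊥
      · subst h
        rw [if_pos ⟨le_rfl, fun i j hc => absurd hc (YoungDiagram.notMem_bot _)⟩]
        rw [show (⊥ : YoungDiagram).transpose = ⊥ from rfl, schurPoly_bot]
        simp
      · rw [if_neg fun h' => h (le_bot_iff.1 h'.1), schurPoly_zero, if_neg, zero_mul]
        rw [YoungDiagram.transpose_eq_iff_eq_transpose]
        exact h
    · intro ρ hρ h
      rw [schurPoly_zero ρ.transpose, if_neg (c := ρ.transpose = ⊥), mul_zero]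
      rw [YoungDiagram.transpose_eq_iff_eq_transpose]
      exact h
  | succ M ih =>
    intro P Q κ hκ
    have h1 : ∀ ρ ∈ box (P + 1) (M + 1), schurPoly ρ.transpose (M + 1) x =
        ∑ σ ∈ box (P + 1) M, (if IsVStrip σ ρ then x M ^ (ρ.card - σ.card) else 0) *
          schurPoly σ.transpose M x := by
      intro ρ hρ
      rw [schurPoly_transpose_succ hρ, ← sum_box_schurPoly_transpose le_rfl (Nat.le_succ M)]
      refine Finset.sum_congr rfl fun σ _ => ?_
      split_ifs <;> simp
    have h2 : schurPoly κ.transpose (M + 1) x =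
        ∑ τ ∈ box P Q, (if IsVStrip τ κ then x M ^ (κ.card - τ.card) else 0) *
          schurPoly τ.transpose M x := by
      rw [schurPoly_transpose_succ hκ]
      refine Finset.sum_congr rfl fun σ _ => ?_
      split_ifs <;> simp
    -- The last variable x_M is split off as a vertical strip ρ/σ. Commuting it past the horizontal
    -- strip ρ/κ produces 1 + x_M y, and leaves sums over σ in M variables to which the induction
    -- hypothesis applies for each τ.
    calc _ = ∑ σ ∈ box (P + 1) M, schurPoly σ.transpose M x * ∑ ρ ∈ box (P + 1) (M + 1),
          if IsHStrip κ ρ ∧ IsVStrip σ ρ then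
            y ^ (ρ.card - κ.card) * x M ^ (ρ.card - σ.card) else 0 := by
          simp only [Finset.mul_sum]
          rw [Finset.sum_comm]
          refine Finset.sum_congr rfl fun ρ hρ => ?_
          rw [h1 ρ hρ, Finset.mul_sum]
          refine Finset.sum_congr rfl fun σ _ => ?_
          by_cases ha : IsHStrip κ ρ <;> by_cases hb : IsVStrip σ ρ <;> simp [ha, hb] ; ring
      _ = (1 + x M * y) * ∑ τ ∈ box P Q, (if IsVStrip τ κ then x M ^ (κ.card - τ.card) else 0) *
          ∑ σ ∈ box (P + 1) M, (if IsHStrip τ σ then y ^ (σ.card - τ.card) else 0) *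
            schurPoly σ.transpose M x := by
          simp only [Finset.mul_sum]
          rw [Finset.sum_comm (s := box P Q)]
          refine Finset.sum_congr rfl fun σ hσ => ?_
          rw [← Finset.mul_sum, strip_commutation _ _ hκ hσ, Finset.mul_sum, Finset.mul_sum]
          refine Finset.sum_congr rfl fun τ _ => ?_
          by_cases ha : IsHStrip τ σ <;> by_cases hb : IsVStrip τ κ <;> simp [ha, hb] ; ring
      _ = _ := by
          rw [h2, Finset.prod_range_succ, mul_comm (∏ j ∈ Finset.range M, _), mul_assoc]
          congr 1
          rw [Finset.mul_sum]
          refine Finset.sum_congr rfl fun τ hτ => ?_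
          rw [ih hτ]
          ring

/-- The dual Cauchy identity. -/
theorem dual_cauchy (w x : ℕ → R) (N M : ℕ) : ∀ {P : ℕ}, N ≤ P →
    ∑ μ ∈ box P M, schurPoly μ N w * schurPoly μ.transpose M x =
      ∏ i ∈ Finset.range N, ∏ j ∈ Finset.range M, (1 + x j * w i) := by
  classical
  induction N with
  | zero =>
    intro P _
    rw [Finset.prod_range_zero, Finset.sum_eq_single_of_mem ⊥ (bot_mem_box _ _)]
    · rw [show (⊥ : YoungDiagram).transpose = ⊥ from rfl, schurPoly_bot, schurPoly_bot, one_mul]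
    · intro μ _ h
      rw [schurPoly_zero, if_neg h, zero_mul]
  | succ N ih =>
    intro P hP
    obtain ⟨P, rfl⟩ : ∃ P', P = P' + 1 := ⟨P - 1, by omega⟩
    rw [Finset.prod_range_succ, ← ih (show N ≤ P by omega), Finset.sum_mul]
    have h1 : ∀ μ ∈ box (P + 1) M, schurPoly μ (N + 1) w = ∑ ν ∈ box P M, if IsHStrip ν μ then
        w N ^ (μ.card - ν.card) * schurPoly ν N w else 0 := by
      intro μ hμ
      rw [schurPoly_succ hμ]
      symm
      refine Finset.sum_subset (box_mono (Nat.le_succ _) le_rfl) fun ν h1 h2 => ?_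
      split_ifs with h
      -- A diagram in the larger box but not in the smaller one has more than P rows, and only N ≤ P
      -- letters remain.
      · rw [schurPoly_eq_zero, mul_zero]
        have : ν.rowLen P ≠ 0 := by
          simp only [mem_box] at h1 h2
          omega
        have := YoungDiagram.mem_iff_lt_colLen.1
          (YoungDiagram.mem_iff_lt_rowLen.2 (Nat.pos_of_ne_zero this))
        omega
      · rfl
    rw [Finset.sum_congr rfl fun μ hμ => by rw [h1 μ hμ, Finset.sum_mul], Finset.sum_comm]
    refine Finset.sum_congr rfl fun ν hν => ?_
    rw [mul_assoc, mul_comm (schurPoly ν.transpose M x), ← dual_pieri (w N) x M hν, Finset.mul_sum]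
    refine Finset.sum_congr rfl fun μ _ => ?_
    split_ifs <;> ring

end


/-! ### Schur functions and the series `∑ a_μ s_{μ'}` -/

theorem schurEval_eq_schurPoly {R : Type*} [CommRing R] (μ : YoungDiagram) (l : List R) :
    schurEval μ l = schurPoly μ l.length fun i => l.getD i 0 := by
  have h1 := finsum_mem_range (f := fun t : ℕ → ℕ → ℕ => ∏ c ∈ μ.cells, l.getD (t c.1 c.2) 0)
    (g := fun T : SemistandardYoungTableau μ => ⇑T) DFunLike.coe_injective
  rw [schurEval, ← h1, schurPoly]
  refine finsum_mem_eq_sum_of_inter_support_eq _ ?_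
  ext t
  simp only [Set.mem_inter_iff, Set.mem_range, Function.mem_support, Set.Finite.coe_toFinset]
  refine and_congr_left fun h => ⟨?_, fun ht => exists_coe_eq_of_mem_boundedTableaux ht⟩
  rintro ⟨T, rfl⟩
  refine coe_mem_boundedTableaux T fun i j hc => ?_
  by_contra! hl
  -- An entry beyond the end of the list picks up the default value 0, so tableaux with such an
  -- entry lie outside the support.
  refine h (Finset.prod_eq_zero (i := (i, j)) hc ?_)
  exact List.getD_eq_default _ _ hl

/-- The exponent of the monomial of a filling `t` of the cells of `μ`. -/
noncomputable def fillingContent (μ : YoungDiagram) (t : ℕ → ℕ → ℕ) : ℕ →₀ ℕ :=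
  ∑ c ∈ μ.cells, Finsupp.single (t c.1 c.2) 1

theorem content_eq {μ : YoungDiagram} (T : SemistandardYoungTableau μ) :
    content T = fillingContent μ T := rfl

theorem prod_X_eq_monomial {R : Type*} [CommRing R] (μ : YoungDiagram) (t : ℕ → ℕ → ℕ) :
    ∏ c ∈ μ.cells, (MvPowerSeries.X (t c.1 c.2) : MvPowerSeries ℕ R) =
      MvPowerSeries.monomial (fillingContent μ t) 1 := by
  unfold fillingContent
  induction μ.cells using Finset.induction_on with
  | empty => simp
  | insert c s hc ih =>
    rw [Finset.prod_insert hc, Finset.sum_insert hc, ih, MvPowerSeries.X,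
      MvPowerSeries.monomial_mul_monomial, one_mul]

theorem apply_mem_support_fillingContent {μ : YoungDiagram} {t : ℕ → ℕ → ℕ} {i j : ℕ}
    (h : (i, j) ∈ μ) : t i j ∈ (fillingContent μ t).support := by
  rw [Finsupp.mem_support_iff, fillingContent, Finsupp.finsetSum_apply]
  refine (Finset.sum_pos' (fun _ _ => Nat.zero_le _) ⟨(i, j), h, ?_⟩).ne'
  simp

/-- Every entry of a tableau of content m lies in the support of m, so letters ≥ M play no part and
the finite-variable polynomial can be used. -/
theorem coeff_schur_eq {R : Type*} [CommRing R] (μ : YoungDiagram) {m : ℕ →₀ ℕ} {M : ℕ}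
    (hm : ∀ i ∈ m.support, i < M) :
    MvPowerSeries.coeff m (schur R μ) =
      MvPowerSeries.coeff m (schurPoly μ M (MvPowerSeries.X : ℕ → MvPowerSeries ℕ R)) := by
  classical
  simp only [schurPoly, map_sum, prod_X_eq_monomial, MvPowerSeries.coeff_monomial]
  rw [Finset.sum_boole]
  change ((Nat.card _ : ℕ) : R) = _
  congr 1
  have h1 := Nat.card_image_of_injective (f := fun T : SemistandardYoungTableau μ => (⇑T : ℕ → ℕ → ℕ))
    DFunLike.coe_injective {T | content T = m}
  refine h1.symm.trans ?_
  rw [Nat.card_coe_set_eq, ← Set.ncard_coe_finset]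
  congr 1
  ext t
  simp only [Set.mem_image, Set.mem_ofPred_eq, Finset.coe_filter, Set.Finite.mem_toFinset]
  constructor
  · rintro ⟨T, hT, rfl⟩
    refine ⟨coe_mem_boundedTableaux T fun i j hc => hm _ ?_, ?_⟩
    · rw [← hT]
      exact apply_mem_support_fillingContent hc
    · rw [← hT, content_eq]
  · rintro ⟨h1, h2⟩
    obtain ⟨T, rfl⟩ := exists_coe_eq_of_mem_boundedTableaux h1
    exact ⟨T, by rw [h2, content_eq], rfl⟩

theorem degree_content {μ : YoungDiagram} (T : SemistandardYoungTableau μ) :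
    (content T).degree = μ.card := by
  rw [content, map_sum]
  simp

theorem exists_tableau_of_coeff_schur_ne_zero {R : Type*} [CommRing R] {μ : YoungDiagram}
    {m : ℕ →₀ ℕ} (h : MvPowerSeries.coeff m (schur R μ) ≠ 0) :
    ∃ T : SemistandardYoungTableau μ, content T = m := by
  by_contra! hc
  refine h ?_
  change ((Nat.card _ : ℕ) : R) = 0
  have : IsEmpty {T : SemistandardYoungTableau μ // content T = m} := ⟨fun T => hc T.1 T.2⟩
  simp

theorem rowLen_zero_le_card (μ : YoungDiagram) : μ.rowLen 0 ≤ μ.card := by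
  rw [YoungDiagram.rowLen_eq_card]
  exact Finset.card_le_card (Finset.filter_subset _ _)

theorem colLen_zero_le_card (μ : YoungDiagram) : μ.colLen 0 ≤ μ.card := by
  rw [YoungDiagram.colLen_eq_card]
  exact Finset.card_le_card (Finset.filter_subset _ _)

theorem mem_box_card {μ : YoungDiagram} {P Q : ℕ} (hP : μ.card ≤ P) (hQ : μ.card ≤ Q) :
    μ ∈ box P Q := by
  rw [mem_box]
  refine ⟨?_, (rowLen_zero_le_card μ).trans hQ⟩
  by_contra hc
  have h1 := YoungDiagram.mem_iff_lt_colLen.1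
    (YoungDiagram.mem_iff_lt_rowLen.2 (Nat.pos_of_ne_zero hc))
  have h2 := μ.colLen_anti 0 0 le_rfl
  have h3 := colLen_zero_le_card μ
  omega

theorem card_eq_degree_of_coeff_schur_ne_zero {R : Type*} [CommRing R] {μ : YoungDiagram}
    {m : ℕ →₀ ℕ} (h : MvPowerSeries.coeff m (schur R μ) ≠ 0) : μ.card = m.degree := by
  obtain ⟨T, rfl⟩ := exists_tableau_of_coeff_schur_ne_zero h
  exact (degree_content T).symm

theorem coeff_schurSum (a : YoungDiagram → ℂ) (m : ℕ →₀ ℕ) {P Q : ℕ} (hP : m.degree ≤ P)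
    (hQ : m.degree ≤ Q) :
    MvPowerSeries.coeff m (schurSum a) =
      ∑ μ ∈ box P Q, a μ * MvPowerSeries.coeff m (schur ℂ μ.transpose) := by
  refine finsum_eq_sum_of_support_subset _ fun μ hμ => ?_
  have h1 := card_eq_degree_of_coeff_schur_ne_zero (right_ne_zero_of_mul hμ)
  rw [card_transpose] at h1
  exact mem_box_card (by omega) (by omega)

/-- The dual Cauchy identity in the ring of power series, with the members of `l` as constants in
one set of variables and x_0, …, x_{M-1} in the other. The box has to contain every diagram of size
|m| and, for the identity, at least as many rows as `l` has members. -/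
theorem coeff_schurSum_schurEval (l : List ℂ) (m : ℕ →₀ ℕ) {M : ℕ}
    (hm : ∀ i ∈ m.support, i < M) :
    MvPowerSeries.coeff m (schurSum fun μ => schurEval μ l) =
      MvPowerSeries.coeff m (∏ j ∈ Finset.range M,
        (l.map fun ω => 1 + MvPowerSeries.X j * MvPowerSeries.C ω).prod) := by
  set P := max m.degree l.length
  set Q := max m.degree M
  have hM : M ≤ Q := le_max_right _ _
  rw [coeff_schurSum _ m (le_max_left m.degree l.length) (le_max_left m.degree M)]
  have h1 : ∀ μ : YoungDiagram, schurEval μ l * MvPowerSeries.coeff m (schur ℂ μ.transpose) =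
      MvPowerSeries.coeff m (schurPoly μ l.length
        (fun i => (MvPowerSeries.C (l.getD i 0) : MvPowerSeries ℕ ℂ)) *
        schurPoly μ.transpose M MvPowerSeries.X) := by
    intro μ
    have : schurPoly μ l.length (fun i => (MvPowerSeries.C (l.getD i 0) : MvPowerSeries ℕ ℂ)) =
        MvPowerSeries.C (schurEval μ l) := by
      rw [schurEval_eq_schurPoly]
      simp only [schurPoly, map_sum, map_prod]
    rw [this, MvPowerSeries.coeff_C_mul, coeff_schur_eq _ hm]
  simp only [h1]
  rw [← map_sum, sum_box_schurPoly_transpose le_rfl hM, dual_cauchy _ _ _ _ (le_max_right _ _),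
    Finset.prod_comm]
  congr 1
  refine Finset.prod_congr rfl fun j _ => ?_
  rw [Finset.prod_range, ← List.prod_ofFn]
  congr 1
  exact List.ext_getElem (by simp) fun i h1 h2 => by simp

/-! ### Triangularity of the Kostka numbers -/

/-- The statistic `n(μ) = ∑ i μ_i`. -/
def rowWeight (μ : YoungDiagram) : ℕ := ∑ c ∈ μ.cells, c.1

theorem sum_entries_eq {μ ν : YoungDiagram} (T : SemistandardYoungTableau μ)
    (T' : SemistandardYoungTableau ν) (h : content T = content T') :
    ∑ c ∈ μ.cells, T c.1 c.2 = ∑ c ∈ ν.cells, T' c.1 c.2 := by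
  have key : ∀ {μ : YoungDiagram} (T : SemistandardYoungTableau μ),
      ∑ c ∈ μ.cells, T c.1 c.2 = Finsupp.linearCombination ℕ (fun i : ℕ => i) (content T) := by
    intro μ T
    rw [content, map_sum]
    simp
  rw [key T, key T', h]

theorem le_entry {μ : YoungDiagram} (T : SemistandardYoungTableau μ) {i j : ℕ} (hc : (i, j) ∈ μ) :
    i ≤ T i j := by
  induction i with
  | zero => exact Nat.zero_le _
  | succ i ih =>
    have h1 := ih (μ.up_left_mem (Nat.le_succ _) le_rfl hc)
    have h2 := T.col_strict (Nat.lt_add_one i) hc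
    omega

theorem sum_highestWeight (ν : YoungDiagram) :
    ∑ c ∈ ν.cells, SemistandardYoungTableau.highestWeight ν c.1 c.2 = rowWeight ν :=
  Finset.sum_congr rfl fun c hc => by
    rw [SemistandardYoungTableau.highestWeight_apply, if_pos ((YoungDiagram.mem_cells c).1 hc)]

/-- The content determines the sum of the entries. An entry in row i is at least i, with equality
throughout for the highest weight tableau, which gives the comparison. -/
theorem rowWeight_le {μ ν : YoungDiagram} (T : SemistandardYoungTableau μ)
    (h : content T = content (SemistandardYoungTableau.highestWeight ν)) :
    rowWeight μ ≤ rowWeight ν := by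
  rw [← sum_highestWeight ν, ← sum_entries_eq T _ h]
  exact Finset.sum_le_sum fun c hc => le_entry T ((YoungDiagram.mem_cells c).1 hc)

/-- In the case of equality of the two sums, every inequality i ≤ T(i, j) has to be an equality. -/
theorem eq_highestWeight_of_rowWeight_le {μ ν : YoungDiagram} (T : SemistandardYoungTableau μ)
    (h : content T = content (SemistandardYoungTableau.highestWeight ν))
    (hle : rowWeight ν ≤ rowWeight μ) : T = SemistandardYoungTableau.highestWeight μ := by
  rw [← sum_highestWeight ν, ← sum_entries_eq T _ h] at hle
  have h1 := (Finset.sum_eq_sum_iff_of_le (s := μ.cells) (f := fun c => c.1)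
    (g := fun c => T c.1 c.2) fun c hc => le_entry T ((YoungDiagram.mem_cells c).1 hc)).1
    (le_antisymm (Finset.sum_le_sum fun c hc => le_entry T ((YoungDiagram.mem_cells c).1 hc)) hle)
  ext i j
  rw [SemistandardYoungTableau.highestWeight_apply]
  split_ifs with hc
  · exact (h1 (i, j) hc).symm
  · exact T.zeros hc

theorem content_highestWeight_apply (μ : YoungDiagram) (i : ℕ) :
    content (SemistandardYoungTableau.highestWeight μ) i = μ.rowLen i := by
  rw [content, Finsupp.finsetSum_apply, YoungDiagram.rowLen_eq_card, YoungDiagram.row,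
    Finset.card_filter]
  refine Finset.sum_congr rfl fun c hc => ?_
  rw [SemistandardYoungTableau.highestWeight_apply, if_pos ((YoungDiagram.mem_cells c).1 hc),
    Finsupp.single_apply]

theorem coeff_schur_highestWeight (ν : YoungDiagram) :
    MvPowerSeries.coeff (content (SemistandardYoungTableau.highestWeight ν)) (schur ℂ ν) = 1 := by
  change ((Nat.card _ : ℕ) : ℂ) = 1
  rw [Nat.cast_eq_one, Nat.card_eq_one_iff_unique]
  refine ⟨⟨fun T T' => Subtype.ext ?_⟩, ⟨_, rfl⟩⟩
  rw [eq_highestWeight_of_rowWeight_le T.1 T.2 le_rfl,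
    eq_highestWeight_of_rowWeight_le T'.1 T'.2 le_rfl]

theorem rowWeight_lt_of_coeff_schur_ne_zero {μ ν : YoungDiagram} (hne : μ ≠ ν)
    (h : MvPowerSeries.coeff (content (SemistandardYoungTableau.highestWeight ν)) (schur ℂ μ) ≠ 0) :
    rowWeight μ < rowWeight ν := by
  obtain ⟨T, hT⟩ := exists_tableau_of_coeff_schur_ne_zero h
  refine lt_of_le_of_ne (rowWeight_le T hT) fun he => hne ?_
  rw [eq_highestWeight_of_rowWeight_le T hT he.ge] at hT
  refine youngDiagram_ext_rowLen fun i => ?_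
  rw [← content_highestWeight_apply, hT, content_highestWeight_apply]

/-- If `∑ a_μ s_{μ'}` converges coefficientwise then so does each `a_μ`. -/
theorem tendsto_of_tendsto_coeff_schurSum (a : ℕ → YoungDiagram → ℂ)
    (h : ∀ m : ℕ →₀ ℕ, ∃ z, Tendsto (fun n => MvPowerSeries.coeff m (schurSum (a n))) atTop (𝓝 z))
    (μ : YoungDiagram) : ∃ z, Tendsto (fun n => a n μ) atTop (𝓝 z) := by
  classical
  suffices H : ∀ N, ∀ ν : YoungDiagram, rowWeight ν = N →
      ∃ z, Tendsto (fun n => a n ν.transpose) atTop (𝓝 z) by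
    have := H _ μ.transpose rfl
    rwa [μ.transpose_transpose] at this
  intro N
  induction N using Nat.strong_induction_on with
  | _ N ih =>
  intro ν hν
  set m := content (SemistandardYoungTableau.highestWeight ν) with hmdef
  have hmem : ν.transpose ∈ box m.degree m.degree := by
    rw [hmdef, degree_content, ← card_transpose]
    exact mem_box_card le_rfl le_rfl
  -- The monomial of weight ν occurs with coefficient 1 in s_ν, and otherwise only in s_μ with
  -- `rowWeight μ < rowWeight ν`; these are covered by induction.
  have hsum : ∀ n, a n ν.transpose = MvPowerSeries.coeff m (schurSum (a n)) -
      ∑ μ ∈ (box m.degree m.degree).erase ν.transpose,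
        a n μ * MvPowerSeries.coeff m (schur ℂ μ.transpose) := by
    intro n
    rw [coeff_schurSum (a n) m le_rfl le_rfl, ← Finset.add_sum_erase _ _ hmem,
      ν.transpose_transpose, coeff_schur_highestWeight]
    ring
  simp only [hsum]
  obtain ⟨z, hz⟩ := h m
  have hterm : ∀ μ ∈ (box m.degree m.degree).erase ν.transpose, ∃ z,
      Tendsto (fun n => a n μ * MvPowerSeries.coeff m (schur ℂ μ.transpose)) atTop (𝓝 z) := by
    intro μ hμ
    by_cases h0 : MvPowerSeries.coeff m (schur ℂ μ.transpose) = 0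
    · exact ⟨0, by simp [h0]⟩
    · have hne : μ.transpose ≠ ν := fun h' => (Finset.ne_of_mem_erase hμ)
        (YoungDiagram.transpose_eq_iff_eq_transpose.1 h')
      obtain ⟨z, hz⟩ := ih _ (hν ▸ rowWeight_lt_of_coeff_schur_ne_zero hne h0) μ.transpose rfl
      rw [μ.transpose_transpose] at hz
      exact ⟨_, hz.mul_const _⟩
  choose! f hf using hterm
  exact ⟨_, hz.sub (tendsto_finsetSum _ hf)⟩


/-! ### Infinite sums of Laurent series -/

open WithZero in
theorem exists_lt_of_mem_nhds {a : ℚ⸨X⸩} {U : Set ℚ⸨X⸩} (hU : U ∈ 𝓝 a) :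
    ∃ D : ℤ, ∀ b : ℚ⸨X⸩, (∀ n < D, b.coeff n = a.coeff n) → b ∈ U := by
  obtain ⟨γ, hγ⟩ := Valued.mem_nhds.1 hU
  set g : ℤᵐ⁰ := MonoidWithZeroHom.ValueGroup₀.embedding γ.1 with hg
  have hg0 : g ≠ 0 := by
    rw [hg]
    simp
  -- Valuations lie in the discrete group ℤ, so the strict bound by g becomes a weak bound one step
  -- lower; this is the 1 in 1 - log g.
  refine ⟨1 - log g, fun b hb => hγ ?_⟩
  simp only [Set.mem_ofPred_eq]
  rw [Valuation.restrict_lt_iff_lt_embedding]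
  refine lt_of_le_of_lt ((LaurentSeries.valuation_le_iff_coeff_lt_eq_zero ℚ (D := 1 - log g)).2
    fun n hn => ?_) ?_
  · rw [HahnSeries.coeff_sub, hb n hn, sub_self]
  · rw [← hg, ← lt_log_iff_exp_lt hg0]
    omega

/-- Below any exponent D only finitely many terms are visible, so partial sums containing them agree
with s below D, which is z-adic closeness. -/
theorem hasSum_laurent {ι : Type*} {f : ι → ℚ⸨X⸩} {s : ℚ⸨X⸩}
    (h : ∀ D : ℤ, {i | ∃ n < D, (f i).coeff n ≠ 0}.Finite)
    (hs : ∀ n, s.coeff n = ∑ᶠ i, (f i).coeff n) : HasSum f s := by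
  rw [HasSum]
  intro U hU
  obtain ⟨D, hD⟩ := exists_lt_of_mem_nhds hU
  simp only [SummationFilter.unconditional_filter, mem_map]
  refine mem_of_superset (mem_atTop (h D).toFinset) fun S hS => hD _ fun n hn => ?_
  rw [hs, HahnSeries.coeff_sum, finsum_eq_sum_of_support_subset]
  intro i hi
  exact hS ((h D).mem_toFinset.2 ⟨n, hn, hi⟩)

theorem summable_laurent {ι : Type*} {f : ι → ℚ⸨X⸩}
    (h : ∀ D : ℤ, {i | ∃ n < D, (f i).coeff n ≠ 0}.Finite) : Summable f := by
  have hb : BddBelow (Function.support fun n : ℤ => ∑ᶠ i, (f i).coeff n) := by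
    -- Only finitely many terms have a polar part, so the pole orders are bounded and the
    -- coefficientwise sum is again a Laurent series.
    have h1 : BddBelow ((h 0).toFinset.image fun i => (f i).order : Set ℤ) :=
      Set.Finite.bddBelow (Finset.finite_toSet _)
    obtain ⟨b, hb⟩ := h1
    refine ⟨min b 0, fun n hn => ?_⟩
    by_contra! hlt
    rw [lt_min_iff] at hlt
    obtain ⟨i, hi⟩ : ∃ i, (f i).coeff n ≠ 0 := by
      by_contra! hc
      exact hn (finsum_eq_zero_of_forall_eq_zero hc)
    have h2 : b ≤ (f i).order := hb (Finset.mem_coe.2 (Finset.mem_image_of_mem _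
      ((h 0).mem_toFinset.2 ⟨n, hlt.2, hi⟩)))
    have h3 := HahnSeries.order_le_of_coeff_ne_zero hi
    omega
  exact ⟨HahnSeries.ofSuppBddBelow _ hb, hasSum_laurent h fun n => rfl⟩

theorem hasSum_coe_powerSeries {ι : Type*} {p : ι → PowerSeries ℚ}
    (h : ∀ N, {i | PowerSeries.coeff N (p i) ≠ 0}.Finite) :
    HasSum (fun i => HahnSeries.ofPowerSeries ℤ ℚ (p i))
      (HahnSeries.ofPowerSeries ℤ ℚ (PowerSeries.mk fun N => ∑ᶠ i, PowerSeries.coeff N (p i))) := by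
  refine hasSum_laurent (fun D => ?_) fun n => ?_
  · refine ((Finset.range D.toNat).finite_toSet.biUnion fun N _ => h N).subset ?_
    rintro i ⟨n, hn, hi⟩
    rw [PowerSeries.coeff_coe] at hi
    simp only [Set.mem_iUnion]
    split_ifs at hi with h0
    · exact absurd rfl hi
    · exact ⟨n.natAbs, Finset.mem_coe.2 (Finset.mem_range.2 (by omega)), hi⟩
  · simp only [PowerSeries.coeff_coe]
    split_ifs with h0
    · simp
    · simp

theorem coeff_mul_eq_zero_of_lt {a b : ℚ⸨X⸩} {A B : ℤ} (ha : ∀ n < A, a.coeff n = 0)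
    (hb : ∀ n < B, b.coeff n = 0) : ∀ n < A + B, (a * b).coeff n = 0 := by
  intro n hn
  rw [HahnSeries.coeff_mul]
  refine Finset.sum_eq_zero fun p hp => ?_
  rw [Finset.mem_antidiagonal] at hp
  by_cases h : p.1 < A
  · rw [ha _ h, zero_mul]
  · rw [hb _ (by omega), mul_zero]

theorem exists_coeff_eq_zero_of_lt (a : ℚ⸨X⸩) : ∃ A : ℕ, ∀ n < -(A : ℤ), a.coeff n = 0 := by
  refine ⟨a.order.natAbs, fun n hn => HahnSeries.coeff_eq_zero_of_lt_order ?_⟩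
  omega

/-- In a product of n factors, each factor contributes either its constant coefficient, of z-order
at least 1, or some positive x-degree, which may cost a bounded pole. Below m there are finitely
many exponents, so one constant A bounds the cost per unit of x-degree, and the z-order is at least
n - A·deg. -/
theorem coeff_pow_eq_zero_of_lt {y : MvPowerSeries ℕ ℚ⸨X⸩}
    (hy : ∀ n < 1, (MvPowerSeries.constantCoeff y).coeff n = 0) (m : ℕ →₀ ℕ) :
    ∃ A : ℕ, ∀ n : ℕ, ∀ m' ≤ m, ∀ j : ℤ, j < n - A * m'.degree →
      (MvPowerSeries.coeff m' (y ^ n)).coeff j = 0 := by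
  choose A hA using fun m' => exists_coeff_eq_zero_of_lt (MvPowerSeries.coeff m' y)
  have hA' : ∀ m' ≤ m, A m' ≤ ∑ m' ∈ Finset.Iic m, A m' := fun m' hm =>
    Finset.single_le_sum (f := A) (fun _ _ => Nat.zero_le _) (Finset.mem_Iic.2 hm)
  set A0 := ∑ m' ∈ Finset.Iic m, A m'
  -- The slope A0 + 1 instead of A0 absorbs the extra 1: for deg m' ≥ 1 the bound is at most -A0, so
  -- one formula serves for the constant coefficient too.
  have hone : ∀ m' ≤ m, ∀ j : ℤ, j < 1 - (A0 + 1 : ℕ) * m'.degree →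
      (MvPowerSeries.coeff m' y).coeff j = 0 := by
    intro m' hm j hj
    by_cases h0 : m' = 0
    · subst h0
      rw [MvPowerSeries.coeff_zero_eq_constantCoeff]
      exact hy j (by simpa using hj)
    · have h1 : 1 ≤ m'.degree := Nat.one_le_iff_ne_zero.2 (by rwa [Ne, Finsupp.degree_eq_zero_iff])
      have h2 := hA' m' hm
      refine hA m' j (hj.trans_le ?_)
      have : ((A0 + 1 : ℕ) : ℤ) * 1 ≤ (A0 + 1 : ℕ) * m'.degree :=
        mul_le_mul_of_nonneg_left (by exact_mod_cast h1) (by positivity)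
      push_cast at this ⊢
      omega
  refine ⟨A0 + 1, fun n => ?_⟩
  induction n with
  | zero =>
    intro m' hm j hj
    rw [pow_zero, MvPowerSeries.coeff_one]
    split_ifs with h
    · subst h
      rw [HahnSeries.coeff_one, if_neg]
      simp at hj
      omega
    · rfl
  | succ n ih =>
    intro m' hm j hj
    classical
    rw [pow_succ, MvPowerSeries.coeff_mul, HahnSeries.coeff_sum]
    refine Finset.sum_eq_zero fun p hp => ?_
    rw [Finset.HasAntidiagonal.mem_antidiagonal] at hp
    have h1 : p.1 ≤ m := le_trans (hp ▸ le_self_add) hm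
    have h2 : p.2 ≤ m := le_trans (hp ▸ le_add_self) hm
    refine coeff_mul_eq_zero_of_lt (ih p.1 h1) (hone p.2 h2) j (hj.trans_le (le_of_eq ?_))
    rw [← hp, map_add]
    push_cast
    ring

theorem rat_smul_eq (c : ℚ) (y : MvPowerSeries ℕ ℚ⸨X⸩) :
    c • y = MvPowerSeries.C (HahnSeries.C c) * y := by
  rw [Algebra.smul_def, Subsingleton.elim (algebraMap ℚ (MvPowerSeries ℕ ℚ⸨X⸩))
    (MvPowerSeries.C.comp HahnSeries.C)]
  rfl

theorem coeff_rat_smul (c : ℚ) (y : MvPowerSeries ℕ ℚ⸨X⸩) (m : ℕ →₀ ℕ) :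
    MvPowerSeries.coeff m (c • y) = HahnSeries.C c * MvPowerSeries.coeff m y := by
  rw [rat_smul_eq, MvPowerSeries.coeff_C_mul]

theorem laurent_coeff_C_mul (c : ℚ) (a : ℚ⸨X⸩) (j : ℤ) :
    (HahnSeries.C c * a).coeff j = c * a.coeff j := by
  rw [HahnSeries.C_mul_eq_smul, HahnSeries.coeff_smul, smul_eq_mul]

theorem summable_smul_pow {y : MvPowerSeries ℕ ℚ⸨X⸩}
    (hy : ∀ n < 1, (MvPowerSeries.constantCoeff y).coeff n = 0) (c : ℕ → ℚ) :
    Summable fun n => c n • y ^ n := by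
  rw [MvPowerSeries.WithPiTopology.summable_iff_summable_coeff]
  intro m
  obtain ⟨A, hA⟩ := coeff_pow_eq_zero_of_lt hy m
  refine summable_laurent fun D => ?_
  refine (Finset.range (D + A * m.degree).toNat).finite_toSet.subset ?_
  rintro n ⟨j, hj, hn⟩
  simp only [Finset.coe_range, Set.mem_Iio]
  by_contra! hc
  refine hn ?_
  have hc' : D + A * m.degree ≤ n := by
    have := Int.self_le_toNat (D + A * m.degree)
    have h2 : ((D + A * m.degree).toNat : ℤ) ≤ n := by exact_mod_cast hc
    omega
  have h0 := hA n m le_rfl j (by omega)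
  rw [coeff_rat_smul, laurent_coeff_C_mul, h0, mul_zero]


/-! ### The Euler derivation -/

/-- The derivation `x ^ m ↦ |m| x ^ m`. -/
noncomputable def euler (R : Type*) [CommRing R] :
    Derivation R (MvPowerSeries ℕ R) (MvPowerSeries ℕ R) :=
  Derivation.mk'
    { toFun := fun f m => (m.degree : R) * MvPowerSeries.coeff m f
      map_add' := fun f g => by
        ext m
        change (m.degree : R) * MvPowerSeries.coeff m (f + g) =
          (m.degree : R) * MvPowerSeries.coeff m f + (m.degree : R) * MvPowerSeries.coeff m g
        rw [map_add, mul_add]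
      map_smul' := fun c f => by
        ext m
        change (m.degree : R) * MvPowerSeries.coeff m (c • f) =
          c * ((m.degree : R) * MvPowerSeries.coeff m f)
        rw [MvPowerSeries.coeff_smul]
        ring }
    fun f g => by
      classical
      ext m
      change (m.degree : R) * MvPowerSeries.coeff m (f * g) = _
      rw [map_add, smul_eq_mul, smul_eq_mul, MvPowerSeries.coeff_mul, mul_comm g,
        MvPowerSeries.coeff_mul, MvPowerSeries.coeff_mul, Finset.mul_sum, ← Finset.sum_add_distrib]
      refine Finset.sum_congr rfl fun p hp => ?_
      change _ = MvPowerSeries.coeff p.1 f * ((p.2.degree : R) * MvPowerSeries.coeff p.2 g) +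
        ((p.1.degree : R) * MvPowerSeries.coeff p.1 f) * MvPowerSeries.coeff p.2 g
      rw [← Finset.HasAntidiagonal.mem_antidiagonal.1 hp, map_add]
      push_cast
      ring

section

variable {R : Type*} [CommRing R]

theorem coeff_euler (f : MvPowerSeries ℕ R) (m : ℕ →₀ ℕ) :
    MvPowerSeries.coeff m (euler R f) = (m.degree : R) * MvPowerSeries.coeff m f := rfl

theorem constantCoeff_euler (f : MvPowerSeries ℕ R) :
    MvPowerSeries.constantCoeff (euler R f) = 0 := by
  rw [← MvPowerSeries.coeff_zero_eq_constantCoeff_apply, coeff_euler]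
  simp

theorem euler_C (r : R) : euler R (MvPowerSeries.C r) = 0 := by
  have := (euler R).map_algebraMap r
  exact this

theorem continuous_euler [TopologicalSpace R] [IsTopologicalRing R] : Continuous (euler R) := by
  refine continuous_pi fun m => ?_
  exact continuous_const.mul (MvPowerSeries.WithPiTopology.continuous_coeff R m)

end

/-! ### Exponential and logarithm -/

theorem hasSum_of_eq {ι M : Type*} [AddCommMonoid M] [TopologicalSpace M] {f g : ι → M} {a : M}
    (h : HasSum f a) (hfg : ∀ i, f i = g i) : HasSum g a := (funext hfg) ▸ h

theorem euler_rat_smul (c : ℚ) (y : MvPowerSeries ℕ ℚ⸨X⸩) :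
    euler ℚ⸨X⸩ (c • y) = c • euler ℚ⸨X⸩ y := by
  rw [rat_smul_eq, rat_smul_eq, Derivation.leibniz, euler_C, smul_zero, add_zero, smul_eq_mul]

/-- The coefficient of `x ^ 0` is a power series in `z` without constant term. -/
def IsSmall (y : MvPowerSeries ℕ ℚ⸨X⸩) : Prop :=
  ∀ n < 1, (MvPowerSeries.constantCoeff y).coeff n = 0

theorem hasSum_expSeries {y : MvPowerSeries ℕ ℚ⸨X⸩} (hy : IsSmall y) :
    HasSum (fun n : ℕ => ((n.factorial : ℚ)⁻¹) • y ^ n) (expSeries y) :=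
  (summable_smul_pow hy _).hasSum

theorem euler_expSeries {y : MvPowerSeries ℕ ℚ⸨X⸩} (hy : IsSmall y) :
    euler ℚ⸨X⸩ (expSeries y) = expSeries y * euler ℚ⸨X⸩ y := by
  have h1 := (hasSum_expSeries hy).map (euler ℚ⸨X⸩) continuous_euler
  have h2 := (hasSum_expSeries hy).mul_right (euler ℚ⸨X⸩ y)
  rw [← hasSum_nat_add_iff' 1] at h1
  have h3 : (∑ i ∈ Finset.range 1, (⇑(euler ℚ⸨X⸩) ∘ fun n : ℕ => ((n.factorial : ℚ)⁻¹) • y ^ n) i) =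
      0 := by
    rw [Finset.sum_range_one, Function.comp_apply, euler_rat_smul, pow_zero,
      Derivation.map_one_eq_zero, rat_smul_eq, mul_zero]
  rw [h3, sub_zero] at h1
  refine (hasSum_of_eq h1 fun n => ?_).unique h2
  simp only [Function.comp_apply]
  rw [euler_rat_smul, Derivation.leibniz_pow, Nat.add_sub_cancel, Nat.factorial_succ, smul_eq_mul,
    rat_smul_eq, rat_smul_eq, nsmul_eq_mul, show ((n + 1 : ℕ) : MvPowerSeries ℕ ℚ⸨X⸩) =
      MvPowerSeries.C (HahnSeries.C ((n + 1 : ℕ) : ℚ)) by rw [map_natCast, map_natCast], ← mul_assoc, ← mul_assoc,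
    ← map_mul, ← map_mul]
  congr 4
  push_cast
  have : (n : ℚ) + 1 ≠ 0 := by positivity
  field_simp

theorem hasSum_logSeries {g : MvPowerSeries ℕ ℚ⸨X⸩} (hg : IsSmall (g - 1)) :
    HasSum (fun n : ℕ => ((-1 : ℚ) ^ n / (n + 1 : ℚ)) • (g - 1) ^ (n + 1)) (logSeries g) := by
  have h1 := summable_smul_pow hg fun n => (-1 : ℚ) ^ (n - 1) / (n : ℚ)
  rw [← summable_nat_add_iff 1] at h1
  simp only [Nat.add_sub_cancel, Nat.cast_add, Nat.cast_one] at h1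
  exact h1.hasSum

/-- Termwise differentiation yields the geometric series ∑ (-1)^n (g - 1)^n times Eg, and that
series is the inverse of g. Stated as a product with g to avoid inverses. -/
theorem mul_euler_logSeries {g : MvPowerSeries ℕ ℚ⸨X⸩} (hg : IsSmall (g - 1)) :
    g * euler ℚ⸨X⸩ (logSeries g) = euler ℚ⸨X⸩ g := by
  have h1 := (hasSum_logSeries hg).map (euler ℚ⸨X⸩) continuous_euler
  have h2 := summable_smul_pow hg fun n => (-1 : ℚ) ^ n
  obtain ⟨S, hS⟩ := h2
  have h3 : euler ℚ⸨X⸩ (logSeries g) = S * euler ℚ⸨X⸩ g := by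
    refine (hasSum_of_eq h1 fun n => ?_).unique (hS.mul_right (euler ℚ⸨X⸩ g))
    simp only [Function.comp_apply]
    rw [euler_rat_smul, Derivation.leibniz_pow, Nat.add_sub_cancel, map_sub,
      Derivation.map_one_eq_zero, sub_zero, smul_eq_mul,
      rat_smul_eq, rat_smul_eq, nsmul_eq_mul, show ((n + 1 : ℕ) : MvPowerSeries ℕ ℚ⸨X⸩) =
        MvPowerSeries.C (HahnSeries.C ((n + 1 : ℕ) : ℚ)) by rw [map_natCast, map_natCast], ← mul_assoc, ← mul_assoc,
      ← map_mul, ← map_mul]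
    congr 4
    push_cast
    have : (n : ℚ) + 1 ≠ 0 := by positivity
    field_simp
  -- Dropping the first term of S is the same as multiplying S by -(g - 1), so S - 1 = -(g - 1) S.
  have h4 : g * S = 1 := by
    have h5 := hS
    rw [← hasSum_nat_add_iff' 1] at h5
    have h6 := (hS.mul_left (-(g - 1)))
    have h7 := (hasSum_of_eq h5 fun n => (by
      rw [rat_smul_eq, rat_smul_eq, pow_succ, pow_succ]
      simp only [map_mul, map_neg, map_one]
      ring : _ = -(g - 1) * ((-1 : ℚ) ^ n • (g - 1) ^ n))).unique h6
    rw [Finset.sum_range_one, pow_zero, pow_zero, rat_smul_eq, map_one, map_one, mul_one] at h7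
    linear_combination h7
  rw [h3, ← mul_assoc, h4, one_mul]

/-! ### Adams operations -/

theorem laurentExpand_coeff_mul (k : ℕ+) (a : ℚ⸨X⸩) (n : ℤ) :
    (laurentExpand k a).coeff (k * n) = a.coeff n := by
  exact HahnSeries.embDomain_coeff (f := (⟨⟨_, _⟩, _⟩ : ℤ ↪o ℤ)) ..

theorem laurentExpand_coeff_of_not_dvd (k : ℕ+) (a : ℚ⸨X⸩) (n : ℤ) (h : ¬ (k : ℤ) ∣ n) :
    (laurentExpand k a).coeff n = 0 := by
  refine HahnSeries.embDomain_of_notMem_range ?_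
  rintro ⟨m, rfl⟩
  exact h ⟨m, rfl⟩

theorem laurentExpand_single (k : ℕ+) (n : ℤ) (r : ℚ) :
    laurentExpand k (HahnSeries.single n r) = HahnSeries.single ((k : ℤ) * n) r := by
  exact HahnSeries.embDomain_single ..

theorem coeff_adams_smul (k : ℕ+) (f : MvPowerSeries ℕ ℚ⸨X⸩) (m : ℕ →₀ ℕ) :
    MvPowerSeries.coeff ((k : ℕ) • m) (adams k f) = laurentExpand k (MvPowerSeries.coeff m f) := by
  exact (MvPowerSeries.coeff_expand_smul _ k.ne_zero (MvPowerSeries.map (laurentExpand k) f) _).trans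
    (MvPowerSeries.coeff_map _ _ _)

theorem coeff_adams_of_not_dvd (k : ℕ+) (f : MvPowerSeries ℕ ℚ⸨X⸩) (m : ℕ →₀ ℕ)
    (h : ¬ ∃ m', m = (k : ℕ) • m') : MvPowerSeries.coeff m (adams k f) = 0 := by
  have : ∃ i, ¬ (k : ℕ) ∣ m i := by
    by_contra! hc
    choose c hcc using hc
    refine h ⟨Finsupp.mapRange (fun n => n / (k : ℕ)) (Nat.zero_div _) m, Finsupp.ext fun i => ?_⟩
    rw [Finsupp.smul_apply, Finsupp.mapRange_apply, hcc i, Nat.mul_div_cancel_left _ k.pos,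
      smul_eq_mul]
  obtain ⟨i, hi⟩ := this
  exact MvPowerSeries.coeff_expand_of_not_dvd _ k.ne_zero (MvPowerSeries.map (laurentExpand k) f) hi

theorem constantCoeff_adams (k : ℕ+) (f : MvPowerSeries ℕ ℚ⸨X⸩) :
    MvPowerSeries.constantCoeff (adams k f) = laurentExpand k (MvPowerSeries.constantCoeff f) := by
  have := coeff_adams_smul k f 0
  rwa [smul_zero, MvPowerSeries.coeff_zero_eq_constantCoeff_apply,
    MvPowerSeries.coeff_zero_eq_constantCoeff_apply] at this

theorem euler_adams (k : ℕ+) (f : MvPowerSeries ℕ ℚ⸨X⸩) :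
    euler ℚ⸨X⸩ (adams k f) = (k : ℕ) • adams k (euler ℚ⸨X⸩ f) := by
  ext1 m
  rw [coeff_euler, map_nsmul]
  by_cases h : ∃ m', m = (k : ℕ) • m'
  · obtain ⟨m', rfl⟩ := h
    rw [coeff_adams_smul, coeff_adams_smul, coeff_euler, map_mul, map_natCast, map_nsmul,
      smul_eq_mul, nsmul_eq_mul (k : ℕ)]
    push_cast
    ring
  · rw [coeff_adams_of_not_dvd k _ _ h, coeff_adams_of_not_dvd k _ _ h]
    simp

theorem adams_adams (j k : ℕ+) (f : MvPowerSeries ℕ ℚ⸨X⸩) :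
    adams j (adams k f) = adams (j * k) f := by
  have hl : ∀ a, laurentExpand j (laurentExpand k a) = laurentExpand (j * k) a := by
    intro a
    ext n
    have hjk : ((j * k : ℕ+) : ℤ) = j * k := by push_cast; rfl
    by_cases h : (j : ℤ) ∣ n
    · obtain ⟨n, rfl⟩ := h
      rw [laurentExpand_coeff_mul]
      by_cases h' : (k : ℤ) ∣ n
      · obtain ⟨n, rfl⟩ := h'
        rw [laurentExpand_coeff_mul, ← mul_assoc, ← hjk, laurentExpand_coeff_mul]
      · rw [laurentExpand_coeff_of_not_dvd _ _ _ h', laurentExpand_coeff_of_not_dvd]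
        rw [hjk]
        intro hd
        exact h' ((mul_dvd_mul_iff_left (by exact_mod_cast j.ne_zero)).1 hd)
    · rw [laurentExpand_coeff_of_not_dvd _ _ _ h, laurentExpand_coeff_of_not_dvd]
      rw [hjk]
      exact fun hd => h ((dvd_mul_right _ _).trans hd)
  ext1 m
  by_cases h : ∃ m', m = (j : ℕ) • m'
  · obtain ⟨m, rfl⟩ := h
    rw [coeff_adams_smul]
    by_cases h' : ∃ m', m = (k : ℕ) • m'
    · obtain ⟨m, rfl⟩ := h'
      rw [coeff_adams_smul, hl, smul_smul, ← PNat.mul_coe, coeff_adams_smul]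
    · rw [coeff_adams_of_not_dvd _ _ _ h', map_zero, coeff_adams_of_not_dvd]
      rintro ⟨m', hm'⟩
      refine h' ⟨m', ?_⟩
      rw [PNat.mul_coe, ← smul_smul] at hm'
      exact smul_right_injective _ j.ne_zero hm'
  · rw [coeff_adams_of_not_dvd _ _ _ h, coeff_adams_of_not_dvd]
    rintro ⟨m', hm'⟩
    refine h ⟨(k : ℕ) • m', ?_⟩
    rw [hm', PNat.mul_coe, smul_smul]


/-! ### The stable series -/

/-- The series `∑ h_{2k}`. -/
noncomputable def evenH (R : Type*) [CommSemiring R] : MvPowerSeries ℕ R :=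
  fun m => if Even m.degree then 1 else 0

theorem coeff_evenH (R : Type*) [CommSemiring R] (m : ℕ →₀ ℕ) :
    MvPowerSeries.coeff m (evenH R) = if Even m.degree then 1 else 0 := rfl

theorem constantCoeff_evenH (R : Type*) [CommSemiring R] :
    MvPowerSeries.constantCoeff (evenH R) = 1 := by
  rw [← MvPowerSeries.coeff_zero_eq_constantCoeff_apply, coeff_evenH]
  simp

theorem coeff_hsymm (R : Type*) [CommSemiring R] (r : ℕ) (m : ℕ →₀ ℕ) :
    MvPowerSeries.coeff m (hsymm R r) = if m.degree = r then 1 else 0 := rfl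

theorem tsum_hsymm : ∑' k : ℕ, hsymm ℚ⸨X⸩ (2 * k) = evenH ℚ⸨X⸩ := by
  refine HasSum.tsum_eq ?_
  rw [MvPowerSeries.WithPiTopology.hasSum_iff_hasSum_coeff]
  intro m
  simp only [coeff_hsymm, coeff_evenH]
  by_cases h : Even m.degree
  · obtain ⟨r, hr⟩ := h
    have h1 : ∀ k : ℕ, (if m.degree = 2 * k then (1 : ℚ⸨X⸩) else 0) = if k = r then 1 else 0 := by
      intro k
      congr 1
      rw [eq_iff_iff]
      omega
    rw [if_pos ⟨r, hr⟩]
    simp only [h1]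
    exact hasSum_ite_eq r 1
  · rw [if_neg h]
    have h1 : ∀ k : ℕ, (if m.degree = 2 * k then (1 : ℚ⸨X⸩) else 0) = 0 := by
      intro k
      rw [if_neg]
      rintro hk
      exact h ⟨k, by omega⟩
    simp only [h1]
    exact hasSum_zero

theorem constantCoeff_zPow (j : ℤ) :
    MvPowerSeries.constantCoeff (zPow j) = HahnSeries.single j (1 : ℚ) :=
  MvPowerSeries.constantCoeff_C _

theorem adams_zPow (k : ℕ+) (j : ℤ) : adams k (zPow j) = zPow (k * j) := by
  change MvPowerSeries.expand _ k.ne_zero (MvPowerSeries.map _ (MvPowerSeries.C _)) = _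
  rw [MvPowerSeries.map_C]
  exact (MvPowerSeries.expand_C _ k.ne_zero _).trans (by rw [laurentExpand_single, zPow])

theorem euler_zPow (j : ℤ) : euler ℚ⸨X⸩ (zPow j) = 0 := euler_C _

/-- The series `z + ∑ h_{2k}`. -/
noncomputable def baseSeries : MvPowerSeries ℕ ℚ⸨X⸩ := zPow 1 + evenH ℚ⸨X⸩

theorem constantCoeff_baseSeries :
    MvPowerSeries.constantCoeff baseSeries = HahnSeries.single 1 1 + 1 := by
  rw [baseSeries, map_add, constantCoeff_zPow, constantCoeff_evenH]

theorem constantCoeff_adams_baseSeries (k : ℕ+) :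
    MvPowerSeries.constantCoeff (adams k baseSeries) = HahnSeries.single (k : ℤ) 1 + 1 := by
  rw [constantCoeff_adams, constantCoeff_baseSeries, map_add, laurentExpand_single,
    map_one (laurentExpand k), mul_one]

theorem single_add_one_ne_zero (k : ℕ+) : (HahnSeries.single (k : ℤ) 1 + 1 : ℚ⸨X⸩) ≠ 0 := by
  intro h
  have := congrArg (fun a => HahnSeries.coeff a (0 : ℤ)) h
  simp only [HahnSeries.coeff_add, HahnSeries.coeff_one, HahnSeries.coeff_zero, if_true] at this
  rw [HahnSeries.coeff_single_of_ne (by exact_mod_cast k.ne_zero.symm)] at this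
  simp at this

theorem adams_baseSeries_ne_zero (k : ℕ+) : adams k baseSeries ≠ 0 := by
  intro h
  have := constantCoeff_adams_baseSeries k
  rw [h, map_zero] at this
  exact single_add_one_ne_zero k this.symm

theorem isSmall_adams_baseSeries_sub_one (k : ℕ+) : IsSmall (adams k baseSeries - 1) := by
  intro n hn
  rw [map_sub, constantCoeff_adams_baseSeries, map_one MvPowerSeries.constantCoeff,
    add_sub_cancel_right]
  refine HahnSeries.coeff_single_of_ne ?_
  have := k.pos
  omega

/-- The logarithmic derivative of `baseSeries`. -/
noncomputable def logDerivBase : MvPowerSeries ℕ ℚ⸨X⸩ :=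
  baseSeries⁻¹ * euler ℚ⸨X⸩ baseSeries

theorem baseSeries_mul_logDerivBase : baseSeries * logDerivBase = euler ℚ⸨X⸩ baseSeries := by
  rw [logDerivBase, ← mul_assoc, MvPowerSeries.mul_inv_cancel, one_mul]
  rw [constantCoeff_baseSeries]
  exact single_add_one_ne_zero 1

theorem constantCoeff_logDerivBase : MvPowerSeries.constantCoeff logDerivBase = 0 := by
  rw [logDerivBase, map_mul, constantCoeff_euler, mul_zero]

theorem adams_baseSeries_mul (k : ℕ+) : adams k baseSeries * ((k : ℕ) • adams k logDerivBase) =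
    euler ℚ⸨X⸩ (adams k baseSeries) := by
  rw [mul_smul_comm, ← map_mul, baseSeries_mul_logDerivBase, euler_adams]

theorem euler_logSeries_adams (k : ℕ+) : euler ℚ⸨X⸩ (logSeries (adams k baseSeries)) =
    (k : ℕ) • adams k logDerivBase := by
  refine mul_left_cancel₀ (adams_baseSeries_ne_zero k) ?_
  rw [mul_euler_logSeries (isSmall_adams_baseSeries_sub_one k), adams_baseSeries_mul]

/-- Adams operations push a series without constant coefficient into degree at least k. Hence the
logarithmic derivatives that occur are finite sums over k in each x-degree, and only the coefficient
of x⁰ in the sums over k calls for z-adic convergence. -/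
theorem coeff_adams_eq_zero_of_lt {F : MvPowerSeries ℕ ℚ⸨X⸩}
    (hF : MvPowerSeries.constantCoeff F = 0) {k : ℕ+} {m : ℕ →₀ ℕ} (h : m.degree < k) :
    MvPowerSeries.coeff m (adams k F) = 0 := by
  by_cases hm : ∃ m', m = (k : ℕ) • m'
  · obtain ⟨m', rfl⟩ := hm
    rw [map_nsmul, smul_eq_mul] at h
    have : m'.degree = 0 := by
      by_contra h0
      have := Nat.le_mul_of_pos_right (k : ℕ) (Nat.pos_of_ne_zero h0)
      omega
    rw [Finsupp.degree_eq_zero_iff] at this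
    rw [this, coeff_adams_smul, MvPowerSeries.coeff_zero_eq_constantCoeff_apply, hF, map_zero]
  · exact coeff_adams_of_not_dvd k F m hm

theorem natCast_laurent_ne_zero {n : ℕ} (hn : n ≠ 0) : (n : ℚ⸨X⸩) ≠ 0 := by
  rw [← map_natCast (HahnSeries.C (Γ := ℤ) (R := ℚ)), Ne,
    map_eq_zero_iff _ HahnSeries.C_injective]
  exact_mod_cast hn

theorem coeff_eq_zero_of_coeff_euler {F : MvPowerSeries ℕ ℚ⸨X⸩} {m : ℕ →₀ ℕ} (hm : m ≠ 0)
    (h : MvPowerSeries.coeff m (euler ℚ⸨X⸩ F) = 0) : MvPowerSeries.coeff m F = 0 := by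
  rw [coeff_euler] at h
  refine (mul_eq_zero.1 h).resolve_left ?_
  rw [Ne, ← Finsupp.degree_eq_zero_iff] at hm
  exact natCast_laurent_ne_zero hm

theorem finite_setOf_pnat_le (n : ℕ) : {k : ℕ+ | (k : ℕ) ≤ n}.Finite := by
  refine Set.Finite.of_finite_image (f := fun k : ℕ+ => (k : ℕ)) ((Set.finite_Iic n).subset ?_)
    PNat.coe_injective.injOn
  rintro _ ⟨k, hk, rfl⟩
  exact hk

/-- The positive integers `≤ n`. -/
noncomputable def pnatLE (n : ℕ) : Finset ℕ+ := (finite_setOf_pnat_le n).toFinset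

theorem mem_pnatLE {n : ℕ} {k : ℕ+} : k ∈ pnatLE n ↔ (k : ℕ) ≤ n := by
  simp [pnatLE]

/-- The power series `log (1 + z ^ k)`. -/
noncomputable def logOneAddPow (k : ℕ+) : PowerSeries ℚ :=
  PowerSeries.mk fun N => if N ≠ 0 ∧ (k : ℕ) ∣ N then (-1) ^ (N / k + 1) / ((N / k : ℕ) : ℚ) else 0

theorem ofPowerSeries_monomial (n : ℕ) (c : ℚ) :
    HahnSeries.ofPowerSeries ℤ ℚ (PowerSeries.monomial n c) =
      HahnSeries.C c * HahnSeries.single (n : ℤ) 1 := by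
  rw [show PowerSeries.monomial n c = PowerSeries.C c * PowerSeries.X ^ n by
    ext; simp [PowerSeries.coeff_X_pow, PowerSeries.coeff_monomial], map_mul,
    HahnSeries.ofPowerSeries_C, HahnSeries.ofPowerSeries_X_pow]

theorem constantCoeff_logSeries_adams (k : ℕ+) :
    MvPowerSeries.constantCoeff (logSeries (adams k baseSeries)) =
      HahnSeries.ofPowerSeries ℤ ℚ (logOneAddPow k) := by
  have h1 := (hasSum_logSeries (isSmall_adams_baseSeries_sub_one k)).map
    (MvPowerSeries.constantCoeff (σ := ℕ) (R := ℚ⸨X⸩))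
    (MvPowerSeries.WithPiTopology.continuous_constantCoeff _)
  have h2 := hasSum_coe_powerSeries (p := fun n : ℕ => PowerSeries.monomial (k * (n + 1))
    ((-1 : ℚ) ^ n / (n + 1 : ℚ))) (fun N => by
      refine (Set.finite_Iic N).subset fun n hn => ?_
      rw [Set.mem_ofPred_eq, PowerSeries.coeff_monomial] at hn
      split_ifs at hn with h
      · have := Nat.le_mul_of_pos_left (n + 1) k.pos
        rw [Set.mem_Iic]
        omega
      · exact absurd rfl hn)
  have h3 := (hasSum_of_eq h1 fun n => ?_).unique h2
  · rw [h3]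
    congr 1
    ext N
    rw [PowerSeries.coeff_mk, logOneAddPow, PowerSeries.coeff_mk]
    simp only [PowerSeries.coeff_monomial]
    split_ifs with h
    · obtain ⟨hN, t, rfl⟩ := h
      obtain ⟨t, rfl⟩ : ∃ t', t = t' + 1 := ⟨t - 1, by
        rcases t with _ | t
        · simp at hN
        · simp⟩
      rw [finsum_eq_single _ t, if_pos rfl, Nat.mul_div_cancel_left _ k.pos]
      · push_cast
        ring
      · intro n hn
        rw [if_neg]
        intro h
        have := Nat.eq_of_mul_eq_mul_left k.pos h
        omega
    · refine finsum_eq_zero_of_forall_eq_zero fun n => ?_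
      rw [if_neg]
      rintro rfl
      exact h ⟨Nat.mul_ne_zero k.ne_zero (Nat.succ_ne_zero n), dvd_mul_right _ _⟩
  · rw [Function.comp_apply, rat_smul_eq, map_mul, MvPowerSeries.constantCoeff_C, map_pow, map_sub,
      constantCoeff_adams_baseSeries, map_one MvPowerSeries.constantCoeff, add_sub_cancel_right,
      ofPowerSeries_monomial, HahnSeries.single_pow, one_pow]
    congr 2
    push_cast
    simp [mul_comm]

/-! #### The plethystic logarithm -/

theorem finsum_pnat_eq_sum_divisors {M : Type*} [AddCommMonoid M] (f : ℕ → M) {N : ℕ} (hN : N ≠ 0)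
    (h : ∀ k, ¬ k ∣ N → f k = 0) : ∑ᶠ k : ℕ+, f k = ∑ k ∈ N.divisors, f k := by
  rw [← finsum_mem_range (f := f) PNat.coe_injective]
  refine finsum_mem_eq_sum_of_inter_support_eq _ ?_
  ext k
  simp only [Set.mem_inter_iff, Set.mem_range, Function.mem_support, Finset.mem_coe,
    Nat.mem_divisors]
  refine and_congr_left fun hk => ?_
  constructor
  · intro _
    by_contra hd
    exact hk (h k fun hd' => hd ⟨hd', hN⟩)
  · rintro ⟨hd, _⟩
    exact ⟨⟨k, Nat.pos_of_dvd_of_pos hd (Nat.pos_of_ne_zero hN)⟩, rfl⟩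

/-- Möbius inversion of (-1)^{n+1} = ∑_{d ∣ n} f(d), with f supported on {1, 2}; this is the
arithmetic of 1 + z = (1 - z²)/(1 - z). -/
theorem sum_moebius_mul_neg_one_pow {n : ℕ} (hn : 0 < n) :
    ∑ x ∈ n.divisorsAntidiagonal, (ArithmeticFunction.moebius x.1 : ℚ) * (-1) ^ (x.2 + 1) =
      if n = 1 then 1 else if n = 2 then -2 else 0 := by
  refine (ArithmeticFunction.sum_eq_iff_sum_mul_moebius_eq (R := ℚ)
    (f := fun n => if n = 1 then 1 else if n = 2 then -2 else 0)
    (g := fun n => (-1) ^ (n + 1))).1 (fun n hn => ?_) n hn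
  rw [Finset.sum_ite, Finset.sum_ite]
  have h1 : n.divisors.filter (· = 1) = {1} := by
    ext i
    simp only [Finset.mem_filter, Nat.mem_divisors, Finset.mem_singleton]
    constructor
    · exact fun h => h.2
    · rintro rfl
      exact ⟨⟨one_dvd _, hn.ne'⟩, rfl⟩
  rw [h1, Finset.filter_filter]
  rcases Nat.even_or_odd n with he | ho
  · have h2 : n.divisors.filter (fun a => ¬ a = 1 ∧ a = 2) = {2} := by
      ext i
      simp only [Finset.mem_filter, Nat.mem_divisors, Finset.mem_singleton]
      constructor
      · exact fun h => h.2.2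
      · rintro rfl
        exact ⟨⟨he.two_dvd, hn.ne'⟩, by omega, rfl⟩
    rw [h2, pow_succ, he.neg_one_pow]
    simp
    norm_num
  · have h2 : n.divisors.filter (fun a => ¬ a = 1 ∧ a = 2) = ∅ := by
      ext i
      simp only [Finset.mem_filter, Nat.mem_divisors, Finset.notMem_empty, iff_false]
      rintro ⟨⟨h, -⟩, -, rfl⟩
      exact (Nat.not_even_iff_odd.2 ho) (even_iff_two_dvd.2 h)
    rw [h2, pow_succ, ho.neg_one_pow]
    simp

theorem sum_moebius_mul_logOneAddPow (N : ℕ) :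
    ∑ᶠ k : ℕ+, PowerSeries.coeff N (PowerSeries.C
      ((ArithmeticFunction.moebius (k : ℕ) : ℚ) / (k : ℚ)) * logOneAddPow k) =
    PowerSeries.coeff N (PowerSeries.X - PowerSeries.X ^ 2 : PowerSeries ℚ) := by
  simp only [PowerSeries.coeff_C_mul, logOneAddPow, PowerSeries.coeff_mk]
  rcases N.eq_zero_or_pos with rfl | hN
  · simp
  rw [finsum_pnat_eq_sum_divisors (fun k => (ArithmeticFunction.moebius k : ℚ) / (k : ℚ) *
    if N ≠ 0 ∧ k ∣ N then (-1) ^ (N / k + 1) / ((N / k : ℕ) : ℚ) else 0) hN.ne'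
    (fun k hk => by rw [if_neg fun h => hk h.2, mul_zero]),
    ← Nat.sum_divisorsAntidiagonal (f := fun k t => (ArithmeticFunction.moebius k : ℚ) / (k : ℚ) *
    if N ≠ 0 ∧ k ∣ N then (-1) ^ (t + 1) / (t : ℚ) else 0)]
  have h1 : ∑ x ∈ N.divisorsAntidiagonal, (ArithmeticFunction.moebius x.1 : ℚ) / (x.1 : ℚ) *
      (if N ≠ 0 ∧ x.1 ∣ N then (-1) ^ (x.2 + 1) / (x.2 : ℚ) else 0) =
      (∑ x ∈ N.divisorsAntidiagonal, (ArithmeticFunction.moebius x.1 : ℚ) * (-1) ^ (x.2 + 1)) / N := by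
    rw [Finset.sum_div]
    refine Finset.sum_congr rfl fun x hx => ?_
    obtain ⟨h1, h2⟩ := Nat.mem_divisorsAntidiagonal.1 hx
    rw [if_pos ⟨h2, Dvd.intro _ h1⟩, div_mul_div_comm, ← Nat.cast_mul, h1]
  rw [h1, sum_moebius_mul_neg_one_pow hN, map_sub, PowerSeries.coeff_X, PowerSeries.coeff_X_pow]
  split_ifs with h h' h'
  · omega
  · simp [h]
  · simp [h']
  · simp

/-- For m ≠ 0 summability is checked after applying the Euler derivation, where only k ≤ |m|
survive. For m = 0 the sum is ∑ (μ(k)/k) log(1 + z^k) = z - z². -/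
theorem hasSum_plethysticLog :
    HasSum (fun k : ℕ+ => ((ArithmeticFunction.moebius (k : ℕ) : ℚ) / (k : ℚ)) •
      logSeries (adams k baseSeries)) (plethysticLog baseSeries) ∧
    MvPowerSeries.constantCoeff (plethysticLog baseSeries) =
      HahnSeries.single 1 1 - HahnSeries.single 2 1 := by
  have h0 := hasSum_coe_powerSeries (p := fun k : ℕ+ => PowerSeries.C
      ((ArithmeticFunction.moebius (k : ℕ) : ℚ) / (k : ℚ)) * logOneAddPow k) (fun N => by
    refine (finite_setOf_pnat_le N).subset fun k hk => ?_
    rw [Set.mem_ofPred_eq, PowerSeries.coeff_C_mul, logOneAddPow, PowerSeries.coeff_mk] at hk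
    split_ifs at hk with h
    · exact Nat.le_of_dvd (Nat.pos_of_ne_zero h.1) h.2
    · simp at hk)
  have h1 : ∀ k : ℕ+, MvPowerSeries.constantCoeff
      (((ArithmeticFunction.moebius (k : ℕ) : ℚ) / (k : ℚ)) • logSeries (adams k baseSeries)) =
      HahnSeries.ofPowerSeries ℤ ℚ (PowerSeries.C
        ((ArithmeticFunction.moebius (k : ℕ) : ℚ) / (k : ℚ)) * logOneAddPow k) := by
    intro k
    rw [rat_smul_eq, map_mul, MvPowerSeries.constantCoeff_C, constantCoeff_logSeries_adams, map_mul,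
      HahnSeries.ofPowerSeries_C]
  have hs : Summable fun k : ℕ+ => ((ArithmeticFunction.moebius (k : ℕ) : ℚ) / (k : ℚ)) •
      logSeries (adams k baseSeries) := by
    rw [MvPowerSeries.WithPiTopology.summable_iff_summable_coeff]
    intro m
    by_cases hm : m = 0
    · subst hm
      refine ⟨_, hasSum_of_eq h0 fun k => ?_⟩
      rw [MvPowerSeries.coeff_zero_eq_constantCoeff_apply, h1]
    · refine summable_of_hasFiniteSupport ((finite_setOf_pnat_le m.degree).subset fun k hk => ?_)
      by_contra! hlt
      rw [Set.mem_ofPred_eq, not_le] at hlt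
      refine hk ?_
      beta_reduce
      rw [coeff_rat_smul, coeff_eq_zero_of_coeff_euler hm, mul_zero]
      rw [euler_logSeries_adams, map_nsmul,
        coeff_adams_eq_zero_of_lt constantCoeff_logDerivBase hlt, smul_zero]
  refine ⟨hs.hasSum, ?_⟩
  have h2 := hs.hasSum.map (MvPowerSeries.constantCoeff (σ := ℕ) (R := ℚ⸨X⸩))
    (MvPowerSeries.WithPiTopology.continuous_constantCoeff _)
  have h3 := (hasSum_of_eq h2 h1).unique h0
  refine h3.trans ?_
  rw [show (PowerSeries.mk fun N => ∑ᶠ k : ℕ+, PowerSeries.coeff N (PowerSeries.C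
      ((ArithmeticFunction.moebius (k : ℕ) : ℚ) / (k : ℚ)) * logOneAddPow k)) =
      PowerSeries.X - PowerSeries.X ^ 2 by
    ext N
    rw [PowerSeries.coeff_mk, sum_moebius_mul_logOneAddPow], map_sub, HahnSeries.ofPowerSeries_X,
    HahnSeries.ofPowerSeries_X_pow]
  rfl

theorem sum_Icc_of_hasSum {f : ℕ+ → ℚ⸨X⸩} {s : ℚ⸨X⸩} (h : HasSum f s) (L : ℕ)
    (h0 : ∀ k : ℕ+, L < k → f k = 0) :
    s = ∑ k ∈ pnatLE L, f k := by
  refine h.unique (hasSum_sum_of_ne_finset_zero fun k hk => h0 k ?_)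
  rwa [mem_pnatLE, not_le] at hk

theorem coeff_euler_plethysticLog {m : ℕ →₀ ℕ} {L : ℕ} (hL : m.degree ≤ L) :
    MvPowerSeries.coeff m (euler ℚ⸨X⸩ (plethysticLog baseSeries)) =
      Finset.sum (pnatLE L) fun k : ℕ+ =>
        HahnSeries.C (ArithmeticFunction.moebius (k : ℕ) : ℚ) *
          MvPowerSeries.coeff m (adams k logDerivBase) := by
  have h1 := (hasSum_plethysticLog.1.map (euler ℚ⸨X⸩) continuous_euler).map (MvPowerSeries.coeff m)
    (MvPowerSeries.WithPiTopology.continuous_coeff _ m)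
  have h2 := hasSum_of_eq h1 (g := fun k : ℕ+ => HahnSeries.C (ArithmeticFunction.moebius (k : ℕ) : ℚ) *
      MvPowerSeries.coeff m (adams k logDerivBase)) fun k => by
    simp only [Function.comp_apply]
    rw [euler_rat_smul, euler_logSeries_adams, coeff_rat_smul, map_nsmul, nsmul_eq_mul, ← mul_assoc,
      ← map_natCast (HahnSeries.C (Γ := ℤ) (R := ℚ)), ← map_mul]
    congr 2
    have : ((k : ℕ) : ℚ) ≠ 0 := by exact_mod_cast k.ne_zero
    field_simp
  refine sum_Icc_of_hasSum h2 L fun k hk => ?_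
  rw [coeff_adams_eq_zero_of_lt constantCoeff_logDerivBase (by omega), mul_zero]


/-! #### The plethystic exponential -/

/-- The argument of the plethystic exponential in the stable series. -/
noncomputable def expArgument : MvPowerSeries ℕ ℚ⸨X⸩ :=
  zPow (-1) * plethysticLog baseSeries - 1

/-- Here the shift by -1 matters: z⁻¹(z - z²) - 1 = -z has positive z-order, as convergence of the
plethystic exponential requires. -/
theorem constantCoeff_expArgument :
    MvPowerSeries.constantCoeff expArgument = HahnSeries.single 1 (-1) := by
  rw [expArgument, map_sub, map_mul, hasSum_plethysticLog.2, constantCoeff_zPow,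
    map_one MvPowerSeries.constantCoeff, mul_sub, HahnSeries.single_mul_single,
    HahnSeries.single_mul_single]
  norm_num

theorem euler_adams_expArgument (k : ℕ+) : euler ℚ⸨X⸩ (adams k expArgument) =
    (k : ℕ) • (zPow (-(k : ℤ)) * adams k (euler ℚ⸨X⸩ (plethysticLog baseSeries))) := by
  rw [euler_adams, expArgument, map_sub, Derivation.leibniz, euler_zPow, smul_zero, add_zero,
    Derivation.map_one_eq_zero, sub_zero, smul_eq_mul, map_mul, adams_zPow, mul_neg, mul_one]

/-- The power series `log (1 - z)`. -/
noncomputable def logOneSub : PowerSeries ℚ :=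
  PowerSeries.mk fun N => -(N : ℚ)⁻¹

theorem constantCoeff_logOneSub : PowerSeries.constantCoeff logOneSub = 0 := by
  rw [← PowerSeries.coeff_zero_eq_constantCoeff_apply, logOneSub, PowerSeries.coeff_mk]
  simp

theorem hasSum_expExponent : ∃ Y : MvPowerSeries ℕ ℚ⸨X⸩,
    HasSum (fun k : ℕ+ => ((k : ℚ)⁻¹) • adams k expArgument) Y ∧
    MvPowerSeries.constantCoeff Y = HahnSeries.ofPowerSeries ℤ ℚ logOneSub := by
  have h0 := hasSum_coe_powerSeries (p := fun k : ℕ+ => PowerSeries.monomial (k : ℕ)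
      (-(k : ℚ)⁻¹)) (fun N => by
    refine (finite_setOf_pnat_le N).subset fun k hk => ?_
    rw [Set.mem_ofPred_eq, PowerSeries.coeff_monomial] at hk
    split_ifs at hk with h
    · exact h.ge
    · exact absurd rfl hk)
  have h1 : ∀ k : ℕ+, MvPowerSeries.constantCoeff (((k : ℚ)⁻¹) • adams k expArgument) =
      HahnSeries.ofPowerSeries ℤ ℚ (PowerSeries.monomial (k : ℕ) (-(k : ℚ)⁻¹)) := by
    intro k
    rw [rat_smul_eq, map_mul, MvPowerSeries.constantCoeff_C, constantCoeff_adams,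
      constantCoeff_expArgument, laurentExpand_single, ofPowerSeries_monomial, mul_one, HahnSeries.C_apply,
      HahnSeries.C_apply, HahnSeries.single_mul_single, HahnSeries.single_mul_single, mul_neg,
      mul_one, mul_one]
  have hs : Summable fun k : ℕ+ => ((k : ℚ)⁻¹) • adams k expArgument := by
    rw [MvPowerSeries.WithPiTopology.summable_iff_summable_coeff]
    intro m
    by_cases hm : m = 0
    · subst hm
      refine ⟨_, hasSum_of_eq h0 fun k => ?_⟩
      rw [MvPowerSeries.coeff_zero_eq_constantCoeff_apply, h1]
    · refine summable_of_hasFiniteSupport ((finite_setOf_pnat_le m.degree).subset fun k hk => ?_)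
      by_contra! hlt
      rw [Set.mem_ofPred_eq, not_le] at hlt
      refine hk ?_
      beta_reduce
      rw [coeff_rat_smul, coeff_eq_zero_of_coeff_euler hm, mul_zero]
      rw [euler_adams_expArgument, map_nsmul, zPow, MvPowerSeries.coeff_C_mul,
        coeff_adams_eq_zero_of_lt (constantCoeff_euler _) hlt, mul_zero, smul_zero]
  obtain ⟨Y, hY⟩ := hs
  refine ⟨Y, hY, ?_⟩
  have h2 := hY.map (MvPowerSeries.constantCoeff (σ := ℕ) (R := ℚ⸨X⸩))
    (MvPowerSeries.WithPiTopology.continuous_constantCoeff _)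
  have h3 := (hasSum_of_eq h2 h1).unique h0
  rw [h3]
  congr 1
  ext N
  rw [PowerSeries.coeff_mk, logOneSub, PowerSeries.coeff_mk]
  simp only [PowerSeries.coeff_monomial]
  rcases N.eq_zero_or_pos with rfl | hN
  · rw [finsum_eq_zero_of_forall_eq_zero]
    · simp
    · intro k
      rw [if_neg k.ne_zero.symm]
  · obtain ⟨k0, rfl⟩ : ∃ k0 : ℕ+, (k0 : ℕ) = N := ⟨⟨N, hN⟩, rfl⟩
    rw [finsum_eq_single _ k0, if_pos rfl]
    intro k hk
    rw [if_neg]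
    exact fun h => hk (PNat.coe_injective h.symm)

/-- The composite F satisfies (1 - z) F' = -F, which gives (N + 1) F_{N+1} = (N - 1) F_N. The
vanishing factor at N = 1 stops the recursion after F_0 = 1 and F_1 = -1. -/
theorem subst_logOneSub_exp :
    PowerSeries.subst logOneSub (PowerSeries.exp ℚ) = 1 - PowerSeries.X := by
  have hsub : PowerSeries.HasSubst logOneSub :=
    PowerSeries.HasSubst.of_constantCoeff_zero' constantCoeff_logOneSub
  set F := PowerSeries.subst logOneSub (PowerSeries.exp ℚ) with hF
  have h1 : PowerSeries.derivative ℚ F = F * PowerSeries.derivative ℚ logOneSub := by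
    rw [hF, PowerSeries.derivative_subst hsub, PowerSeries.derivative_exp]
  have h2 : (1 - PowerSeries.X) * PowerSeries.derivative ℚ logOneSub = -1 := by
    ext N
    rw [sub_mul, one_mul, map_sub, PowerSeries.coeff_derivative, logOneSub, PowerSeries.coeff_mk]
    cases N with
    | zero => simp
    | succ N =>
      rw [PowerSeries.coeff_succ_X_mul, PowerSeries.coeff_derivative, PowerSeries.coeff_mk, map_neg,
        PowerSeries.coeff_one, if_neg (Nat.succ_ne_zero _)]
      push_cast
      have h1 : (N : ℚ) + 1 ≠ 0 := by positivity
      have h2 : (N : ℚ) + 1 + 1 ≠ 0 := by positivity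
      field_simp
      ring
  have h3 : (1 - PowerSeries.X) * PowerSeries.derivative ℚ F = -F := by
    rw [h1, mul_left_comm, h2, mul_neg, mul_one]
  have h0 : PowerSeries.coeff 0 F = 1 := by
    rw [hF, PowerSeries.coeff_subst' hsub, finsum_eq_single _ 0]
    · simp
    · intro n hn
      simp [constantCoeff_logOneSub, hn]
  have hrec : ∀ N : ℕ, PowerSeries.coeff (N + 1) F * (N + 1) = (N - 1) * PowerSeries.coeff N F := by
    intro N
    have := congrArg (PowerSeries.coeff N) h3
    rw [sub_mul, one_mul, map_sub, PowerSeries.coeff_derivative, map_neg] at this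
    cases N with
    | zero =>
      rw [PowerSeries.coeff_zero_X_mul] at this
      rw [sub_zero] at this
      rw [this]
      simp
    | succ N =>
      rw [PowerSeries.coeff_succ_X_mul, PowerSeries.coeff_derivative] at this
      push_cast at this ⊢
      linear_combination this
  have h1' : PowerSeries.coeff 1 F = -1 := by
    have := hrec 0
    rw [h0] at this
    simpa using this
  have h2' : ∀ N, PowerSeries.coeff (N + 2) F = 0 := by
    intro N
    induction N with
    | zero =>
      have := hrec 1
      norm_num at this
      exact this
    | succ N ih =>
      have := hrec (N + 2)
      rw [ih, mul_zero] at this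
      have h : ((N + 2 : ℕ) : ℚ) + 1 ≠ 0 := by positivity
      exact (mul_eq_zero.1 this).resolve_right h
  ext N
  rcases N with _ | _ | N
  · rw [h0]; simp
  · rw [h1', map_sub, PowerSeries.coeff_one, PowerSeries.coeff_one_X]; simp
  · rw [h2', map_sub, PowerSeries.coeff_one, PowerSeries.coeff_X]; simp

theorem stableSeries_eq {Y : MvPowerSeries ℕ ℚ⸨X⸩}
    (hY : HasSum (fun k : ℕ+ => ((k : ℚ)⁻¹) • adams k expArgument) Y) :
    stableSeries = expSeries Y := by
  rw [stableSeries, tsum_hsymm, plethysticExp]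
  exact congrArg expSeries hY.tsum_eq

theorem isSmall_of_constantCoeff_eq {Y : MvPowerSeries ℕ ℚ⸨X⸩} {p : PowerSeries ℚ}
    (hp : PowerSeries.constantCoeff p = 0)
    (h : MvPowerSeries.constantCoeff Y = HahnSeries.ofPowerSeries ℤ ℚ p) : IsSmall Y := by
  intro n hn
  rw [h, PowerSeries.coeff_coe]
  split_ifs with h0
  · rfl
  · rw [show n.natAbs = 0 by omega, PowerSeries.coeff_zero_eq_constantCoeff_apply, hp]

theorem constantCoeff_stableSeries :
    MvPowerSeries.constantCoeff stableSeries = 1 - HahnSeries.single 1 1 := by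
  obtain ⟨Y, hY, hY0⟩ := hasSum_expExponent
  rw [stableSeries_eq hY]
  have h1 := (hasSum_expSeries (isSmall_of_constantCoeff_eq constantCoeff_logOneSub hY0)).map
    (MvPowerSeries.constantCoeff (σ := ℕ) (R := ℚ⸨X⸩))
    (MvPowerSeries.WithPiTopology.continuous_constantCoeff _)
  have hsub : PowerSeries.HasSubst logOneSub :=
    PowerSeries.HasSubst.of_constantCoeff_zero' constantCoeff_logOneSub
  have h0 := hasSum_coe_powerSeries (p := fun n : ℕ => PowerSeries.coeff n (PowerSeries.exp ℚ) •
      logOneSub ^ n) (fun N => by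
    have := PowerSeries.coeff_subst_finite' hsub (PowerSeries.exp ℚ) N
    exact this.subset fun n hn => by simpa using hn)
  have h2 := (hasSum_of_eq h1 fun n => ?_).unique h0
  · rw [h2, show (PowerSeries.mk fun N => ∑ᶠ n : ℕ, PowerSeries.coeff N
        (PowerSeries.coeff n (PowerSeries.exp ℚ) • logOneSub ^ n)) =
        PowerSeries.subst logOneSub (PowerSeries.exp ℚ) by
      ext N
      rw [PowerSeries.coeff_mk, PowerSeries.coeff_subst' hsub]
      rfl, subst_logOneSub_exp, map_sub, map_one (HahnSeries.ofPowerSeries ℤ ℚ),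
      HahnSeries.ofPowerSeries_X]
  · rw [Function.comp_apply, rat_smul_eq, map_mul, map_pow, MvPowerSeries.constantCoeff_C, hY0,
      PowerSeries.smul_eq_C_mul, map_mul, map_pow, HahnSeries.ofPowerSeries_C,
      PowerSeries.coeff_exp]
    simp

theorem coeff_adams_euler_plethysticLog (k : ℕ+) {m : ℕ →₀ ℕ} {L : ℕ} (hL : m.degree ≤ L) :
    MvPowerSeries.coeff m (adams k (euler ℚ⸨X⸩ (plethysticLog baseSeries))) =
      Finset.sum (pnatLE L) fun j : ℕ+ =>
        HahnSeries.C (ArithmeticFunction.moebius (j : ℕ) : ℚ) *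
          MvPowerSeries.coeff m (adams (k * j) logDerivBase) := by
  by_cases h : ∃ m', m = (k : ℕ) • m'
  · obtain ⟨m, rfl⟩ := h
    have hm : m.degree ≤ L := by
      rw [map_nsmul, smul_eq_mul] at hL
      exact (Nat.le_mul_of_pos_left _ k.pos).trans hL
    rw [coeff_adams_smul, coeff_euler_plethysticLog hm, map_sum]
    refine Finset.sum_congr rfl fun j _ => ?_
    rw [← adams_adams, coeff_adams_smul, map_mul]
    congr 1
    exact (laurentExpand_single _ _ _).trans (by rw [mul_zero]; rfl)
  · rw [coeff_adams_of_not_dvd k _ m h]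
    refine (Finset.sum_eq_zero fun j _ => ?_).symm
    rw [← adams_adams, coeff_adams_of_not_dvd k _ m h, mul_zero]

/-- The logarithmic derivative of the stable series. -/
theorem euler_stableSeries : ∃ W : MvPowerSeries ℕ ℚ⸨X⸩,
    euler ℚ⸨X⸩ stableSeries = stableSeries * W ∧
    ∀ (m : ℕ →₀ ℕ) (L : ℕ), m.degree ≤ L → MvPowerSeries.coeff m W =
      Finset.sum (pnatLE L) fun k : ℕ+ => Finset.sum (pnatLE L) fun j : ℕ+ =>
        HahnSeries.single (-(k : ℤ)) (ArithmeticFunction.moebius (j : ℕ) : ℚ) *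
          MvPowerSeries.coeff m (adams (k * j) logDerivBase) := by
  obtain ⟨Y, hY, hY0⟩ := hasSum_expExponent
  refine ⟨euler ℚ⸨X⸩ Y, ?_, fun m L hL => ?_⟩
  · rw [stableSeries_eq hY]
    exact euler_expSeries (isSmall_of_constantCoeff_eq constantCoeff_logOneSub hY0)
  · have h1 := (hY.map (euler ℚ⸨X⸩) continuous_euler).map (MvPowerSeries.coeff m)
      (MvPowerSeries.WithPiTopology.continuous_coeff _ m)
    have h2 := hasSum_of_eq h1 (g := fun k : ℕ+ => HahnSeries.single (-(k : ℤ)) 1 *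
        MvPowerSeries.coeff m (adams k (euler ℚ⸨X⸩ (plethysticLog baseSeries)))) fun k => by
      simp only [Function.comp_apply]
      rw [euler_rat_smul, euler_adams_expArgument, coeff_rat_smul, map_nsmul, nsmul_eq_mul,
        ← mul_assoc, ← map_natCast (HahnSeries.C (Γ := ℤ) (R := ℚ)), ← map_mul,
        inv_mul_cancel₀ (by exact_mod_cast k.ne_zero), map_one HahnSeries.C, one_mul, zPow,
        MvPowerSeries.coeff_C_mul]
    rw [sum_Icc_of_hasSum h2 L fun k hk => by
      rw [coeff_adams_eq_zero_of_lt (constantCoeff_euler _) (by omega), mul_zero]]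
    -- The factor k produced by the derivation of ψ_k has cancelled 1/k; expanding ψ_k of the
    -- logarithmic derivative of Log g now gives the terms ψ_{kj}.
    refine Finset.sum_congr rfl fun k _ => ?_
    rw [coeff_adams_euler_plethysticLog k hL, Finset.mul_sum]
    refine Finset.sum_congr rfl fun j _ => ?_
    rw [← mul_assoc, HahnSeries.C_apply, HahnSeries.single_mul_single, add_zero, one_mul]


/-! ### Evaluation of Laurent series -/

/-- The Laurent series `a` converges at `r`, with value `c`. -/
def EvalsTo (r : ℂ) (a : ℚ⸨X⸩) (c : ℂ) : Prop :=
  HasSum (fun j : ℤ => ((a.coeff j : ℚ) : ℂ) * r ^ j) c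

theorem hasSum_mul_shift {f g : ℤ → ℂ} {c d : ℂ} (hf : HasSum f c) (hg : HasSum g d) :
    HasSum (fun p : ℤ × ℤ => f p.2 * g (p.1 - p.2)) (c * d) := by
  have h0 : Summable fun x : ℤ × ℤ => f x.1 * g x.2 :=
    summable_mul_of_summable_norm hf.summable.norm hg.summable.norm
  let e : ℤ × ℤ ≃ ℤ × ℤ :=
    { toFun := fun p => (p.2, p.1 - p.2)
      invFun := fun p => (p.1 + p.2, p.1)
      left_inv := fun p => by ext <;> simp
      right_inv := fun p => by ext <;> simp }
  exact (e.hasSum_iff (f := fun x : ℤ × ℤ => f x.1 * g x.2)).2 (hf.mul hg h0)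

namespace EvalsTo

variable {r : ℂ} {a b : ℚ⸨X⸩} {c d : ℂ}

theorem unique (h : EvalsTo r a c) (h' : EvalsTo r a d) : c = d := HasSum.unique h h'

theorem add (ha : EvalsTo r a c) (hb : EvalsTo r b d) : EvalsTo r (a + b) (c + d) := by
  refine hasSum_of_eq (HasSum.add ha hb) fun j => ?_
  rw [HahnSeries.coeff_add, Rat.cast_add, add_mul]

theorem neg (ha : EvalsTo r a c) : EvalsTo r (-a) (-c) := by
  refine hasSum_of_eq (HasSum.neg ha) fun j => ?_
  rw [HahnSeries.coeff_neg, Rat.cast_neg, neg_mul]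

theorem sub (ha : EvalsTo r a c) (hb : EvalsTo r b d) : EvalsTo r (a - b) (c - d) := by
  rw [sub_eq_add_neg, sub_eq_add_neg]
  exact ha.add hb.neg

theorem zero : EvalsTo r 0 0 := by
  refine hasSum_of_eq (hasSum_zero (α := ℂ) (β := ℤ)) fun j => ?_
  simp

theorem single (n : ℤ) (t : ℚ) : EvalsTo r (HahnSeries.single n t) (t * r ^ n) := by
  have := hasSum_single (f := fun j : ℤ => (((HahnSeries.single n t).coeff j : ℚ) : ℂ) * r ^ j) n
    fun j hj => by rw [HahnSeries.coeff_single_of_ne hj, Rat.cast_zero, zero_mul]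
  rwa [HahnSeries.coeff_single_same] at this

theorem C (t : ℚ) : EvalsTo r (HahnSeries.C t) t := by
  have := single (r := r) 0 t
  rwa [zpow_zero, mul_one] at this

theorem one : EvalsTo r 1 1 := by
  have := C (r := r) 1
  rwa [map_one, Rat.cast_one] at this

theorem sum {ι : Type*} {s : Finset ι} {f : ι → ℚ⸨X⸩} {g : ι → ℂ}
    (h : ∀ i ∈ s, EvalsTo r (f i) (g i)) : EvalsTo r (∑ i ∈ s, f i) (∑ i ∈ s, g i) := by
  classical
  induction s using Finset.induction_on with
  | empty => exact zero
  | insert i s hi ih =>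
    rw [Finset.sum_insert hi, Finset.sum_insert hi]
    exact (h i (Finset.mem_insert_self _ _)).add
      (ih fun j hj => h j (Finset.mem_insert_of_mem hj))

/-- Summability in ℂ is absolute, so the product of the two sums may be regrouped by total exponent.
Both supports are bounded below, so each group is finite and is the coefficient of the Laurent
series product. -/
theorem mul (hr : r ≠ 0) (ha : EvalsTo r a c) (hb : EvalsTo r b d) :
    EvalsTo r (a * b) (c * d) := by
  classical
  unfold EvalsTo at ha hb ⊢
  have h2 := hasSum_mul_shift ha hb
  refine h2.prod_fiberwise fun n => ?_
  rw [HahnSeries.coeff_mul]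
  have h3 : ((∑ ij ∈ Finset.antidiagonal a.isPWO_support b.isPWO_support n,
      a.coeff ij.1 * b.coeff ij.2 : ℚ) : ℂ) * r ^ n =
      ∑ i ∈ (Finset.antidiagonal a.isPWO_support b.isPWO_support n).image Prod.fst,
        ((a.coeff i : ℚ) : ℂ) * r ^ i * (((b.coeff (n - i) : ℚ) : ℂ) * r ^ (n - i)) := by
    rw [Finset.sum_image]
    · push_cast
      rw [Finset.sum_mul]
      refine Finset.sum_congr rfl fun ij hij => ?_
      rw [Finset.mem_antidiagonal] at hij
      rw [show n - ij.1 = ij.2 by omega, ← hij.2.2, zpow_add₀ hr]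
      ring
    · intro x hx y hy hxy
      rw [Finset.mem_coe, Finset.mem_antidiagonal] at hx hy
      ext
      · exact hxy
      · omega
  rw [h3]
  refine hasSum_sum_of_ne_finset_zero fun i hi => ?_
  change ((a.coeff i : ℚ) : ℂ) * r ^ i * (((b.coeff (n - i) : ℚ) : ℂ) * r ^ (n - i)) = 0
  by_cases h0 : a.coeff i = 0
  · rw [h0]; simp
  by_cases h0' : b.coeff (n - i) = 0
  · rw [h0']; simp
  exfalso
  refine hi (Finset.mem_image.2 ⟨(i, n - i), ?_, rfl⟩)
  rw [Finset.mem_antidiagonal]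
  exact ⟨h0, h0', by simp⟩

theorem laurentExpand {k : ℕ+} (h : EvalsTo (r ^ (k : ℕ)) a c) :
    EvalsTo r (laurentExpand k a) c := by
  have hinj : Function.Injective fun n : ℤ => (k : ℤ) * n := fun x y hxy =>
    mul_left_cancel₀ (by exact_mod_cast k.ne_zero) hxy
  refine (hinj.hasSum_iff fun j hj => ?_).1 (hasSum_of_eq h fun j => ?_)
  · rw [laurentExpand_coeff_of_not_dvd, Rat.cast_zero, zero_mul]
    rintro ⟨n, rfl⟩
    exact hj ⟨n, rfl⟩
  · rw [Function.comp_apply, laurentExpand_coeff_mul, zpow_mul, zpow_natCast]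

end EvalsTo

/-- The inverse of `1 + z`. -/
theorem exists_evalsTo_inv {r : ℂ} (hr : ‖r‖ < 1) : ∃ u : ℚ⸨X⸩,
    u * (HahnSeries.single 1 1 + 1) = 1 ∧ EvalsTo r u (1 + r)⁻¹ := by
  refine ⟨HahnSeries.ofPowerSeries ℤ ℚ (PowerSeries.mk fun n => (-1) ^ n), ?_, ?_⟩
  · rw [← HahnSeries.ofPowerSeries_X, ← map_one (HahnSeries.ofPowerSeries ℤ ℚ), ← map_add,
      ← map_mul]
    congr 1
    ext n
    rw [mul_add, mul_one, map_add, PowerSeries.coeff_mk, PowerSeries.coeff_one]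
    cases n with
    | zero => simp
    | succ n => rw [PowerSeries.coeff_succ_mul_X, PowerSeries.coeff_mk, pow_succ]; simp
  · have h1 := hasSum_geometric_of_norm_lt_one (ξ := -r) (by rwa [norm_neg])
    rw [sub_neg_eq_add] at h1
    have hinj : Function.Injective fun n : ℕ => (n : ℤ) := Nat.cast_injective
    refine (hinj.hasSum_iff fun j hj => ?_).1 (hasSum_of_eq h1 fun j => ?_)
    · rw [PowerSeries.coeff_coe, if_pos, Rat.cast_zero, zero_mul]
      by_contra! h
      exact hj ⟨j.toNat, Int.toNat_of_nonneg h⟩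
    · rw [Function.comp_apply, PowerSeries.coeff_coe, if_neg (by omega), PowerSeries.coeff_mk,
        Int.natAbs_natCast, zpow_natCast, neg_pow]
      push_cast
      rfl

/-- Coefficientwise evaluation. -/
def EvalsToCoeff (r : ℂ) (f : MvPowerSeries ℕ ℚ⸨X⸩) (g : MvPowerSeries ℕ ℂ) : Prop :=
  ∀ m, EvalsTo r (MvPowerSeries.coeff m f) (MvPowerSeries.coeff m g)

/-- Division of power series is recursive in the degree, and the only inverse it takes is that of
the constant coefficient. Convergence at r is not inherited by inverses of Laurent series, which is
why an inverse u with a known value is supplied. -/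
theorem EvalsToCoeff.of_mul {r : ℂ} (hr : r ≠ 0) {F G H : MvPowerSeries ℕ ℚ⸨X⸩}
    {f g h : MvPowerSeries ℕ ℂ} (hF : EvalsToCoeff r F f) (hH : EvalsToCoeff r H h)
    (hFG : F * G = H) (hfg : f * g = h) {u : ℚ⸨X⸩} {v : ℂ}
    (hu : u * MvPowerSeries.constantCoeff F = 1) (huv : EvalsTo r u v) : EvalsToCoeff r G g := by
  classical
  have hv : v * MvPowerSeries.constantCoeff f = 1 := by
    have := huv.mul hr (hF 0)
    rw [MvPowerSeries.coeff_zero_eq_constantCoeff_apply, hu,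
      MvPowerSeries.coeff_zero_eq_constantCoeff_apply] at this
    exact this.unique EvalsTo.one
  have key : ∀ {R : Type} [CommRing R] (F G : MvPowerSeries ℕ R) (u : R)
      (_ : u * MvPowerSeries.constantCoeff F = 1) (m : ℕ →₀ ℕ), MvPowerSeries.coeff m G =
      u * (MvPowerSeries.coeff m (F * G) - ∑ p ∈ (Finset.HasAntidiagonal.antidiagonal m).erase (0, m),
        MvPowerSeries.coeff p.1 F * MvPowerSeries.coeff p.2 G) := by
    intro R _ F G u hu m
    rw [MvPowerSeries.coeff_mul, ← Finset.add_sum_erase _ _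
      (Finset.HasAntidiagonal.mem_antidiagonal.2 (zero_add m) : (0, m) ∈ Finset.HasAntidiagonal.antidiagonal m),
      add_sub_cancel_right, ← mul_assoc, MvPowerSeries.coeff_zero_eq_constantCoeff_apply, hu,
      one_mul]
  intro m
  induction hn : m.degree using Nat.strong_induction_on generalizing m with
  | _ n ih =>
    rw [key F G u hu, key f g v hv, hFG, hfg]
    refine huv.mul hr ((hH m).sub (EvalsTo.sum fun p hp => ?_))
    rw [Finset.mem_erase, Finset.HasAntidiagonal.mem_antidiagonal] at hp
    refine (hF p.1).mul hr (ih p.2.degree ?_ p.2 rfl)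
    have h0 : p.1 ≠ 0 := by
      intro h0
      refine hp.1 (Prod.ext h0 ?_)
      have := hp.2
      rwa [h0, zero_add] at this
    have h1 : p.1.degree ≠ 0 := by rwa [Ne, Finsupp.degree_eq_zero_iff]
    rw [← hn, ← hp.2, map_add]
    omega

/-- As W has no constant coefficient, |m| S_m is a polynomial expression in coefficients of S of
smaller degree and coefficients of W of degree at most |m|. Information on W up to degree L
therefore suffices, and a truncated Euler product can be compared. -/
theorem EvalsToCoeff.of_euler_eq {r : ℂ} (hr : r ≠ 0) {S W : MvPowerSeries ℕ ℚ⸨X⸩}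
    {s w : MvPowerSeries ℕ ℂ} {L : ℕ} (hS : euler _ S = S * W) (hs : euler _ s = s * w)
    (hW0 : MvPowerSeries.constantCoeff W = 0) (hw0 : MvPowerSeries.constantCoeff w = 0)
    (hW : ∀ m, m.degree ≤ L → EvalsTo r (MvPowerSeries.coeff m W) (MvPowerSeries.coeff m w))
    (h0 : EvalsTo r (MvPowerSeries.constantCoeff S) (MvPowerSeries.constantCoeff s))
    (m : ℕ →₀ ℕ) (hm : m.degree ≤ L) :
    EvalsTo r (MvPowerSeries.coeff m S) (MvPowerSeries.coeff m s) := by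
  classical
  have key : ∀ {R : Type} [CommRing R] (F G : MvPowerSeries ℕ R)
      (_ : euler _ F = F * G) (_ : MvPowerSeries.constantCoeff G = 0)
      (m : ℕ →₀ ℕ), (m.degree : R) * MvPowerSeries.coeff m F =
      ∑ p ∈ (Finset.HasAntidiagonal.antidiagonal m).erase (m, 0),
        MvPowerSeries.coeff p.1 F * MvPowerSeries.coeff p.2 G := by
    intro R _ F G h h0 m
    rw [← coeff_euler, h, MvPowerSeries.coeff_mul, ← Finset.add_sum_erase _ _
      (Finset.HasAntidiagonal.mem_antidiagonal.2 (add_zero m) : (m, 0) ∈ Finset.HasAntidiagonal.antidiagonal m),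
      MvPowerSeries.coeff_zero_eq_constantCoeff_apply, h0, mul_zero, zero_add]
  induction hn : m.degree using Nat.strong_induction_on generalizing m with
  | _ n ih =>
    by_cases hm0 : m = 0
    · subst hm0
      exact h0
    have hd : m.degree ≠ 0 := by rwa [Ne, Finsupp.degree_eq_zero_iff]
    have h1 : EvalsTo r ((m.degree : ℚ⸨X⸩) * MvPowerSeries.coeff m S)
        ((m.degree : ℂ) * MvPowerSeries.coeff m s) := by
      rw [key S W hS hW0, key s w hs hw0]
      refine EvalsTo.sum fun p hp => ?_
      rw [Finset.mem_erase, Finset.HasAntidiagonal.mem_antidiagonal] at hp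
      have hp2 : p.2 ≠ 0 := by
        intro h0
        refine hp.1 (Prod.ext ?_ h0)
        have := hp.2
        rwa [h0, add_zero] at this
      have h1 : p.2.degree ≠ 0 := by rwa [Ne, Finsupp.degree_eq_zero_iff]
      have h2 : p.1.degree + p.2.degree = m.degree := by rw [← map_add, hp.2]
      exact (ih p.1.degree (by omega) p.1 (by omega) rfl).mul hr (hW p.2 (by omega))
    have h2 := (EvalsTo.C (r := r) (m.degree : ℚ)⁻¹).mul hr h1
    rw [← mul_assoc, ← mul_assoc, ← map_natCast (HahnSeries.C (Γ := ℤ) (R := ℚ)), ← map_mul,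
      inv_mul_cancel₀ (by exact_mod_cast hd), map_one HahnSeries.C, one_mul] at h2
    push_cast at h2
    rwa [inv_mul_cancel₀ (by exact_mod_cast hd), one_mul] at h2


/-! ### Values of the stable series -/

theorem not_dvd_of_not_smul {k : ℕ} {m : ℕ →₀ ℕ} (h : ¬ ∃ m', m = k • m') : ∃ i, ¬ k ∣ m i := by
  rcases k.eq_zero_or_pos with rfl | hk
  · by_contra! hc
    refine h ⟨0, Finsupp.ext fun i => ?_⟩
    simpa using hc i
  by_contra! hc
  choose c hcc using hc
  refine h ⟨Finsupp.mapRange (fun n => n / k) (Nat.zero_div _) m, Finsupp.ext fun i => ?_⟩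
  rw [Finsupp.smul_apply, Finsupp.mapRange_apply, hcc i, Nat.mul_div_cancel_left _ hk,
    smul_eq_mul]

/-- The substitution `x_i ↦ x_i ^ k`. -/
noncomputable def expandC (k : ℕ+) : MvPowerSeries ℕ ℂ →ₐ[ℂ] MvPowerSeries ℕ ℂ :=
  MvPowerSeries.expand (k : ℕ) k.ne_zero

theorem coeff_expandC_smul (k : ℕ+) (f : MvPowerSeries ℕ ℂ) (m : ℕ →₀ ℕ) :
    MvPowerSeries.coeff ((k : ℕ) • m) (expandC k f) = MvPowerSeries.coeff m f :=
  MvPowerSeries.coeff_expand_smul _ k.ne_zero f m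

theorem coeff_expandC_of_not_dvd (k : ℕ+) (f : MvPowerSeries ℕ ℂ) (m : ℕ →₀ ℕ)
    (h : ¬ ∃ m', m = (k : ℕ) • m') : MvPowerSeries.coeff m (expandC k f) = 0 := by
  obtain ⟨i, hi⟩ := not_dvd_of_not_smul h
  exact MvPowerSeries.coeff_expand_of_not_dvd _ k.ne_zero f hi

theorem constantCoeff_expandC (k : ℕ+) (f : MvPowerSeries ℕ ℂ) :
    MvPowerSeries.constantCoeff (expandC k f) = MvPowerSeries.constantCoeff f :=
  MvPowerSeries.constantCoeff_expand _ k.ne_zero f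

theorem euler_expandC (k : ℕ+) (f : MvPowerSeries ℕ ℂ) :
    euler ℂ (expandC k f) = ((k : ℕ) : ℂ) • expandC k (euler ℂ f) := by
  ext1 m
  rw [coeff_euler, MvPowerSeries.coeff_smul]
  by_cases h : ∃ m', m = (k : ℕ) • m'
  · obtain ⟨m', rfl⟩ := h
    rw [coeff_expandC_smul, coeff_expandC_smul, coeff_euler, map_nsmul, smul_eq_mul]
    push_cast
    ring
  · rw [coeff_expandC_of_not_dvd k _ _ h, coeff_expandC_of_not_dvd k _ _ h]
    simp

theorem coeff_expandC_eq_zero_of_lt {f : MvPowerSeries ℕ ℂ}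
    (hf : MvPowerSeries.constantCoeff f = 0) {k : ℕ+} {m : ℕ →₀ ℕ} (h : m.degree < k) :
    MvPowerSeries.coeff m (expandC k f) = 0 := by
  by_cases hm : ∃ m', m = (k : ℕ) • m'
  · obtain ⟨m', rfl⟩ := hm
    rw [map_nsmul, smul_eq_mul] at h
    have : m'.degree = 0 := by
      by_contra h0
      have := Nat.le_mul_of_pos_right (k : ℕ) (Nat.pos_of_ne_zero h0)
      omega
    rw [Finsupp.degree_eq_zero_iff] at this
    rw [this, coeff_expandC_smul, MvPowerSeries.coeff_zero_eq_constantCoeff_apply, hf]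
  · exact coeff_expandC_of_not_dvd k f m hm

theorem EvalsToCoeff.adams {r : ℂ} {k : ℕ+} {F : MvPowerSeries ℕ ℚ⸨X⸩} {f : MvPowerSeries ℕ ℂ}
    (h : EvalsToCoeff (r ^ (k : ℕ)) F f) : EvalsToCoeff r (adams k F) (expandC k f) := by
  intro m
  by_cases hm : ∃ m', m = (k : ℕ) • m'
  · obtain ⟨m', rfl⟩ := hm
    rw [coeff_adams_smul, coeff_expandC_smul]
    exact (h m').laurentExpand
  · rw [coeff_adams_of_not_dvd k _ _ hm, coeff_expandC_of_not_dvd k _ _ hm]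
    exact EvalsTo.zero

/-- The value of `baseSeries` at `z = r`. -/
noncomputable def baseValue (r : ℂ) : MvPowerSeries ℕ ℂ := MvPowerSeries.C r + evenH ℂ

theorem constantCoeff_baseValue (r : ℂ) : MvPowerSeries.constantCoeff (baseValue r) = r + 1 := by
  rw [baseValue, map_add, MvPowerSeries.constantCoeff_C, constantCoeff_evenH]

theorem add_one_ne_zero_of_norm_lt {r : ℂ} (hr : ‖r‖ < 1) : r + 1 ≠ 0 := by
  intro h
  rw [eq_neg_of_add_eq_zero_left h, norm_neg, norm_one] at hr
  exact lt_irrefl _ hr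

/-- The value of `logDerivBase` at `z = r`. -/
noncomputable def logDerivValue (r : ℂ) : MvPowerSeries ℕ ℂ :=
  (baseValue r)⁻¹ * euler ℂ (baseValue r)

theorem baseValue_mul_logDerivValue {r : ℂ} (hr : ‖r‖ < 1) :
    baseValue r * logDerivValue r = euler ℂ (baseValue r) := by
  rw [logDerivValue, ← mul_assoc, MvPowerSeries.mul_inv_cancel, one_mul]
  rw [constantCoeff_baseValue]
  exact add_one_ne_zero_of_norm_lt hr

theorem constantCoeff_logDerivValue (r : ℂ) :
    MvPowerSeries.constantCoeff (logDerivValue r) = 0 := by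
  rw [logDerivValue, map_mul, constantCoeff_euler, mul_zero]

theorem evalsToCoeff_baseSeries (r : ℂ) : EvalsToCoeff r baseSeries (baseValue r) := by
  classical
  intro m
  rw [baseSeries, baseValue, map_add, map_add, coeff_evenH, coeff_evenH, zPow,
    MvPowerSeries.coeff_C, MvPowerSeries.coeff_C]
  refine EvalsTo.add ?_ ?_
  · split_ifs
    · have := EvalsTo.single (r := r) 1 1
      rwa [Rat.cast_one, one_mul, zpow_one] at this
    · exact EvalsTo.zero
  · split_ifs
    · exact EvalsTo.one
    · exact EvalsTo.zero

theorem EvalsToCoeff.euler {r : ℂ} (hr : r ≠ 0) {F : MvPowerSeries ℕ ℚ⸨X⸩}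
    {f : MvPowerSeries ℕ ℂ} (h : EvalsToCoeff r F f) :
    EvalsToCoeff r (euler _ F) (euler _ f) := by
  intro m
  rw [coeff_euler, coeff_euler]
  have := (EvalsTo.C (r := r) (m.degree : ℚ)).mul hr (h m)
  rwa [map_natCast, Rat.cast_natCast] at this

theorem evalsToCoeff_logDerivBase {r : ℂ} (hr0 : r ≠ 0) (hr : ‖r‖ < 1) :
    EvalsToCoeff r logDerivBase (logDerivValue r) := by
  obtain ⟨u, hu, huv⟩ := exists_evalsTo_inv hr
  refine EvalsToCoeff.of_mul hr0 (evalsToCoeff_baseSeries r)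
    ((evalsToCoeff_baseSeries r).euler hr0) baseSeries_mul_logDerivBase
    (baseValue_mul_logDerivValue hr) ?_ huv
  rwa [constantCoeff_baseSeries]

/-- The local factor `(1 + r ^ k)⁻¹ (r ^ k + ∑ h_{2j} (x ^ k))`. -/
noncomputable def localFactor (r : ℂ) (k : ℕ+) : MvPowerSeries ℕ ℂ :=
  MvPowerSeries.C (1 + r ^ (k : ℕ))⁻¹ * expandC k (baseValue (r ^ (k : ℕ)))

theorem norm_pow_lt_one {r : ℂ} (hr : ‖r‖ < 1) (k : ℕ+) : ‖r ^ (k : ℕ)‖ < 1 := by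
  rw [norm_pow]
  exact pow_lt_one₀ (norm_nonneg _) hr k.ne_zero

theorem constantCoeff_localFactor {r : ℂ} (hr : ‖r‖ < 1) (k : ℕ+) :
    MvPowerSeries.constantCoeff (localFactor r k) = 1 := by
  rw [localFactor, map_mul, MvPowerSeries.constantCoeff_C, constantCoeff_expandC,
    constantCoeff_baseValue, add_comm (r ^ (k : ℕ)), inv_mul_cancel₀]
  rw [add_comm]
  exact add_one_ne_zero_of_norm_lt (norm_pow_lt_one hr k)

theorem euler_localFactor {r : ℂ} (hr : ‖r‖ < 1) (k : ℕ+) : euler ℂ (localFactor r k) =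
    localFactor r k * (((k : ℕ) : ℂ) • expandC k (logDerivValue (r ^ (k : ℕ)))) := by
  rw [localFactor, Derivation.leibniz, euler_C, smul_zero, add_zero, euler_expandC, smul_eq_mul,
    mul_assoc]
  congr 1
  rw [mul_smul_comm, ← map_mul (expandC k), baseValue_mul_logDerivValue (norm_pow_lt_one hr k)]

/-- The Euler product `(1 - r) ∏_{k ≤ L} (localFactor r k) ^ (N k)`. -/
noncomputable def eulerProduct (r : ℂ) (N : ℕ → ℕ) (L : ℕ) : MvPowerSeries ℕ ℂ :=
  MvPowerSeries.C (1 - r) * Finset.prod (pnatLE L) fun k : ℕ+ => localFactor r k ^ N k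

theorem euler_prod {ι : Type*} (s : Finset ι) (f g : ι → MvPowerSeries ℕ ℂ)
    (h : ∀ i ∈ s, euler ℂ (f i) = f i * g i) :
    euler ℂ (∏ i ∈ s, f i) = (∏ i ∈ s, f i) * ∑ i ∈ s, g i := by
  classical
  induction s using Finset.induction_on with
  | empty => rw [Finset.prod_empty, Finset.sum_empty, Derivation.map_one_eq_zero, mul_zero]
  | insert i s hi ih =>
    rw [Finset.prod_insert hi, Finset.sum_insert hi, Derivation.leibniz,
      ih fun j hj => h j (Finset.mem_insert_of_mem hj), h i (Finset.mem_insert_self _ _),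
      smul_eq_mul, smul_eq_mul]
    ring

theorem euler_pow_eq {f g : MvPowerSeries ℕ ℂ} (h : euler ℂ f = f * g) (n : ℕ) :
    euler ℂ (f ^ n) = f ^ n * ((n : ℂ) • g) := by
  have := euler_prod (Finset.range n) (fun _ => f) (fun _ => g) fun _ _ => h
  rwa [Finset.prod_const, Finset.sum_const, Finset.card_range, ← Nat.cast_smul_eq_nsmul ℂ] at this

theorem constantCoeff_eulerProduct {r : ℂ} (hr : ‖r‖ < 1) (N : ℕ → ℕ) (L : ℕ) :
    MvPowerSeries.constantCoeff (eulerProduct r N L) = 1 - r := by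
  rw [eulerProduct, map_mul, MvPowerSeries.constantCoeff_C, map_prod, Finset.prod_eq_one, mul_one]
  intro k _
  rw [map_pow, constantCoeff_localFactor hr, one_pow]

/-- Comparison of logarithmic derivatives: the hypothesis on N says that grouping the pairs (k, j)
by n = kj turns ∑ μ(j) r^{-k} ψ_{kj} into ∑ n N_n ψ_n. Evaluating ψ_n at z = r uses the value of the
logarithmic derivative of g at r^n. -/
theorem evalsTo_coeff_stableSeries {r : ℂ} (hr0 : r ≠ 0) (hr : ‖r‖ < 1) (N : ℕ → ℕ)
    (hN : ∀ n : ℕ, 0 < n → ((n : ℂ) * N n) =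
      ∑ p ∈ n.divisorsAntidiagonal, (r ^ p.1)⁻¹ * (ArithmeticFunction.moebius p.2 : ℂ))
    (L : ℕ) (m : ℕ →₀ ℕ) (hm : m.degree ≤ L) :
    EvalsTo r (MvPowerSeries.coeff m stableSeries) (MvPowerSeries.coeff m (eulerProduct r N L)) := by
  classical
  obtain ⟨W, hW, hWc⟩ := euler_stableSeries
  set w : MvPowerSeries ℕ ℂ := Finset.sum (pnatLE L) fun k : ℕ+ =>
    (N k : ℂ) • (((k : ℕ) : ℂ) • expandC k (logDerivValue (r ^ (k : ℕ)))) with hw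
  have hE : euler ℂ (eulerProduct r N L) = eulerProduct r N L * w := by
    rw [eulerProduct, Derivation.leibniz, euler_C, smul_zero, add_zero, smul_eq_mul, mul_assoc,
      euler_prod _ _ (fun k : ℕ+ =>
        (N k : ℂ) • (((k : ℕ) : ℂ) • expandC k (logDerivValue (r ^ (k : ℕ)))))
        fun k _ => euler_pow_eq (euler_localFactor hr k) _]
  refine EvalsToCoeff.of_euler_eq hr0 hW hE ?_ ?_ (fun m hm => ?_) ?_ m hm
  · have := hWc 0 0 (by simp)
    rw [← MvPowerSeries.coeff_zero_eq_constantCoeff_apply, this]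
    refine Finset.sum_eq_zero fun k _ => Finset.sum_eq_zero fun j _ => ?_
    rw [coeff_adams_eq_zero_of_lt constantCoeff_logDerivBase (by simp), mul_zero]
  · rw [hw, map_sum]
    refine Finset.sum_eq_zero fun k _ => ?_
    rw [← MvPowerSeries.coeff_zero_eq_constantCoeff_apply, MvPowerSeries.coeff_smul,
      MvPowerSeries.coeff_smul, coeff_expandC_eq_zero_of_lt (constantCoeff_logDerivValue _)
        (by simp), mul_zero, mul_zero]
  · set c : ℕ+ → ℂ := fun n =>
      MvPowerSeries.coeff m (expandC n (logDerivValue (r ^ (n : ℕ)))) with hc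
    have hc0 : ∀ n : ℕ+, L < n → c n = 0 := fun n hn =>
      coeff_expandC_eq_zero_of_lt (constantCoeff_logDerivValue _) (by omega)
    have h1 : MvPowerSeries.coeff m w = Finset.sum (pnatLE L) fun k : ℕ+ =>
        Finset.sum (pnatLE L) fun j : ℕ+ =>
          (((ArithmeticFunction.moebius (j : ℕ) : ℚ) : ℂ) * r ^ (-(k : ℤ))) * c (k * j) := by
      rw [← Finset.sum_product', hw, map_sum]
      have h2 : ∀ n ∈ pnatLE L, MvPowerSeries.coeff m ((N n : ℂ) • (((n : ℕ) : ℂ) •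
          expandC n (logDerivValue (r ^ (n : ℕ))))) =
          ∑ p ∈ (pnatLE L ×ˢ pnatLE L).filter (fun p => p.1 * p.2 = n),
            (((ArithmeticFunction.moebius (p.2 : ℕ) : ℚ) : ℂ) * r ^ (-(p.1 : ℤ))) *
              c (p.1 * p.2) := by
        intro n hn
        rw [MvPowerSeries.coeff_smul, MvPowerSeries.coeff_smul, ← mul_assoc,
          mul_comm (N n : ℂ), hN n n.pos, Finset.sum_mul]
        symm
        refine Finset.sum_bij (fun p _ => ((p.1 : ℕ), (p.2 : ℕ))) ?_ ?_ ?_ ?_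
        · intro p hp
          rw [Nat.mem_divisorsAntidiagonal]
          rw [Finset.mem_filter] at hp
          exact ⟨by rw [← hp.2]; simp, n.ne_zero⟩
        · intro p _ p' _ h
          rw [Prod.mk.injEq] at h
          exact Prod.ext (PNat.coe_injective h.1) (PNat.coe_injective h.2)
        · intro p hp
          rw [Nat.mem_divisorsAntidiagonal] at hp
          have hp1 : 0 < p.1 := Nat.pos_of_ne_zero fun h => hp.2 (by rw [← hp.1, h, zero_mul])
          have hp2 : 0 < p.2 := Nat.pos_of_ne_zero fun h => hp.2 (by rw [← hp.1, h, mul_zero])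
          rw [mem_pnatLE] at hn
          refine ⟨(⟨p.1, hp1⟩, ⟨p.2, hp2⟩), ?_, rfl⟩
          rw [Finset.mem_filter, Finset.mem_product, mem_pnatLE, mem_pnatLE]
          refine ⟨⟨?_, ?_⟩, PNat.eq ?_⟩
          · exact (Nat.le_mul_of_pos_right _ hp2).trans (hp.1.le.trans hn)
          · exact (Nat.le_mul_of_pos_left _ hp1).trans (hp.1.le.trans hn)
          · exact hp.1
        · intro p hp
          rw [Finset.mem_filter] at hp
          rw [hp.2, Rat.cast_intCast, zpow_neg, zpow_natCast]
          ring
      rw [Finset.sum_congr rfl h2]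
      simp only [Finset.sum_filter]
      rw [Finset.sum_comm]
      refine Finset.sum_congr rfl fun p _ => ?_
      -- Pairs with kj > L belong to no group, but their terms vanish because ψ_{kj} starts in
      -- degree kj.
      rw [Finset.sum_ite_eq]
      split_ifs with hp
      · rfl
      · rw [mem_pnatLE, not_le] at hp
        rw [hc0 _ hp, mul_zero]
    rw [hWc m L hm, h1]
    refine EvalsTo.sum fun k _ => EvalsTo.sum fun j _ => (EvalsTo.single _ _).mul hr0 ?_
    refine EvalsToCoeff.adams (evalsToCoeff_logDerivBase (pow_ne_zero _ hr0) ?_) m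
    exact norm_pow_lt_one hr _
  · rw [constantCoeff_stableSeries, constantCoeff_eulerProduct hr]
    have := EvalsTo.one.sub (EvalsTo.single (r := r) 1 1)
    rwa [Rat.cast_one, one_mul, zpow_one] at this


/-! ### Generating series over monic polynomials -/

section GeneratingSeries

variable {F : Type*} [Field F]

section

variable [Finite F]

theorem finite_degreeLT (n : ℕ) : Finite (degreeLT F n) :=
  Finite.of_equiv _ (degreeLTEquiv F n).toEquiv.symm

theorem finite_monic_natDegree_eq (n : ℕ) : {f : F[X] | f.Monic ∧ f.natDegree = n}.Finite := by
  have := finite_degreeLT (F := F) n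
  exact Finite.of_equiv _ (monicEquivDegreeLT n).symm

variable (F) in
/-- The monic polynomials of degree `n`. -/
noncomputable def monics (n : ℕ) : Finset F[X] := (finite_monic_natDegree_eq n).toFinset

theorem mem_monics {f : F[X]} {n : ℕ} : f ∈ monics F n ↔ f.Monic ∧ f.natDegree = n := by
  simp [monics]

theorem card_monics (n : ℕ) : (monics F n).card = Nat.card F ^ n := by
  rw [monics, ← Nat.card_eq_card_finite_toFinset]
  have e := (monicEquivDegreeLT (R := F) n).trans (degreeLTEquiv F n).toEquiv
  refine (Nat.card_congr e).trans ?_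
  rw [Nat.card_fun]
  simp

theorem monics_zero : monics F 0 = {1} := by
  ext f
  rw [mem_monics, Finset.mem_singleton]
  constructor
  · rintro ⟨h, h0⟩
    exact eq_one_of_monic_natDegree_zero h h0
  · rintro rfl
    exact ⟨monic_one, natDegree_one⟩

/-- The generating series `∑ w(m) t ^ (deg m)`, the sum being over monic `m`. -/
noncomputable def genSeries (w : F[X] → ℂ) : PowerSeries ℂ :=
  PowerSeries.mk fun n => ∑ m ∈ monics F n, w m

theorem coeff_genSeries (w : F[X] → ℂ) (n : ℕ) :
    PowerSeries.coeff n (genSeries w) = ∑ m ∈ monics F n, w m := PowerSeries.coeff_mk _ _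

theorem genSeries_congr {w w' : F[X] → ℂ} (h : ∀ m : F[X], m.Monic → w m = w' m) :
    genSeries w = genSeries w' := by
  ext n
  rw [coeff_genSeries, coeff_genSeries]
  exact Finset.sum_congr rfl fun m hm => h m (mem_monics.1 hm).1

end

/-- `w` is completely multiplicative on monic polynomials. -/
def IsMulWeight (w : F[X] → ℂ) : Prop :=
  ∀ a b : F[X], a.Monic → b.Monic → w (a * b) = w a * w b

open Classical in
/-- Restriction of a weight to the polynomials coprime to the primes in `S`. -/
noncomputable def restrictWeight (S : Finset F[X]) (w : F[X] → ℂ) : F[X] → ℂ :=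
  fun m => if ∀ P ∈ S, ¬ P ∣ m then w m else 0

theorem IsMulWeight.restrict {w : F[X] → ℂ} (hw : IsMulWeight w) {S : Finset F[X]}
    (hS : ∀ P ∈ S, P.Monic ∧ Irreducible P) : IsMulWeight (restrictWeight S w) := by
  intro a b ha hb
  have h : (∀ P ∈ S, ¬ P ∣ a * b) ↔ (∀ P ∈ S, ¬ P ∣ a) ∧ ∀ P ∈ S, ¬ P ∣ b := by
    rw [← forall₂_and]
    refine forall₂_congr fun P hP => ?_
    rw [(hS P hP).2.prime.dvd_mul, not_or]
  simp only [restrictWeight]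
  by_cases h1 : ∀ P ∈ S, ¬ P ∣ a
  · by_cases h2 : ∀ P ∈ S, ¬ P ∣ b
    · rw [if_pos (h.2 ⟨h1, h2⟩), if_pos h1, if_pos h2, hw a b ha hb]
    · rw [if_neg (fun hc => h2 (h.1 hc).2), if_neg h2, mul_zero]
  · rw [if_neg (fun hc => h1 (h.1 hc).1), if_neg h1, zero_mul]

theorem eq_of_monic_irreducible_dvd {P Q : F[X]} (hP : P.Monic ∧ Irreducible P)
    (hQ : Q.Monic ∧ Irreducible Q) (h : P ∣ Q) : P = Q :=
  eq_of_monic_of_associated hP.1 hQ.1 (hP.2.associated_of_dvd hQ.2 h)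

theorem exists_monic_irreducible_dvd {m : F[X]} (hm : m.Monic) (h : m ≠ 1) :
    ∃ P : F[X], (P.Monic ∧ Irreducible P) ∧ P ∣ m := by
  obtain ⟨P, hPm, hP, hd⟩ := exists_monic_irreducible_factor m fun hu => h (hm.eq_one_of_isUnit hu)
  exact ⟨P, ⟨hPm, hP⟩, hd⟩

variable [Finite F]

-- Multiplication by P is a bijection from the monics of degree n - deg P onto the multiples of P of
-- degree n, so the product with w(P) t^{deg P} collects exactly the multiples of P.
open Classical in
theorem genSeries_mul_one_sub {w : F[X] → ℂ} (hw : IsMulWeight w) {P : F[X]} (hP : P.Monic) :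
    genSeries w * (1 - PowerSeries.C (w P) * PowerSeries.X ^ P.natDegree) =
      genSeries fun m => if P ∣ m then 0 else w m := by
  have h1 : genSeries w * (PowerSeries.C (w P) * PowerSeries.X ^ P.natDegree) =
      genSeries fun m => if P ∣ m then w m else 0 := by
    ext n
    rw [mul_comm, mul_assoc, PowerSeries.coeff_C_mul, PowerSeries.coeff_X_pow_mul', coeff_genSeries,
      coeff_genSeries, ← Finset.sum_filter]
    split_ifs with hn
    · rw [Finset.mul_sum]
      refine Finset.sum_bij (fun m _ => P * m) ?_ ?_ ?_ ?_
      · intro m hm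
        rw [mem_monics] at hm
        rw [Finset.mem_filter, mem_monics]
        refine ⟨⟨hP.mul hm.1, ?_⟩, dvd_mul_right _ _⟩
        rw [hP.natDegree_mul hm.1, hm.2]
        omega
      · intro m _ m' _ h
        exact mul_left_cancel₀ hP.ne_zero h
      · intro m hm
        rw [Finset.mem_filter, mem_monics] at hm
        obtain ⟨m', rfl⟩ := hm.2
        have hm' : m'.Monic := hP.of_mul_monic_left hm.1.1
        refine ⟨m', mem_monics.2 ⟨hm', ?_⟩, rfl⟩
        rw [← hm.1.2, hP.natDegree_mul hm']
        omega
      · intro m hm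
        exact (hw P m hP (mem_monics.1 hm).1).symm
    · rw [mul_zero]
      refine (Finset.sum_eq_zero fun m hm => ?_).symm
      rw [Finset.mem_filter, mem_monics] at hm
      exact absurd (hm.1.2 ▸ natDegree_le_of_dvd hm.2 hm.1.1.ne_zero) hn
  rw [mul_sub, mul_one, h1, sub_eq_iff_eq_add]
  ext n
  rw [map_add, coeff_genSeries, coeff_genSeries, coeff_genSeries, ← Finset.sum_add_distrib]
  refine Finset.sum_congr rfl fun m _ => ?_
  split_ifs <;> simp

theorem genSeries_mul_prod {w : F[X] → ℂ} (hw : IsMulWeight w) {S : Finset F[X]}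
    (hS : ∀ P ∈ S, P.Monic ∧ Irreducible P) :
    genSeries w * ∏ P ∈ S, (1 - PowerSeries.C (w P) * PowerSeries.X ^ P.natDegree) =
      genSeries (restrictWeight S w) := by
  classical
  induction S using Finset.induction_on with
  | empty =>
    rw [Finset.prod_empty, mul_one]
    refine genSeries_congr fun m _ => ?_
    rw [restrictWeight, if_pos (by simp)]
  | insert Q S hQ ih =>
    have hS' : ∀ P ∈ S, P.Monic ∧ Irreducible P := fun P hP => hS P (Finset.mem_insert_of_mem hP)
    have hQ' := hS Q (Finset.mem_insert_self _ _)
    -- Distinct monic irreducibles do not divide each other, so sieving by S leaves the weight of Q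
    -- unchanged and the next prime can be sieved out.
    have hwQ : restrictWeight S w Q = w Q := by
      rw [restrictWeight, if_pos]
      intro P hP hd
      exact hQ (eq_of_monic_irreducible_dvd (hS' P hP) hQ' hd ▸ hP)
    rw [Finset.prod_insert hQ, mul_left_comm, ih hS', mul_comm, ← hwQ,
      genSeries_mul_one_sub (hw.restrict hS') hQ'.1]
    refine genSeries_congr fun m _ => ?_
    simp only [restrictWeight, Finset.forall_mem_insert]
    by_cases h1 : Q ∣ m
    · rw [if_pos h1, if_neg fun h => h.1 h1]
    · rw [if_neg h1]
      congr 1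
      rw [eq_iff_iff]
      exact ⟨fun h => ⟨h1, h⟩, fun h => h.2⟩

variable (F) in
/-- The monic irreducible polynomials of degree at most `N`. -/
noncomputable def primesLE (N : ℕ) : Finset F[X] := by
  classical
  exact ((Finset.range (N + 1)).biUnion (monics F)).filter Irreducible

theorem mem_primesLE {N : ℕ} {P : F[X]} :
    P ∈ primesLE F N ↔ (P.Monic ∧ Irreducible P) ∧ P.natDegree ≤ N := by
  classical
  rw [primesLE, Finset.mem_filter, Finset.mem_biUnion]
  constructor
  · rintro ⟨⟨n, hn, h⟩, hi⟩
    rw [mem_monics] at h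
    rw [Finset.mem_range] at hn
    exact ⟨⟨h.1, hi⟩, by omega⟩
  · rintro ⟨⟨hm, hi⟩, hN⟩
    exact ⟨⟨P.natDegree, Finset.mem_range.2 (by omega), mem_monics.2 ⟨hm, rfl⟩⟩, hi⟩

theorem isMonicIrreducible_of_mem_primesLE {N : ℕ} {P : F[X]} (h : P ∈ primesLE F N) :
    P.Monic ∧ Irreducible P := (mem_primesLE.1 h).1

/-- The Euler product, truncated: `G_w ∏_{deg P ≤ N} (1 - w(P) t ^ (deg P)) ≡ 1` modulo
`t ^ (N + 1)`. -/
theorem coeff_genSeries_restrict_primesLE {w : F[X] → ℂ} (h1 : w 1 = 1) {N n : ℕ} (hn : n ≤ N) :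
    PowerSeries.coeff n (genSeries (restrictWeight (primesLE F N) w)) = if n = 0 then 1 else 0 := by
  rw [coeff_genSeries]
  split_ifs with h0
  · rw [h0, monics_zero, Finset.sum_singleton, restrictWeight, if_pos, h1]
    intro P hP hd
    exact (isMonicIrreducible_of_mem_primesLE hP).2.not_isUnit (isUnit_of_dvd_one hd)
  · refine Finset.sum_eq_zero fun m hm => ?_
    rw [mem_monics] at hm
    obtain ⟨P, hP, hd⟩ := exists_monic_irreducible_dvd hm.1 (by
      rintro rfl
      rw [natDegree_one] at hm
      exact h0 hm.2.symm)
    rw [restrictWeight, if_neg]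
    push Not
    refine ⟨P, mem_primesLE.2 ⟨hP, ?_⟩, hd⟩
    have := natDegree_le_of_dvd hd hm.1.ne_zero
    omega

end GeneratingSeries

/-! ### Normalized limits of coefficients -/

section NormLimit

/-- The coefficients of `G`, divided by `q ^ n`, tend to `L`. -/
def HasNormLimit (q : ℝ) (G : PowerSeries ℂ) (L : ℂ) : Prop :=
  Tendsto (fun n => PowerSeries.coeff n G / (q : ℂ) ^ n) atTop (𝓝 L)

variable {q : ℝ} {G : PowerSeries ℂ} {L : ℂ}

theorem HasNormLimit.mul_one_sub (hq : 1 < q) (h : HasNormLimit q G L) (r : ℂ) (k : ℕ) :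
    HasNormLimit q (G * (1 - PowerSeries.C r * PowerSeries.X ^ k)) (L * (1 - r / (q : ℂ) ^ k)) := by
  have hq0 : (q : ℂ) ≠ 0 := by
    rw [Ne, Complex.ofReal_eq_zero]
    linarith
  have h1 : Tendsto (fun n => PowerSeries.coeff n G / (q : ℂ) ^ n -
      r / (q : ℂ) ^ k * (PowerSeries.coeff (n - k) G / (q : ℂ) ^ (n - k))) atTop
      (𝓝 (L - r / (q : ℂ) ^ k * L)) :=
    h.sub (tendsto_const_nhds.mul (h.comp (tendsto_sub_atTop_nat k)))
  have h2 : L * (1 - r / (q : ℂ) ^ k) = L - r / (q : ℂ) ^ k * L := by ring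
  rw [HasNormLimit, h2]
  refine h1.congr' ?_
  filter_upwards [eventually_ge_atTop k] with n hn
  rw [mul_sub, mul_one, mul_comm G, mul_assoc, map_sub, PowerSeries.coeff_C_mul,
    PowerSeries.coeff_X_pow_mul', if_pos hn, sub_div, div_mul_div_comm, ← pow_add,
    Nat.add_sub_cancel' hn]

/-- Unrolling gives g(n) = ∑_j ρ^j h(n - kj) over kj ≤ n; since h is bounded, dominated convergence
with a geometric majorant gives L ∑ ρ^j. -/
theorem tendsto_of_recurrence {g h : ℕ → ℂ} {ρ : ℂ} (hρ : ‖ρ‖ < 1) {k : ℕ} (hk : 0 < k)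
    (h1 : ∀ n < k, g n = h n) (h2 : ∀ n, g (n + k) = h (n + k) + ρ * g n)
    (hL : Tendsto h atTop (𝓝 L)) : Tendsto g atTop (𝓝 (L / (1 - ρ))) := by
  obtain ⟨M, hM⟩ := hL.norm.bddAbove_range
  have hM' : ∀ n, ‖h n‖ ≤ M := fun n => hM ⟨n, rfl⟩
  set t : ℕ → ℕ → ℂ := fun n j => if k * j ≤ n then ρ ^ j * h (n - k * j) else 0 with ht
  have hfin : ∀ n, Summable (t n) := fun n => by
    refine summable_of_ne_finset_zero (s := Finset.range (n + 1)) fun j hj => ?_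
    rw [Finset.mem_range, not_lt] at hj
    rw [ht]
    refine if_neg ?_
    have := Nat.le_mul_of_pos_left j hk
    omega
  have hg : ∀ n, g n = ∑' j, t n j := by
    intro n
    induction n using Nat.strong_induction_on with
    | _ n ih =>
      rw [(hfin n).tsum_eq_zero_add]
      rcases lt_or_ge n k with hn | hn
      · rw [h1 n hn]
        have : ∀ j, t n (j + 1) = 0 := fun j => by
          rw [ht]
          refine if_neg ?_
          have := Nat.le_mul_of_pos_right k (Nat.succ_pos j)
          simp only [Nat.succ_eq_add_one] at this
          omega
        simp only [this, tsum_zero, add_zero]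
        rw [ht]
        simp
      · obtain ⟨n, rfl⟩ := Nat.exists_eq_add_of_le' hn
        rw [h2 n, ih n (by omega), ← tsum_mul_left]
        congr 1
        · rw [ht]
          simp
        · refine tsum_congr fun j => ?_
          simp only [ht]
          have e : k * (j + 1) ≤ n + k ↔ k * j ≤ n := by
            rw [mul_add, mul_one, Nat.add_le_add_iff_right]
          by_cases hj : k * j ≤ n
          · rw [if_pos hj, if_pos (e.2 hj), pow_succ',
              show n + k - k * (j + 1) = n - k * j by rw [mul_add, mul_one]; omega, mul_assoc]
          · rw [if_neg hj, if_neg (fun h => hj (e.1 h)), mul_zero]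
  have hlim := tendsto_tsum_of_dominated_convergence (f := t) (g := fun j => ρ ^ j * L)
    (bound := fun j => ‖ρ‖ ^ j * M) (𝓕 := atTop)
    ((summable_geometric_of_lt_one (norm_nonneg _) hρ).mul_right M) (fun j => by
      refine Tendsto.congr' (f₁ := fun n => ρ ^ j * h (n - k * j)) ?_
        (tendsto_const_nhds.mul (hL.comp (tendsto_sub_atTop_nat _)))
      filter_upwards [eventually_ge_atTop (k * j)] with n hn
      rw [ht]
      exact (if_pos hn).symm) (by
    refine Eventually.of_forall fun n j => ?_
    simp only [ht]
    split_ifs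
    · rw [norm_mul, norm_pow]
      exact mul_le_mul_of_nonneg_left (hM' _) (by positivity)
    · rw [norm_zero]
      exact mul_nonneg (by positivity) ((norm_nonneg _).trans (hM' 0)))
  rw [tsum_mul_right, tsum_geometric_of_norm_lt_one hρ] at hlim
  rw [div_eq_inv_mul]
  exact hlim.congr fun n => (hg n).symm

theorem HasNormLimit.of_mul_one_sub (hq : 1 < q) {r : ℂ} (hr : ‖r‖ ≤ 1) {k : ℕ} (hk : 0 < k)
    (h : HasNormLimit q (G * (1 - PowerSeries.C r * PowerSeries.X ^ k)) L) :
    HasNormLimit q G (L / (1 - r / (q : ℂ) ^ k)) := by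
  have hq0 : (q : ℂ) ≠ 0 := by
    rw [Ne, Complex.ofReal_eq_zero]
    linarith
  have hc : ∀ n, PowerSeries.coeff n (G * (1 - PowerSeries.C r * PowerSeries.X ^ k)) =
      PowerSeries.coeff n G - r * if k ≤ n then PowerSeries.coeff (n - k) G else 0 := by
    intro n
    rw [mul_sub, mul_one, mul_comm G, mul_assoc, map_sub, PowerSeries.coeff_C_mul,
      PowerSeries.coeff_X_pow_mul']
  refine tendsto_of_recurrence ?_ hk (fun n hn => ?_) (fun n => ?_) h
  · rw [norm_div, norm_pow, Complex.norm_real, Real.norm_of_nonneg (by linarith)]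
    have := one_lt_pow₀ hq hk.ne'
    rw [div_lt_one (by linarith)]
    linarith
  · rw [hc, if_neg (by omega), mul_zero, sub_zero]
  · rw [hc, if_pos (by omega), Nat.add_sub_cancel, pow_add]
    field_simp
    ring

theorem HasNormLimit.mul_prod (hq : 1 < q) (h : HasNormLimit q G L) {ι : Type*} (S : Finset ι)
    (r : ι → ℂ) (k : ι → ℕ) :
    HasNormLimit q (G * ∏ i ∈ S, (1 - PowerSeries.C (r i) * PowerSeries.X ^ k i))
      (L * ∏ i ∈ S, (1 - r i / (q : ℂ) ^ k i)) := by
  classical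
  induction S using Finset.induction_on with
  | empty => simpa using h
  | insert i S hi ih =>
    rw [Finset.prod_insert hi, Finset.prod_insert hi, mul_comm (1 - _), mul_comm (1 - _),
      ← mul_assoc, ← mul_assoc]
    exact ih.mul_one_sub hq _ _

theorem HasNormLimit.of_mul_prod (hq : 1 < q) {ι : Type*} (S : Finset ι)
    (r : ι → ℂ) (k : ι → ℕ) (hr : ∀ i ∈ S, ‖r i‖ ≤ 1) (hk : ∀ i ∈ S, 0 < k i)
    (h : HasNormLimit q (G * ∏ i ∈ S, (1 - PowerSeries.C (r i) * PowerSeries.X ^ k i)) L) :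
    HasNormLimit q G (L / ∏ i ∈ S, (1 - r i / (q : ℂ) ^ k i)) := by
  classical
  induction S using Finset.induction_on generalizing L with
  | empty => simpa using h
  | insert i S hi ih =>
    rw [Finset.prod_insert hi, mul_comm (1 - _), ← mul_assoc] at h
    have := ih (fun j hj => hr j (Finset.mem_insert_of_mem hj))
      (fun j hj => hk j (Finset.mem_insert_of_mem hj))
      (h.of_mul_one_sub hq (hr i (Finset.mem_insert_self _ _)) (hk i (Finset.mem_insert_self _ _)))
    rwa [div_div, ← Finset.prod_insert (f := fun i => 1 - r i / (q : ℂ) ^ k i) hi] at this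

theorem hasNormLimit_zero_of_eventually (h : ∀ᶠ n in atTop, PowerSeries.coeff n G = 0) :
    HasNormLimit q G 0 := by
  refine tendsto_const_nhds.congr' ?_
  filter_upwards [h] with n hn
  rw [hn, zero_div]

end NormLimit


/-! ### Square factors -/

section Squares

variable {F : Type*} [Field F]

theorem exists_sq_mul_squarefree {d : F[X]} (hd : d.Monic) :
    ∃ a b : F[X], a.Monic ∧ b.Monic ∧ Squarefree b ∧ a ^ 2 * b = d := by
  induction hn : d.natDegree using Nat.strong_induction_on generalizing d with
  | _ n ih =>
    by_cases hs : Squarefree d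
    · exact ⟨1, d, monic_one, hd, hs, by rw [one_pow, one_mul]⟩
    · rw [Squarefree] at hs
      push Not at hs
      obtain ⟨x, hx, hxu⟩ := hs
      obtain ⟨P, hPm, hP, hPx⟩ := exists_monic_irreducible_factor x hxu
      obtain ⟨c, hc⟩ := (mul_dvd_mul hPx hPx).trans hx
      have hcm : c.Monic := (hPm.mul hPm).of_mul_monic_left (hc ▸ hd)
      have hdeg : P.natDegree + P.natDegree + c.natDegree = n := by
        rw [← hn, hc, (hPm.mul hPm).natDegree_mul hcm, hPm.natDegree_mul hPm]
      have hP0 := hP.natDegree_pos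
      obtain ⟨a, b, ha, hb, hbs, hab⟩ := ih c.natDegree (by omega) hcm rfl
      refine ⟨P * a, b, hPm.mul ha, hb, hbs, ?_⟩
      rw [hc, ← hab]
      ring

theorem exists_gcd_eq_mul {a : F[X]} (ha : a ≠ 0) (b : F[X]) :
    ∃ g s t : F[X], g ≠ 0 ∧ a = g * s ∧ b = g * t ∧ IsCoprime s t := by
  classical
  obtain ⟨s, hs⟩ := EuclideanDomain.gcd_dvd_left a b
  obtain ⟨t, ht⟩ := EuclideanDomain.gcd_dvd_right a b
  have e := EuclideanDomain.gcd_eq_gcd_ab a b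
  generalize EuclideanDomain.gcd a b = g at hs ht e
  generalize EuclideanDomain.gcdA a b = x at e
  generalize EuclideanDomain.gcdB a b = y at e
  have hg0 : g ≠ 0 := fun h0 => ha (by rw [hs, h0, zero_mul])
  refine ⟨g, s, t, hg0, hs, ht, x, y, mul_left_cancel₀ hg0 ?_⟩
  rw [mul_one]
  nth_rewrite 2 [e]
  rw [hs, ht]
  ring

/-- Removing the common factor of a and a' leaves s²b = t²b' with s, t coprime. Then s² divides b'
and t² divides b, so both are units by squarefreeness. -/
theorem eq_of_sq_mul_squarefree {a b a' b' : F[X]} (ha : a.Monic) (ha' : a'.Monic)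
    (hb : Squarefree b) (hb' : Squarefree b') (h : a ^ 2 * b = a' ^ 2 * b') : a = a' ∧ b = b' := by
  classical
  have haa : a = a' := by
    obtain ⟨g, s, t, hg0, hs, ht, hco⟩ := exists_gcd_eq_mul ha.ne_zero a'
    have h2 : s ^ 2 * b = t ^ 2 * b' := by
      refine mul_left_cancel₀ (pow_ne_zero 2 hg0) ?_
      calc _ = (g * s) ^ 2 * b := by ring
        _ = (g * t) ^ 2 * b' := by rw [← hs, ← ht, h]
        _ = _ := by ring
    have hsu : IsUnit s := hb' s (by
      rw [← sq]
      exact (hco.pow (m := 2) (n := 2)).dvd_of_dvd_mul_left (Dvd.intro b h2))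
    have htu : IsUnit t := hb t (by
      rw [← sq]
      exact (hco.symm.pow (m := 2) (n := 2)).dvd_of_dvd_mul_left (Dvd.intro b' h2.symm))
    refine eq_of_monic_of_associated ha ha' ?_
    rw [hs, ht]
    exact (associated_mul_unit_left _ _ hsu).trans (associated_mul_unit_right _ _ htu)
  subst haa
  exact ⟨rfl, mul_left_cancel₀ (pow_ne_zero 2 ha.ne_zero) h⟩

variable [Finite F]

-- Every monic d is uniquely a²b with b squarefree, and w(a²b) = w(a)² w(b); the substitution t ↦ t²
-- records that a counts twice in the degree.
open Classical in
theorem genSeries_eq_expand_mul {w : F[X] → ℂ} (hw : IsMulWeight w) :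
    genSeries w = PowerSeries.expand 2 two_ne_zero (genSeries fun a => w a ^ 2) *
      genSeries fun b => if Squarefree b then w b else 0 := by
  ext n
  rw [PowerSeries.coeff_mul]
  have h1 : ∀ p ∈ Finset.HasAntidiagonal.antidiagonal n,
      PowerSeries.coeff p.1 (PowerSeries.expand 2 two_ne_zero (genSeries fun a => w a ^ 2)) *
        PowerSeries.coeff p.2 (genSeries fun b => if Squarefree b then w b else 0) =
      ∑ x ∈ (if 2 ∣ p.1 then monics F (p.1 / 2) else ∅) ×ˢ (monics F p.2).filter Squarefree,
        w (x.1 ^ 2 * x.2) := by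
    intro p _
    rw [PowerSeries.coeff_expand, coeff_genSeries, coeff_genSeries, ← Finset.sum_filter,
      Finset.sum_product]
    split_ifs with h
    · rw [Finset.sum_mul_sum]
      refine Finset.sum_congr rfl fun a ha => Finset.sum_congr rfl fun b hb => ?_
      rw [Finset.mem_filter] at hb
      have ha := (mem_monics.1 ha).1
      have hb := (mem_monics.1 hb.1).1
      rw [hw _ _ (ha.pow 2) hb, pow_two a, hw a a ha ha, pow_two]
    · rw [zero_mul, Finset.sum_empty]
  rw [Finset.sum_congr rfl h1, Finset.sum_sigma', coeff_genSeries]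
  symm
  refine Finset.sum_bij (fun x _ => x.2.1 ^ 2 * x.2.2) ?_ ?_ ?_ fun _ _ => rfl
  · rintro ⟨p, a, b⟩ hx
    simp only [Finset.mem_sigma, Finset.mem_product, Finset.mem_filter,
      Finset.HasAntidiagonal.mem_antidiagonal] at hx ⊢
    obtain ⟨hp, ha, hb, -⟩ := hx
    split_ifs at ha with h2
    · rw [mem_monics] at ha hb ⊢
      refine ⟨(ha.1.pow 2).mul hb.1, ?_⟩
      rw [(ha.1.pow 2).natDegree_mul hb.1, ha.1.natDegree_pow, ha.2, hb.2]
      omega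
    · simp at ha
  · rintro ⟨p, a, b⟩ hx ⟨p', a', b'⟩ hx' h
    simp only [Finset.mem_sigma, Finset.mem_product, Finset.mem_filter,
      Finset.HasAntidiagonal.mem_antidiagonal] at hx hx' h
    obtain ⟨hp, ha, hb, hbs⟩ := hx
    obtain ⟨hp', ha', hb', hbs'⟩ := hx'
    split_ifs at ha ha' with h2 h2'
    · rw [mem_monics] at ha hb ha' hb'
      obtain ⟨rfl, rfl⟩ := eq_of_sq_mul_squarefree ha.1 ha'.1 hbs hbs' h
      have : p = p' := Prod.ext (by omega) (by omega)
      rw [this]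
    all_goals simp_all
  · intro d hd
    rw [mem_monics] at hd
    obtain ⟨a, b, ha, hb, hbs, rfl⟩ := exists_sq_mul_squarefree hd.1
    refine ⟨⟨(2 * a.natDegree, b.natDegree), a, b⟩, ?_, rfl⟩
    simp only [Finset.mem_sigma, Finset.mem_product, Finset.mem_filter,
      Finset.HasAntidiagonal.mem_antidiagonal]
    refine ⟨?_, ?_, mem_monics.2 ⟨hb, rfl⟩, hbs⟩
    · rw [← hd.2, (ha.pow 2).natDegree_mul hb, ha.natDegree_pow]
    · rw [if_pos (dvd_mul_right _ _), Nat.mul_div_cancel_left _ two_pos]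
      exact mem_monics.2 ⟨ha, rfl⟩

end Squares

/-! ### The number of monic irreducible polynomials -/

section PrimeCount

variable {F : Type*} [Field F] [Finite F]

theorem genSeries_one : genSeries (fun _ : F[X] => (1 : ℂ)) =
    PowerSeries.mk fun n => (Nat.card F : ℂ) ^ n := by
  ext n
  rw [coeff_genSeries, PowerSeries.coeff_mk, Finset.sum_const, card_monics, nsmul_eq_mul, mul_one,
    Nat.cast_pow]

theorem mk_pow_mul_one_sub (q : ℂ) :
    (PowerSeries.mk fun n => q ^ n) * (1 - PowerSeries.C q * PowerSeries.X) = 1 := by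
  ext n
  rw [mul_sub, mul_one, mul_left_comm, map_sub, PowerSeries.coeff_C_mul, PowerSeries.coeff_mk,
    PowerSeries.coeff_one]
  cases n with
  | zero => simp
  | succ n =>
    rw [PowerSeries.coeff_succ_mul_X, PowerSeries.coeff_mk, pow_succ', sub_self,
      if_neg (Nat.succ_ne_zero n)]

theorem derivative_prod {ι : Type*} (s : Finset ι) (f g : ι → PowerSeries ℂ)
    (h : ∀ i ∈ s, PowerSeries.derivative ℂ (f i) = f i * g i) :
    PowerSeries.derivative ℂ (∏ i ∈ s, f i) = (∏ i ∈ s, f i) * ∑ i ∈ s, g i := by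
  classical
  induction s using Finset.induction_on with
  | empty => rw [Finset.prod_empty, Finset.sum_empty, Derivation.map_one_eq_zero, mul_zero]
  | insert i s hi ih =>
    rw [Finset.prod_insert hi, Finset.sum_insert hi, Derivation.leibniz,
      ih fun j hj => h j (Finset.mem_insert_of_mem hj), h i (Finset.mem_insert_self _ _),
      smul_eq_mul, smul_eq_mul]
    ring

theorem derivative_one_sub_X_pow (d : ℕ) :
    PowerSeries.derivative ℂ (1 - PowerSeries.X ^ d) = (1 - PowerSeries.X ^ d) *
      PowerSeries.mk fun k => if d ∣ k + 1 then -(d : ℂ) else 0 := by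
  ext n
  rw [PowerSeries.coeff_derivative, map_sub, PowerSeries.coeff_one, PowerSeries.coeff_X_pow,
    if_neg (Nat.succ_ne_zero n), sub_mul (1 : PowerSeries ℂ), one_mul, map_sub,
    PowerSeries.coeff_X_pow_mul',
    PowerSeries.coeff_mk, PowerSeries.coeff_mk]
  by_cases h : d ≤ n
  · rw [if_pos h, if_neg (by omega), show n + 1 = (n - d + 1) + d by omega]
    simp only [Nat.dvd_add_self_right]
    simp
  · rw [if_neg h]
    by_cases hn : n + 1 = d
    · rw [if_pos hn, if_pos (by rw [hn]), ← hn]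
      push_cast
      ring
    · rw [if_neg hn, if_neg fun hdv => ?_]
      · simp
      · have := Nat.le_of_dvd (Nat.succ_pos n) hdv
        omega

-- Let ν = (1 - qt)⁻¹ ∏_{deg P ≤ n} (1 - t^{deg P}). Sieving shows ν ≡ 1 modulo t^{n+1}, so ν' is
-- divisible by t^n and so is the logarithmic derivative of ν. Its coefficient at t^{n-1} is the
-- difference of the two sides.
open Classical in
theorem sum_natDegree_primesLE {n : ℕ} (hn : 0 < n) :
    ∑ P ∈ (primesLE F n).filter (fun P => P.natDegree ∣ n), (P.natDegree : ℂ) =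
      (Nat.card F : ℂ) ^ n := by
  set q : ℂ := (Nat.card F : ℂ) with hq
  set G : PowerSeries ℂ := PowerSeries.mk fun n => q ^ n with hG
  set E : PowerSeries ℂ := ∏ P ∈ primesLE F n, (1 - PowerSeries.X ^ P.natDegree) with hE
  set c : PowerSeries ℂ := ∑ P ∈ primesLE F n,
    PowerSeries.mk fun k => if P.natDegree ∣ k + 1 then -(P.natDegree : ℂ) else 0 with hc
  set ν : PowerSeries ℂ := genSeries (restrictWeight (primesLE F n) fun _ => (1 : ℂ)) with hν
  have h1 : G * E = ν := by
    have := genSeries_mul_prod (w := fun _ : F[X] => (1 : ℂ)) (fun _ _ _ _ => (mul_one 1).symm)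
      (S := primesLE F n) fun P hP => isMonicIrreducible_of_mem_primesLE hP
    rw [genSeries_one] at this
    rw [hν, ← this]
    congr 1
    refine Finset.prod_congr rfl fun P _ => ?_
    rw [map_one, one_mul]
  have h2 : PowerSeries.derivative ℂ E = E * c := derivative_prod _ _ _ fun P _ =>
    derivative_one_sub_X_pow P.natDegree
  have hG1 := mk_pow_mul_one_sub q
  have h3 : PowerSeries.derivative ℂ G = PowerSeries.C q * G * G := by
    have h := congrArg (PowerSeries.derivative ℂ) hG1
    rw [Derivation.leibniz, Derivation.map_one_eq_zero, map_sub, Derivation.map_one_eq_zero,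
      Derivation.leibniz, PowerSeries.derivative_C, PowerSeries.derivative_X, smul_eq_mul,
      smul_eq_mul, smul_eq_mul, smul_eq_mul] at h
    rw [← hG] at h hG1
    linear_combination G * h - (PowerSeries.derivative ℂ G) * hG1
  have h4 : PowerSeries.X ^ n ∣ PowerSeries.derivative ℂ ν := by
    rw [PowerSeries.X_pow_dvd_iff]
    intro k hk
    rw [PowerSeries.coeff_derivative, hν, coeff_genSeries_restrict_primesLE rfl (by omega),
      if_neg (Nat.succ_ne_zero k), zero_mul]
  have h5 : PowerSeries.derivative ℂ ν = ν * (PowerSeries.C q * G + c) := by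
    rw [← h1, Derivation.leibniz, smul_eq_mul, smul_eq_mul, h2, h3]
    ring
  have hu : IsUnit ν := by
    rw [PowerSeries.isUnit_iff_constantCoeff, ← PowerSeries.coeff_zero_eq_constantCoeff_apply, hν,
      coeff_genSeries_restrict_primesLE rfl (Nat.zero_le n), if_pos rfl]
    exact isUnit_one
  rw [h5, hu.dvd_mul_left, PowerSeries.X_pow_dvd_iff] at h4
  have h6 := h4 (n - 1) (by omega)
  rw [map_add, PowerSeries.coeff_C_mul, hG, PowerSeries.coeff_mk, hc, map_sum] at h6
  simp only [PowerSeries.coeff_mk, Nat.sub_add_cancel hn] at h6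
  rw [← pow_succ', Nat.sub_add_cancel hn] at h6
  rw [Finset.sum_filter]
  have h7 : ∀ P : F[X], (if P.natDegree ∣ n then -(P.natDegree : ℂ) else 0) =
      -(if P.natDegree ∣ n then (P.natDegree : ℂ) else 0) := fun P => by split_ifs <;> simp
  simp only [h7, Finset.sum_neg_distrib] at h6
  linear_combination -h6

open Classical in
variable (F) in
/-- The number of monic irreducible polynomials of degree `n`. -/
noncomputable def primeCount (n : ℕ) : ℕ := ((monics F n).filter Irreducible).card

theorem sum_divisors_primeCount {n : ℕ} (hn : 0 < n) :
    ∑ d ∈ n.divisors, ((d : ℂ) * primeCount F d) = (Nat.card F : ℂ) ^ n := by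
  classical
  rw [← sum_natDegree_primesLE hn, ← Finset.sum_fiberwise_of_maps_to (g := Polynomial.natDegree)
    (t := n.divisors)]
  · refine Finset.sum_congr rfl fun d hd => ?_
    rw [Nat.mem_divisors] at hd
    rw [primeCount, Finset.sum_congr rfl (g := fun _ => (d : ℂ)), Finset.sum_const, nsmul_eq_mul,
      mul_comm]
    · refine congrArg (fun s : Finset F[X] => (s.card : ℂ) * (d : ℂ)) ?_
      ext P
      simp only [Finset.mem_filter, mem_monics, mem_primesLE]
      constructor
      · rintro ⟨⟨h1, rfl⟩, h2⟩
        exact ⟨⟨⟨⟨h1, h2⟩, Nat.le_of_dvd hn hd.1⟩, hd.1⟩, rfl⟩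
      · rintro ⟨⟨⟨⟨h1, h2⟩, -⟩, -⟩, rfl⟩
        exact ⟨⟨h1, rfl⟩, h2⟩
    · intro P hP
      rw [(Finset.mem_filter.1 hP).2]
  · intro P hP
    rw [Nat.mem_divisors]
    exact ⟨(Finset.mem_filter.1 hP).2, hn.ne'⟩

theorem natCast_mul_primeCount (n : ℕ) (hn : 0 < n) : (n : ℂ) * primeCount F n =
    ∑ p ∈ n.divisorsAntidiagonal,
      (((Nat.card F : ℂ)⁻¹) ^ p.1)⁻¹ * (ArithmeticFunction.moebius p.2 : ℂ) := by
  have h := (ArithmeticFunction.sum_eq_iff_sum_mul_moebius_eq (R := ℂ)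
    (f := fun d => (d : ℂ) * primeCount F d) (g := fun n => (Nat.card F : ℂ) ^ n)).1
    (fun n hn => sum_divisors_primeCount hn) n hn
  rw [← h]
  refine Finset.sum_nbij' Prod.swap Prod.swap
    (fun p hp => Nat.swap_mem_divisorsAntidiagonal.2 hp)
    (fun p hp => Nat.swap_mem_divisorsAntidiagonal.2 hp) (fun p _ => p.swap_swap)
    (fun p _ => p.swap_swap) fun p _ => ?_
  simp [mul_comm]

end PrimeCount

/-! ### Periodic multiplicative functions -/

section Periodic

variable {F : Type*} [Field F] [Finite F]

theorem sum_monics_add {k : ℕ} (f : F[X] → ℂ) {r : F[X]} (hr : r.degree < k) :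
    ∑ m ∈ monics F k, f (m + r) = ∑ m ∈ monics F k, f m := by
  have key : ∀ r : F[X], r.degree < k → ∀ m ∈ monics F k, m + r ∈ monics F k := by
    intro r hr m hm
    rw [mem_monics] at hm ⊢
    have hd : r.degree < m.degree := by
      rw [degree_eq_natDegree hm.1.ne_zero, hm.2]
      exact hr
    exact ⟨hm.1.add_of_left hd, by rw [natDegree_add_eq_left_of_degree_lt hd, hm.2]⟩
  refine Finset.sum_bij' (fun m _ => m + r) (fun m _ => m - r) (key r hr) (fun m hm => ?_)
    (fun m _ => by simp) (fun m _ => by simp) fun m _ => rfl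
  rw [sub_eq_add_neg]
  exact key (-r) (by rwa [degree_neg]) m hm

/-- Translation by a polynomial of degree below k permutes the monics of degree k, so when deg Q ≤ k
the sum may be averaged over all residues modulo Q. The sum of f over the residues is 0, as
multiplication by the unit u permutes them and f(u) ≠ 1. -/
theorem sum_monics_eq_zero {Q : F[X]} (hQ : Q.Monic) {f : F[X] → ℂ}
    (hper : ∀ a b, Q ∣ a - b → f a = f b) (hmul : ∀ a b, f (a * b) = f a * f b)
    {u : F[X]} (hu : IsCoprime u Q) (hu1 : f u ≠ 1) {k : ℕ} (hk : Q.natDegree ≤ k) :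
    ∑ m ∈ monics F k, f m = 0 := by
  classical
  have hfin : Module.Finite F (AdjoinRoot Q) := (AdjoinRoot.powerBasis' hQ).finite
  have : Finite (AdjoinRoot Q) := Module.finite_of_finite F
  have := Fintype.ofFinite (AdjoinRoot Q)
  set rep := AdjoinRoot.modByMonicHom hQ with hrep
  have hdeg : ∀ x, (rep x).degree < k := by
    intro x
    obtain ⟨p, rfl⟩ := AdjoinRoot.mk_surjective x
    rw [hrep, AdjoinRoot.modByMonicHom_mk]
    refine (degree_modByMonic_lt p hQ).trans_le ?_
    rw [degree_eq_natDegree hQ.ne_zero]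
    exact_mod_cast hk
  have hmk : ∀ x, AdjoinRoot.mk Q (rep x) = x := AdjoinRoot.mk_leftInverse hQ
  have hf : ∀ a b, AdjoinRoot.mk Q a = AdjoinRoot.mk Q b → f a = f b := fun a b h =>
    hper a b (AdjoinRoot.mk_eq_mk.1 h)
  have hunit : IsUnit (AdjoinRoot.mk Q u) := by
    obtain ⟨a, b, h⟩ := hu
    refine IsUnit.of_mul_eq_one (AdjoinRoot.mk Q a) ?_
    rw [← map_mul, ← map_one (AdjoinRoot.mk Q), ← h, mul_comm u, AdjoinRoot.mk_eq_mk]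
    exact ⟨-b, by ring⟩
  have hsum0 : ∑ x : AdjoinRoot Q, f (rep x) = 0 := by
    have h1 : ∑ x : AdjoinRoot Q, f (rep (hunit.unit * x)) = ∑ x : AdjoinRoot Q, f (rep x) :=
      Equiv.sum_comp (Units.mulLeft hunit.unit) fun x => f (rep x)
    have h2 : ∀ x : AdjoinRoot Q, f (rep (hunit.unit * x)) = f u * f (rep x) := by
      intro x
      rw [← hmul]
      refine hf _ _ ?_
      rw [hmk, map_mul, hmk, IsUnit.unit_spec]
    simp only [h2, ← Finset.mul_sum] at h1
    have h3 : (f u - 1) * ∑ x : AdjoinRoot Q, f (rep x) = 0 := by rw [sub_mul, h1, one_mul, sub_self]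
    exact (mul_eq_zero.1 h3).resolve_left (sub_ne_zero.2 hu1)
  have h1 : ∑ x : AdjoinRoot Q, ∑ m ∈ monics F k, f (m + rep x) =
      Fintype.card (AdjoinRoot Q) * ∑ m ∈ monics F k, f m := by
    simp only [sum_monics_add f (hdeg _), Finset.sum_const, nsmul_eq_mul, Finset.card_univ]
  rw [Finset.sum_comm, Finset.sum_eq_zero] at h1
  · exact (mul_eq_zero.1 h1.symm).resolve_left (by exact_mod_cast Fintype.card_ne_zero)
  · intro m _
    rw [← hsum0, ← Equiv.sum_comp (Equiv.addLeft (AdjoinRoot.mk Q m)) fun x => f (rep x)]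
    refine Finset.sum_congr rfl fun x _ => hf _ _ ?_
    rw [map_add, hmk, hmk]
    rfl

end Periodic


/-! ### Quadratic characters and norms -/

section FiniteFieldNorm

/-- The norm is the power with exponent (|K| - 1)/(|F| - 1). Raising it to (|F| - 1)/2 gives x^{(|K|
- 1)/2}, so Euler's criterion reads the same in F and in K. -/
theorem quadraticChar_norm {F K : Type*} [Field F] [Field K] [Algebra F K] [Fintype F] [Fintype K]
    [DecidableEq F] [DecidableEq K] (hF : ringChar F ≠ 2) (hK : ringChar K ≠ 2) (x : K) :
    quadraticChar F (Algebra.norm F x) = quadraticChar K x := by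
  by_cases hx : x = 0
  · rw [hx, Algebra.norm_zero, quadraticChar_zero, quadraticChar_zero]
  have hn : Algebra.norm F x ≠ 0 := Algebra.norm_ne_zero_iff.2 hx
  have hiff : IsSquare (Algebra.norm F x) ↔ IsSquare x := by
    rw [FiniteField.isSquare_iff hF hn, FiniteField.isSquare_iff hK hx,
      ← (algebraMap F K).injective.eq_iff, map_pow, map_one, FiniteField.algebraMap_norm_eq_pow,
      ← pow_mul, Nat.card_eq_fintype_card, Nat.card_eq_fintype_card]
    have hq := FiniteField.odd_card_of_char_ne_two hF
    have hQ := FiniteField.odd_card_of_char_ne_two hK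
    have hdvd : Fintype.card F - 1 ∣ Fintype.card K - 1 := by
      rw [Module.card_eq_pow_finrank (K := F) (V := K)]
      exact Nat.sub_one_dvd_pow_sub_one _ _
    have h1 := Fintype.one_lt_card (α := F)
    have h2 := Fintype.one_lt_card (α := K)
    obtain ⟨c, hc⟩ := hdvd
    have hcd : (Fintype.card K - 1) / (Fintype.card F - 1) = c := by
      rw [hc, Nat.mul_div_cancel_left _ (by omega)]
    have he : c * (Fintype.card F / 2) = Fintype.card K / 2 := by
      have e1 : Fintype.card F - 1 = 2 * (Fintype.card F / 2) := by omega
      have e2 : Fintype.card K - 1 = 2 * (Fintype.card K / 2) := by omega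
      rw [e1, e2] at hc
      have : 2 * (c * (Fintype.card F / 2)) = 2 * (Fintype.card K / 2) := by rw [hc]; ring
      omega
    rw [hcd, he]
  by_cases hs : IsSquare x
  · rw [(quadraticChar_one_iff_isSquare hx).2 hs,
      (quadraticChar_one_iff_isSquare hn).2 (hiff.2 hs)]
  · rw [quadraticChar_neg_one_iff_not_isSquare.2 hs,
      quadraticChar_neg_one_iff_not_isSquare.2 fun h => hs (hiff.1 h)]

/-- Over an algebraic closure both sides are ∏ d(α) over the roots α of P; embeddings of F[x]/(P)
correspond to roots, which are simple because F is perfect. -/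
theorem resultant_eq_norm {F : Type*} [Field F] [PerfectField F] {P : F[X]} (hP : P.Monic)
    [Fact (Irreducible P)] (d : F[X]) :
    resultant P d = Algebra.norm F (AdjoinRoot.mk P d) := by
  classical
  set E := AlgebraicClosure F with hE
  have hPi : Irreducible P := Fact.out
  have hfin : Module.Finite F (AdjoinRoot P) := (AdjoinRoot.powerBasis' hP).finite
  have halg : Algebra.IsAlgebraic F (AdjoinRoot P) := Algebra.IsAlgebraic.of_finite F _
  have hsep : Algebra.IsSeparable F (AdjoinRoot P) := inferInstance
  apply (algebraMap F E).injective
  rw [Algebra.norm_eq_prod_embeddings, ← resultant_map_map,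
    ← natDegree_map (algebraMap F E) (p := P),
    resultant_eq_prod_eval _ _ _ natDegree_map_le (IsAlgClosed.splits _),
    (hP.map _).leadingCoeff, one_pow, one_mul]
  have hnd : (P.aroots E).Nodup := nodup_aroots_iff_of_splits hP.ne_zero (IsAlgClosed.splits _) |>.2
    (PerfectField.separable_of_irreducible hPi)
  have h1 : ∀ σ : AdjoinRoot P →ₐ[F] E, σ (AdjoinRoot.mk P d) =
      (d.map (algebraMap F E)).eval (AdjoinRoot.equiv E F P hP.ne_zero σ : E) := by
    intro σ
    have : (AdjoinRoot.equiv E F P hP.ne_zero σ : E) = σ (AdjoinRoot.root P) := rfl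
    rw [this, eval_map_algebraMap, ← AdjoinRoot.aeval_eq, aeval_algHom_apply]
  simp only [h1]
  rw [(AdjoinRoot.equiv E F P hP.ne_zero).prod_comp fun x => (d.map (algebraMap F E)).eval (x : E)]
  rw [← Finset.prod_subtype (P.aroots E).toFinset (fun x => Multiset.mem_toFinset)
    fun x => (d.map (algebraMap F E)).eval x, Finset.prod, Multiset.toFinset_val, hnd.dedup]

end FiniteFieldNorm

/-! ### Quadratic residue symbols -/

section ResidueSymbol

variable {F : Type*} [Field F]

theorem residueSymbol_eq_quadraticChar {P : F[X]} [Fact (Irreducible P)] [Fintype (AdjoinRoot P)]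
    [DecidableEq (AdjoinRoot P)] (d : F[X]) :
    residueSymbol d P = quadraticChar (AdjoinRoot P) (AdjoinRoot.mk P d) := by
  classical
  rw [quadraticChar_apply, quadraticCharFun, residueSymbol]
  have h1 : AdjoinRoot.mk P d = 0 ↔ P ∣ d := AdjoinRoot.mk_eq_zero
  have h2 : IsSquare (AdjoinRoot.mk P d) ↔ ∃ a : F[X], P ∣ a ^ 2 - d := by
    constructor
    · rintro ⟨r, hr⟩
      obtain ⟨a, rfl⟩ := AdjoinRoot.mk_surjective r
      exact ⟨a, AdjoinRoot.mk_eq_mk.1 (by rw [hr, map_pow, sq])⟩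
    · rintro ⟨a, ha⟩
      exact ⟨AdjoinRoot.mk P a, by rw [← AdjoinRoot.mk_eq_mk.2 ha, map_pow, sq]⟩
  exact if_congr h1.symm rfl (if_congr h2.symm rfl rfl)

variable {P : F[X]}

theorem residueSymbol_of_dvd {d : F[X]} (h : P ∣ d) : residueSymbol d P = 0 := if_pos h

theorem residueSymbol_of_not_dvd {d : F[X]} (h : ¬ P ∣ d) :
    residueSymbol d P = 1 ∨ residueSymbol d P = -1 := by
  rw [residueSymbol, if_neg h]
  split_ifs
  · exact Or.inl rfl
  · exact Or.inr rfl

theorem residueSymbol_congr {a b : F[X]} (h : P ∣ a - b) :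
    residueSymbol a P = residueSymbol b P := by
  classical
  have h1 : P ∣ a ↔ P ∣ b := dvd_iff_dvd_of_dvd_sub h
  have h2 : ∀ c : F[X], P ∣ c ^ 2 - a ↔ P ∣ c ^ 2 - b := fun c =>
    dvd_iff_dvd_of_dvd_sub (by rw [← dvd_neg]; convert h using 1; ring)
  rw [residueSymbol, residueSymbol]
  exact if_congr h1 rfl (if_congr (exists_congr h2) rfl rfl)

variable [Finite F]

theorem finite_adjoinRoot (hP : P.Monic) : Finite (AdjoinRoot P) := by
  have hfin : Module.Finite F (AdjoinRoot P) := (AdjoinRoot.powerBasis' hP).finite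
  exact Module.finite_of_finite F

theorem residueSymbol_mul (hP : P.Monic ∧ Irreducible P) (a b : F[X]) :
    residueSymbol (a * b) P = residueSymbol a P * residueSymbol b P := by
  classical
  have := Fact.mk hP.2
  have := finite_adjoinRoot hP.1
  have := Fintype.ofFinite (AdjoinRoot P)
  rw [residueSymbol_eq_quadraticChar, residueSymbol_eq_quadraticChar,
    residueSymbol_eq_quadraticChar, map_mul, map_mul]

theorem residueSymbol_one (hP : P.Monic ∧ Irreducible P) : residueSymbol 1 P = 1 := by
  classical
  have := Fact.mk hP.2
  have := finite_adjoinRoot hP.1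
  have := Fintype.ofFinite (AdjoinRoot P)
  rw [residueSymbol_eq_quadraticChar, map_one (AdjoinRoot.mk P), map_one]

theorem exists_residueSymbol_eq_neg_one (hF : ringChar F ≠ 2) (hP : P.Monic ∧ Irreducible P) :
    ∃ u : F[X], residueSymbol u P = -1 := by
  classical
  have := Fact.mk hP.2
  have := finite_adjoinRoot hP.1
  have := Fintype.ofFinite (AdjoinRoot P)
  obtain ⟨x, hx⟩ := quadraticChar_exists_neg_one (F := AdjoinRoot P)
    (by rwa [← Algebra.ringChar_eq F (AdjoinRoot P)])
  obtain ⟨u, rfl⟩ := AdjoinRoot.mk_surjective x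
  exact ⟨u, by rw [residueSymbol_eq_quadraticChar, hx]⟩

theorem residueSymbol_eq_resultant [Fintype F] [DecidableEq F] (hF : ringChar F ≠ 2)
    (hP : P.Monic ∧ Irreducible P) (d : F[X]) :
    residueSymbol d P = quadraticChar F (resultant P d) := by
  classical
  have := Fact.mk hP.2
  have : Finite F := inferInstance
  have := finite_adjoinRoot hP.1
  have := Fintype.ofFinite (AdjoinRoot P)
  rw [residueSymbol_eq_quadraticChar, resultant_eq_norm hP.1,
    quadraticChar_norm hF (by rwa [← Algebra.ringChar_eq F (AdjoinRoot P)])]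

end ResidueSymbol

section Chi

variable {F : Type*} [Field F]

open UniqueFactorizationMonoid

theorem chi_one_right (d : F[X]) : chi d 1 = 1 := by
  classical
  rw [chi, normalizedFactors_one, Multiset.map_zero, Multiset.prod_zero]

theorem chi_mul_right (d : F[X]) {a b : F[X]} (ha : a ≠ 0) (hb : b ≠ 0) :
    chi d (a * b) = chi d a * chi d b := by
  classical
  rw [chi, normalizedFactors_mul ha hb, Multiset.map_add, Multiset.prod_add, chi, chi]

theorem chi_prime (d : F[X]) {P : F[X]} (hP : P.Monic ∧ Irreducible P) :
    chi d P = residueSymbol d P := by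
  classical
  rw [chi, normalizedFactors_irreducible hP.2, hP.1.normalize_eq_self, Multiset.map_singleton,
    Multiset.prod_singleton]

theorem chi_eq_prod [DecidableEq F] (d m : F[X]) :
    chi d m = ((normalizedFactors m).map (residueSymbol d)).prod := by
  rw [chi]
  congr!

theorem monic_irreducible_of_mem_normalizedFactors [DecidableEq F] {m P : F[X]} (h : P ∈ normalizedFactors m) :
    P.Monic ∧ Irreducible P := by
  have hi := irreducible_of_normalized_factor P h
  refine ⟨?_, hi⟩
  rw [← normalize_normalized_factor P h]
  exact monic_normalize hi.ne_zero

theorem chi_congr {a b m : F[X]} (h : m ∣ a - b) : chi a m = chi b m := by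
  classical
  rw [chi, chi]
  congr 1
  refine Multiset.map_congr rfl fun P hP => residueSymbol_congr ?_
  exact (dvd_of_mem_normalizedFactors hP).trans h

theorem chi_mul_left [Finite F] (a b m : F[X]) : chi (a * b) m = chi a m * chi b m := by
  classical
  rw [chi, chi, chi, ← Multiset.prod_map_mul]
  congr 1
  exact Multiset.map_congr rfl fun P hP =>
    residueSymbol_mul (monic_irreducible_of_mem_normalizedFactors hP) a b

theorem chi_one_left [Finite F] (m : F[X]) : chi 1 m = 1 := by
  classical
  rw [chi]
  refine Multiset.prod_eq_one fun x hx => ?_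
  rw [Multiset.mem_map] at hx
  obtain ⟨P, hP, rfl⟩ := hx
  exact residueSymbol_one (monic_irreducible_of_mem_normalizedFactors hP)

theorem prod_residueSymbol_eq_resultant [Fintype F] [DecidableEq F] (hF : ringChar F ≠ 2)
    (d : F[X]) (s : Multiset F[X]) (hs : ∀ P ∈ s, P.Monic ∧ Irreducible P) :
    (s.map (residueSymbol d)).prod = quadraticChar F (resultant s.prod d) := by
  induction s using Multiset.induction_on with
  | empty =>
    rw [Multiset.map_zero, Multiset.prod_zero, Multiset.prod_zero, natDegree_one,
      resultant_zero_left_deg, coeff_one_zero, one_pow, map_one]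
  | cons P s ih =>
    have hs' : ∀ Q ∈ s, Q.Monic ∧ Irreducible Q := fun Q hQ => hs Q (Multiset.mem_cons_of_mem hQ)
    have hP := hs P (Multiset.mem_cons_self _ _)
    have hm : s.prod.Monic := by
      have := monic_multiset_prod_of_monic s id fun Q hQ => (hs' Q hQ).1
      rwa [Multiset.map_id] at this
    rw [Multiset.map_cons, Multiset.prod_cons, Multiset.prod_cons, ih hs',
      residueSymbol_eq_resultant hF hP, hP.1.natDegree_mul hm,
      resultant_mul_left _ _ _ _ le_rfl, map_mul]

/-- For irreducible m this is the residue symbol as a quadratic character of a norm, and the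
resultant is multiplicative in m. Reciprocity is then the symmetry of the resultant up to sign. -/
theorem chi_eq_resultant [Fintype F] [DecidableEq F] (hF : ringChar F ≠ 2) (d : F[X])
    {m : F[X]} (hm : m.Monic) : chi d m = quadraticChar F (resultant m d) := by
  classical
  have hs := fun P (hP : P ∈ normalizedFactors m) => monic_irreducible_of_mem_normalizedFactors hP
  have hprod : (normalizedFactors m).prod = m :=
    eq_of_monic_of_associated (by
      have := monic_multiset_prod_of_monic (normalizedFactors m) id fun P hP => (hs P hP).1
      rwa [Multiset.map_id] at this) hm (prod_normalizedFactors hm.ne_zero)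
  rw [chi_eq_prod, prod_residueSymbol_eq_resultant hF d _ hs, hprod]

/-- Quadratic reciprocity, up to a sign depending only on the degrees. -/
theorem exists_chi_comm [Finite F] (hF : ringChar F ≠ 2) (i j : ℕ) : ∃ ε : ℤ, ∀ d m : F[X],
    d.Monic → m.Monic → d.natDegree = i → m.natDegree = j → chi d m = ε * chi m d := by
  classical
  have := Fintype.ofFinite F
  refine ⟨quadraticChar F ((-1) ^ (j * i)), ?_⟩
  rintro d m hd hm rfl rfl
  rw [chi_eq_resultant hF d hm, chi_eq_resultant hF m hd, resultant_comm, map_mul]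

variable [Finite F]

/-- By the Chinese remainder theorem, choose u to be a nonresidue modulo one prime P of Q and 1
modulo the cofactor, which is coprime to P since Q is squarefree. -/
theorem exists_chi_eq_neg_one (hF : ringChar F ≠ 2) {Q : F[X]} (hQ : Q.Monic) (hs : Squarefree Q)
    (h1 : Q ≠ 1) : ∃ u : F[X], IsCoprime u Q ∧ chi u Q = -1 := by
  obtain ⟨P, hP, e, rfl⟩ := exists_monic_irreducible_dvd hQ h1
  have hem : e.Monic := hP.1.of_mul_monic_left hQ
  have hco : IsCoprime P e := by
    rw [hP.2.coprime_iff_not_dvd]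
    exact fun h => hP.2.not_isUnit (hs P (mul_dvd_mul_left P h))
  obtain ⟨v, hv⟩ := exists_residueSymbol_eq_neg_one hF hP
  obtain ⟨a, b, hab⟩ := hco
  set u := b * e * v + a * P with hu
  have h2 : P ∣ u - v := ⟨a - a * v, by rw [hu]; linear_combination v * hab⟩
  have h3 : e ∣ u - 1 := ⟨b * v - b, by rw [hu]; linear_combination hab⟩
  have hPu : ¬ P ∣ u := fun h => by
    have := residueSymbol_congr h2
    rw [residueSymbol_of_dvd h, hv] at this
    norm_num at this
  refine ⟨u, IsCoprime.mul_right ?_ ?_, ?_⟩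
  · exact ((hP.2.coprime_iff_not_dvd).2 hPu).symm
  · obtain ⟨c, hc⟩ := h3
    exact ⟨1, -c, by linear_combination hc⟩
  · rw [chi_mul_right _ hP.1.ne_zero hem.ne_zero, chi_prime _ hP, residueSymbol_congr h2, hv,
      chi_congr h3, chi_one_left, mul_one]

theorem sum_chi_left_eq_zero (hF : ringChar F ≠ 2) {Q : F[X]} (hQ : Q.Monic) (hs : Squarefree Q)
    (h1 : Q ≠ 1) {k : ℕ} (hk : Q.natDegree ≤ k) :
    ∑ m ∈ monics F k, ((chi m Q : ℤ) : ℂ) = 0 := by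
  obtain ⟨u, hu, hu1⟩ := exists_chi_eq_neg_one hF hQ hs h1
  refine sum_monics_eq_zero (f := fun m => ((chi m Q : ℤ) : ℂ)) hQ (fun a b h => ?_)
    (fun a b => ?_) hu ?_ hk
  · rw [chi_congr h]
  · rw [chi_mul_left, Int.cast_mul]
  · rw [hu1]
    norm_num

theorem coeff_lFunction (d : F[X]) (k : ℕ) :
    PowerSeries.coeff k (lFunction d) = ∑ m ∈ monics F k, chi d m := by
  rw [lFunction, PowerSeries.coeff_mk]
  exact finsum_mem_eq_finite_toFinset_sum (chi d) (finite_monic_natDegree_eq k)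

/-- Reciprocity replaces χ_d(m) by χ_m(d) up to a sign that is constant for m of degree k. The
latter is a nontrivial function of m modulo d, and its sum over monics of degree k ≥ deg d vanishes.
-/
theorem coeff_lFunction_eq_zero (hF : ringChar F ≠ 2) {d : F[X]} (hd : d.Monic)
    (hs : Squarefree d) (h0 : 0 < d.natDegree) {k : ℕ} (hk : d.natDegree ≤ k) :
    PowerSeries.coeff k (lFunction d) = 0 := by
  obtain ⟨ε, hε⟩ := exists_chi_comm hF d.natDegree k
  have h1 : d ≠ 1 := by
    rintro rfl
    rw [natDegree_one] at h0
    exact lt_irrefl _ h0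
  have h2 := sum_chi_left_eq_zero hF hd hs h1 hk
  rw [← Int.cast_sum, Int.cast_eq_zero] at h2
  rw [coeff_lFunction, Finset.sum_congr rfl fun m hm =>
    hε d m hd (mem_monics.1 hm).1 rfl (mem_monics.1 hm).2, ← Finset.mul_sum, h2, mul_zero]

theorem constantCoeff_lFunction (d : F[X]) : PowerSeries.coeff 0 (lFunction d) = 1 := by
  rw [coeff_lFunction, monics_zero, Finset.sum_singleton, chi_one_right]

end Chi

/-! ### Inverse roots -/

section InverseRoots

theorem reflect_prod_X_sub_C (s : Multiset ℂ) :
    (s.map fun ω => (X - C ω : ℂ[X])).prod.reflect s.card =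
      (s.map fun ω => (1 - C ω * X : ℂ[X])).prod := by
  induction s using Multiset.induction_on with
  | empty => simp
  | cons ω s ih =>
    rw [Multiset.map_cons, Multiset.prod_cons, Multiset.map_cons, Multiset.prod_cons,
      Multiset.card_cons, add_comm, reflect_mul _ _ (natDegree_X_sub_C ω).le
      (natDegree_multiset_prod_X_sub_C_eq_card s).le, ih, reflect_sub, reflect_one_X, reflect_C,
      pow_one]

variable {F : Type*} [Field F] [Finite F]

/-- The reversed polynomial is monic of degree exactly n - 1 because 𝓛 has constant term 1. If 𝓛 has
smaller degree, the missing inverse roots are zeros, and their factors 1 - 0·t are harmless. -/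
theorem card_inverseRoots_and_map_lFunction (hF : ringChar F ≠ 2) {d : F[X]} (hd : d.Monic)
    (hs : Squarefree d) (h0 : 0 < d.natDegree) :
    (inverseRoots d).card = d.natDegree - 1 ∧
      PowerSeries.map (Int.castRingHom ℂ) (lFunction d) =
        ((inverseRoots d).map
          fun ω => (1 - PowerSeries.C ω * PowerSeries.X : PowerSeries ℂ)).prod := by
  set n := d.natDegree with hn
  set p : ℂ[X] := (PowerSeries.trunc n (lFunction d)).map (Int.castRingHom ℂ) with hp
  have hcoeff : ∀ k, p.coeff k = ((PowerSeries.coeff k (lFunction d) : ℤ) : ℂ) := by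
    intro k
    rw [hp, coeff_map, PowerSeries.coeff_trunc, eq_intCast]
    split_ifs with h
    · rfl
    · rw [coeff_lFunction_eq_zero hF hd hs h0 (not_lt.1 h)]
  have hdeg : p.natDegree ≤ n - 1 := by
    rw [natDegree_le_iff_coeff_eq_zero]
    intro k hk
    rw [hcoeff, coeff_lFunction_eq_zero hF hd hs h0 (by omega), Int.cast_zero]
  set g := p.reflect (n - 1) with hg
  have hroots : inverseRoots d = g.roots := by
    rw [inverseRoots, hg, hp, reflect_map]
  have hgdeg : g.natDegree ≤ n - 1 := natDegree_reflect_le.trans (max_le le_rfl hdeg)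
  have hgc : g.coeff (n - 1) = 1 := by
    rw [hg, coeff_reflect, revAt_le le_rfl, Nat.sub_self, hcoeff, constantCoeff_lFunction,
      Int.cast_one]
  have hgm : g.Monic := monic_of_natDegree_le_of_coeff_eq_one _ hgdeg hgc
  have hgn : g.natDegree = n - 1 := le_antisymm hgdeg (le_natDegree_of_ne_zero (by
    rw [hgc]
    exact one_ne_zero))
  have hcard : g.roots.card = n - 1 := by rw [IsAlgClosed.card_roots_eq_natDegree, hgn]
  have hpp : p = (g.roots.map fun ω => (1 - C ω * X : ℂ[X])).prod := by
    rw [← reflect_prod_X_sub_C, hcard,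
      prod_multiset_X_sub_C_of_monic_of_roots_card_eq hgm (hcard.trans hgn.symm), hg,
      reflect_reflect]
  rw [hroots]
  refine ⟨hcard, ?_⟩
  have h1 : PowerSeries.map (Int.castRingHom ℂ) (lFunction d) = (p : PowerSeries ℂ) := by
    ext k
    rw [PowerSeries.coeff_map, coeff_coe, hcoeff, eq_intCast]
  rw [h1, hpp, ← coeToPowerSeries.ringHom_apply, map_multiset_prod, Multiset.map_map]
  congr 1
  refine Multiset.map_congr rfl fun ω _ => ?_
  rw [Function.comp_apply, map_sub, map_one, map_mul, coeToPowerSeries.ringHom_apply,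
    coeToPowerSeries.ringHom_apply, coe_C, coe_X]

end InverseRoots


/-! ### Averages over squarefree polynomials -/

section Averages

variable {F : Type*} [Field F]

theorem chi_prod (d : F[X]) {B : Finset F[X]} (hB : ∀ P ∈ B, P.Monic ∧ Irreducible P) :
    chi d (∏ P ∈ B, P) = ∏ P ∈ B, residueSymbol d P := by
  classical
  induction B using Finset.induction_on with
  | empty => rw [Finset.prod_empty, Finset.prod_empty, chi_one_right]
  | insert P B hP ih =>
    have hB' : ∀ Q ∈ B, Q.Monic ∧ Irreducible Q := fun Q hQ => hB Q (Finset.mem_insert_of_mem hQ)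
    have hP' := hB P (Finset.mem_insert_self _ _)
    rw [Finset.prod_insert hP, Finset.prod_insert hP, chi_mul_right _ hP'.1.ne_zero
      (Finset.prod_ne_zero_iff.2 fun Q hQ => (hB' Q hQ).1.ne_zero), chi_prime _ hP', ih hB']

theorem squarefree_prod_of_monic_irreducible {B : Finset F[X]}
    (hB : ∀ P ∈ B, P.Monic ∧ Irreducible P) : Squarefree (∏ P ∈ B, P) := by
  refine Finset.squarefree_prod_of_pairwise_isCoprime (fun P hP Q hQ hPQ => IsCoprime.isRelPrime ?_)
    fun P hP => (hB P hP).2.squarefree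
  refine ((hB P hP).2.coprime_iff_not_dvd).2 fun h => hPQ ?_
  exact eq_of_monic_irreducible_dvd (hB P hP) (hB Q hQ) h

open Classical in
theorem sq_residueSymbol {d P : F[X]} :
    ((residueSymbol d P : ℤ) : ℂ) ^ 2 = if P ∣ d then 0 else 1 := by
  split_ifs with h
  · rw [residueSymbol_of_dvd h]
    norm_num
  · rcases residueSymbol_of_not_dvd h with h | h <;> rw [h] <;> norm_num

variable [Finite F]

variable (F) in
/-- The monic squarefree polynomials of degree `n`. -/
noncomputable def squarefreeMonics (n : ℕ) : Finset F[X] := by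
  classical
  exact (monics F n).filter Squarefree

theorem mem_squarefreeMonics {n : ℕ} {d : F[X]} :
    d ∈ squarefreeMonics F n ↔ d.Monic ∧ Squarefree d ∧ d.natDegree = n := by
  classical
  rw [squarefreeMonics, Finset.mem_filter, mem_monics]
  tauto

variable (F) in
theorem one_lt_card_real : (1 : ℝ) < Nat.card F := by
  exact_mod_cast Finite.one_lt_card (α := F)

-- For empty B the n-th coefficient is q^n. Otherwise the product of B is squarefree and nontrivial,
-- and the coefficients vanish from its degree on.
open Classical in
theorem hasNormLimit_genSeries_chi (hF : ringChar F ≠ 2) {B : Finset F[X]}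
    (hB : ∀ P ∈ B, P.Monic ∧ Irreducible P) :
    HasNormLimit (Nat.card F) (genSeries fun d => ((chi d (∏ P ∈ B, P) : ℤ) : ℂ))
      (if B = ∅ then 1 else 0) := by
  split_ifs with h
  · subst h
    have h1 : (genSeries fun d : F[X] => ((chi d (∏ P ∈ (∅ : Finset F[X]), P) : ℤ) : ℂ)) =
        genSeries fun _ : F[X] => (1 : ℂ) := by
      simp only [Finset.prod_empty, chi_one_right, Int.cast_one]
    rw [h1, genSeries_one, HasNormLimit]
    refine tendsto_const_nhds.congr fun n => ?_
    rw [PowerSeries.coeff_mk, Complex.ofReal_natCast, div_self]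
    have := one_lt_card_real F
    exact pow_ne_zero _ (by exact_mod_cast (show (Nat.card F : ℝ) ≠ 0 by linarith))
  · refine hasNormLimit_zero_of_eventually ?_
    filter_upwards [eventually_ge_atTop (∏ P ∈ B, P).natDegree] with n hn
    rw [coeff_genSeries]
    refine sum_chi_left_eq_zero hF (monic_prod_of_monic _ _ fun P hP => (hB P hP).1)
      (squarefree_prod_of_monic_irreducible hB) (fun h1 => ?_) hn
    obtain ⟨P, hP⟩ := Finset.nonempty_iff_ne_empty.2 h
    exact (hB P hP).2.not_isUnit (isUnit_of_dvd_one (h1 ▸ Finset.dvd_prod_of_mem _ hP))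

open Classical in
/-- The generating series of the squarefree polynomials. -/
theorem genSeries_squarefree_mul {B D : Finset F[X]}
    (hB : ∀ P ∈ B, P.Monic ∧ Irreducible P) (hD : ∀ P ∈ D, P.Monic ∧ Irreducible P) :
    (genSeries fun d => if Squarefree d then
        restrictWeight D (fun d => ((chi d (∏ P ∈ B, P) : ℤ) : ℂ)) d else 0) *
      ∏ P ∈ B ∪ D, (1 - PowerSeries.C 1 * PowerSeries.X ^ (2 * P.natDegree)) =
    (genSeries fun d => ((chi d (∏ P ∈ B, P) : ℤ) : ℂ)) *
      (∏ P ∈ D, (1 - PowerSeries.C ((chi P (∏ P ∈ B, P) : ℤ) : ℂ) *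
        PowerSeries.X ^ P.natDegree)) *
      (1 - PowerSeries.C (Nat.card F : ℂ) * PowerSeries.X ^ 2) := by
  set ψ : F[X] → ℂ := fun d => ((chi d (∏ P ∈ B, P) : ℤ) : ℂ) with hψ
  have hψm : IsMulWeight ψ := fun a b _ _ => by
    rw [hψ]
    beta_reduce
    rw [chi_mul_left, Int.cast_mul]
  have hBD : ∀ P ∈ B ∪ D, P.Monic ∧ Irreducible P := fun P hP =>
    (Finset.mem_union.1 hP).elim (hB P) (hD P)
  have h1 := genSeries_mul_prod hψm hD
  have h2 := genSeries_eq_expand_mul (hψm.restrict hD)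
  -- The square of a quadratic character is the indicator of coprimality, so the square part of d
  -- contributes a sieved zeta series.
  have hsq : ∀ a : F[X], restrictWeight D ψ a ^ 2 = restrictWeight (B ∪ D) (fun _ => 1) a := by
    intro a
    simp only [restrictWeight, Finset.mem_union, or_imp, forall_and]
    by_cases hDa : ∀ P ∈ D, ¬ P ∣ a
    · rw [if_pos hDa]
      simp only [hψ, chi_prod a hB, Int.cast_prod, ← Finset.prod_pow, sq_residueSymbol]
      by_cases hBa : ∀ P ∈ B, ¬ P ∣ a
      · rw [if_pos ⟨hBa, hDa⟩]
        exact Finset.prod_eq_one fun P hP => if_neg (hBa P hP)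
      · rw [if_neg fun h => hBa h.1]
        push Not at hBa
        obtain ⟨P, hP, hd⟩ := hBa
        exact Finset.prod_eq_zero hP (if_pos hd)
    · rw [if_neg hDa, if_neg fun h => hDa h.2]
      norm_num
  have h3 : genSeries (fun a => restrictWeight D ψ a ^ 2) =
      genSeries (fun _ : F[X] => (1 : ℂ)) *
        ∏ P ∈ B ∪ D, (1 - PowerSeries.C 1 * PowerSeries.X ^ P.natDegree) := by
    rw [genSeries_mul_prod (w := fun _ => 1) (fun _ _ _ _ => (mul_one 1).symm) hBD]
    exact genSeries_congr fun a _ => hsq a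
  have h4 := congrArg (PowerSeries.expand 2 two_ne_zero) (mk_pow_mul_one_sub (Nat.card F : ℂ))
  rw [← genSeries_one, map_mul, map_sub, map_mul, map_one, PowerSeries.expand_C,
    PowerSeries.expand_X] at h4
  have h5 : PowerSeries.expand 2 two_ne_zero
      (∏ P ∈ B ∪ D, (1 - PowerSeries.C (1 : ℂ) * PowerSeries.X ^ P.natDegree)) =
      ∏ P ∈ B ∪ D, (1 - PowerSeries.C 1 * PowerSeries.X ^ (2 * P.natDegree)) := by
    rw [map_prod]
    refine Finset.prod_congr rfl fun P _ => ?_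
    rw [map_sub, map_mul, map_one, map_one, map_one, map_pow, PowerSeries.expand_X, pow_mul]
  rw [h3, map_mul, h5] at h2
  rw [h1, h2]
  linear_combination (-(∏ P ∈ B ∪ D, (1 - PowerSeries.C (1 : ℂ) *
    PowerSeries.X ^ (2 * P.natDegree))) * genSeries fun d => if Squarefree d then
      restrictWeight D ψ d else 0) * h4

-- Normalized limits turn each factor 1 - r t^k into 1 - r q^{-k}. In the case B = ∅, the factor 1 -
-- q t² becomes 1 - q⁻¹, and each P in D contributes (1 - q^{-deg P})/(1 - q^{-2 deg P}).
open Classical in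
theorem tendsto_average (hF : ringChar F ≠ 2) {B D : Finset F[X]}
    (hB : ∀ P ∈ B, P.Monic ∧ Irreducible P) (hD : ∀ P ∈ D, P.Monic ∧ Irreducible P) :
    Tendsto (fun n => ((Nat.card F : ℂ) ^ n)⁻¹ * ∑ d ∈ squarefreeMonics F n,
        (∏ P ∈ B, ((residueSymbol d P : ℤ) : ℂ)) * ∏ P ∈ D, ((residueSymbol d P : ℤ) : ℂ) ^ 2)
      atTop (𝓝 (if B = ∅ then (1 - (Nat.card F : ℂ)⁻¹) *
        ∏ P ∈ D, (1 + ((Nat.card F : ℂ)⁻¹) ^ P.natDegree)⁻¹ else 0)) := by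
  have hq := one_lt_card_real F
  have hq0 : (Nat.card F : ℂ) ≠ 0 := by exact_mod_cast (show (Nat.card F : ℝ) ≠ 0 by linarith)
  have hBD : ∀ P ∈ B ∪ D, P.Monic ∧ Irreducible P := fun P hP =>
    (Finset.mem_union.1 hP).elim (hB P) (hD P)
  have h1 := ((hasNormLimit_genSeries_chi hF hB).mul_prod hq D
    (fun P => ((chi P (∏ P ∈ B, P) : ℤ) : ℂ)) fun P => P.natDegree).mul_one_sub hq
      (Nat.card F : ℂ) 2
  rw [← genSeries_squarefree_mul hB hD] at h1
  have h2 := h1.of_mul_prod hq (B ∪ D) (fun _ => 1) (fun P => 2 * P.natDegree)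
    (fun _ _ => by rw [norm_one])
    fun P hP => Nat.mul_pos two_pos (hBD P hP).2.natDegree_pos
  rw [HasNormLimit] at h2
  rw [Complex.ofReal_natCast] at h2
  refine (h2.congr fun n => ?_).trans (le_of_eq (congrArg 𝓝 ?_))
  · rw [div_eq_inv_mul, coeff_genSeries, ← Finset.sum_filter, squarefreeMonics]
    congr 1
    refine Finset.sum_congr rfl fun d _ => ?_
    rw [restrictWeight, chi_prod d hB, Int.cast_prod]
    simp only [sq_residueSymbol]
    by_cases hDd : ∀ P ∈ D, ¬ P ∣ d
    · rw [if_pos hDd, Finset.prod_eq_one fun P hP => if_neg (hDd P hP), mul_one]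
    · rw [if_neg hDd]
      push Not at hDd
      obtain ⟨P, hP, hd⟩ := hDd
      have h0 : (∏ P ∈ D, if P ∣ d then (0 : ℂ) else 1) = 0 :=
        Finset.prod_eq_zero hP (if_pos hd)
      rw [h0, mul_zero]
  · split_ifs with h
    · subst h
      rw [one_mul, Finset.empty_union]
      simp only [Finset.prod_empty, chi_one_right, Int.cast_one]
      have e : ∀ P ∈ D, (1 + ((Nat.card F : ℂ)⁻¹) ^ P.natDegree)⁻¹ =
          (1 - 1 / (Nat.card F : ℂ) ^ P.natDegree) /
            (1 - 1 / (Nat.card F : ℂ) ^ (2 * P.natDegree)) := by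
        intro P hP
        have hlt := one_lt_pow₀ hq (hD P hP).2.natDegree_pos.ne'
        have hne : (Nat.card F : ℂ) ^ P.natDegree ≠ 0 := pow_ne_zero _ hq0
        have h1 : (Nat.card F : ℂ) ^ P.natDegree - 1 ≠ 0 := by
          exact_mod_cast (show (Nat.card F : ℝ) ^ P.natDegree - 1 ≠ 0 by linarith)
        have h2 : (Nat.card F : ℂ) ^ P.natDegree + 1 ≠ 0 := by
          exact_mod_cast (show (Nat.card F : ℝ) ^ P.natDegree + 1 ≠ 0 by linarith)
        rw [mul_comm 2, pow_mul, inv_pow]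
        generalize (Nat.card F : ℂ) ^ P.natDegree = x at *
        have h3 : x ^ 2 - 1 ≠ 0 := by
          rw [show x ^ 2 - 1 = (x - 1) * (x + 1) by ring]
          exact mul_ne_zero h1 h2
        have h4 : 1 + x⁻¹ ≠ 0 := by
          rw [show 1 + x⁻¹ = (x + 1) / x by field_simp]
          exact div_ne_zero h2 hne
        have h5 : 1 - 1 / x ^ 2 ≠ 0 := by
          rw [show 1 - 1 / x ^ 2 = (x ^ 2 - 1) / x ^ 2 by field_simp]
          exact div_ne_zero h3 (pow_ne_zero _ hne)
        rw [inv_eq_one_div, div_eq_div_iff h4 h5]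
        field_simp
        ring
      rw [Finset.prod_congr rfl e, Finset.prod_div_distrib]
      have e2 : (Nat.card F : ℂ) / (Nat.card F : ℂ) ^ 2 = (Nat.card F : ℂ)⁻¹ := by field_simp
      rw [e2]
      ring
    · rw [zero_mul, zero_mul, zero_div]

end Averages


/-! ### Products over variables -/

section Variables

/-- The substitution `t ↦ x_j`. -/
noncomputable def substX (j : ℕ) : PowerSeries ℂ →ₐ[ℂ] MvPowerSeries ℕ ℂ :=
  PowerSeries.substAlgHom (PowerSeries.HasSubst.X j)

theorem substX_apply (j : ℕ) (f : PowerSeries ℂ) :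
    substX j f = PowerSeries.subst (MvPowerSeries.X j) f :=
  congrFun (PowerSeries.coe_substAlgHom _) f

theorem coeff_substX (j : ℕ) (f : PowerSeries ℂ) (m : ℕ →₀ ℕ) :
    MvPowerSeries.coeff m (substX j f) =
      if m = Finsupp.single j (m j) then PowerSeries.coeff (m j) f else 0 := by
  rw [substX_apply, PowerSeries.coeff_subst_single]

theorem coeff_prod_substX (s : Finset ℕ) (f : PowerSeries ℂ) (m : ℕ →₀ ℕ) :
    MvPowerSeries.coeff m (∏ j ∈ s, substX j f) =
      if m.support ⊆ s then ∏ j ∈ s, PowerSeries.coeff (m j) f else 0 := by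
  classical
  induction s using Finset.induction_on generalizing m with
  | empty =>
    rw [Finset.prod_empty, Finset.prod_empty, MvPowerSeries.coeff_one]
    simp only [Finset.subset_empty, Finsupp.support_eq_empty]
  | insert i s hi ih =>
    rw [Finset.prod_insert hi, MvPowerSeries.coeff_mul,
      Finset.sum_eq_single (Finsupp.single i (m i), m.erase i)]
    · rw [coeff_substX, ih, Finsupp.single_eq_same, if_pos rfl, Finset.prod_insert hi,
        Finsupp.support_erase]
      simp only [Finset.subset_insert_iff, mul_ite, mul_zero]
      congr 2
      refine Finset.prod_congr rfl fun j hj => ?_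
      rw [Finsupp.erase_ne (ne_of_mem_of_not_mem hj hi)]
    · rintro ⟨a, b⟩ hab hne
      rw [Finset.HasAntidiagonal.mem_antidiagonal] at hab
      rw [coeff_substX, ih]
      split_ifs with ha hb
      · exfalso
        have hbi : b i = 0 := by
          by_contra h
          exact hi (hb (Finsupp.mem_support_iff.2 h))
        have hmi : m i = a i := by
          rw [← hab, Finsupp.add_apply, hbi, add_zero]
        refine hne (Prod.ext (by rw [hmi]; exact ha) (Finsupp.ext fun j => ?_))
        change b j = m.erase i j
        by_cases hj : j = i
        · rw [hj, hbi, Finsupp.erase_same]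
        · have ha' : a = Finsupp.single i (a i) := ha
          have haj : a j = 0 := by rw [ha', Finsupp.single_eq_of_ne hj]
          rw [Finsupp.erase_ne hj, ← hab, Finsupp.add_apply, haj, zero_add]
      all_goals simp
    · intro h
      exact absurd (Finset.HasAntidiagonal.mem_antidiagonal.2 (Finsupp.single_add_erase i m)) h

/-- Setting the variables outside s to zero is multiplicative. This is needed since the local factor
equals the product over j ∈ s only on monomials in those variables. -/
theorem coeff_prod_congr {ι : Type*} (S : Finset ι) (s : Finset ℕ) (f g : ι → MvPowerSeries ℕ ℂ)
    (h : ∀ i ∈ S, ∀ m : ℕ →₀ ℕ, m.support ⊆ s →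
      MvPowerSeries.coeff m (f i) = MvPowerSeries.coeff m (g i))
    (m : ℕ →₀ ℕ) (hm : m.support ⊆ s) :
    MvPowerSeries.coeff m (∏ i ∈ S, f i) = MvPowerSeries.coeff m (∏ i ∈ S, g i) := by
  classical
  induction S using Finset.induction_on generalizing m with
  | empty => rw [Finset.prod_empty, Finset.prod_empty]
  | insert i S hi ih =>
    rw [Finset.prod_insert hi, Finset.prod_insert hi, MvPowerSeries.coeff_mul,
      MvPowerSeries.coeff_mul]
    refine Finset.sum_congr rfl fun p hp => ?_
    rw [Finset.HasAntidiagonal.mem_antidiagonal] at hp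
    have h1 : p.1.support ⊆ m.support := by
      rw [← hp]
      exact Finsupp.support_mono (self_le_add_right _ _)
    have h2 : p.2.support ⊆ m.support := by
      rw [← hp]
      exact Finsupp.support_mono (self_le_add_left _ _)
    rw [h i (Finset.mem_insert_self _ _) _ (h1.trans hm),
      ih (fun j hj => h j (Finset.mem_insert_of_mem hj)) _ (h2.trans hm)]

/-- The series `∑ h_{2k+1}`. -/
noncomputable def oddH : MvPowerSeries ℕ ℂ := fun m => if Odd m.degree then 1 else 0

theorem coeff_oddH (m : ℕ →₀ ℕ) :
    MvPowerSeries.coeff m oddH = if Odd m.degree then 1 else 0 := rfl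

/-- The power series `∑ (ε t ^ k) ^ a`. -/
noncomputable def geomSeries (ε : ℂ) (k : ℕ+) : PowerSeries ℂ :=
  PowerSeries.expand (k : ℕ) k.ne_zero (PowerSeries.mk fun n => ε ^ n)

theorem geomSeries_mul (ε : ℂ) (k : ℕ+) :
    geomSeries ε k * (1 - PowerSeries.C ε * PowerSeries.X ^ (k : ℕ)) = 1 := by
  have h := congrArg (PowerSeries.expand (k : ℕ) k.ne_zero) (mk_pow_mul_one_sub ε)
  rwa [map_mul, map_sub, map_mul, map_one, PowerSeries.expand_C, PowerSeries.expand_X] at h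

/-- The product is ∑_e ε^e ψ_k(h_e) in the variables of s, and ε³ = ε collapses ε^e in positive
degree to ε for odd e and ε² for even e. The term e = 0 must stay apart, because ε may be 0. -/
theorem coeff_prod_substX_geomSeries {ε : ℂ} (hε : ε ^ 3 = ε) (k : ℕ+) (s : Finset ℕ)
    (m : ℕ →₀ ℕ) (hm : m.support ⊆ s) :
    MvPowerSeries.coeff m (∏ j ∈ s, substX j (geomSeries ε k)) =
      MvPowerSeries.coeff m (1 + MvPowerSeries.C ε * expandC k oddH +
        MvPowerSeries.C (ε ^ 2) * (expandC k (evenH ℂ) - 1)) := by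
  classical
  have hpow : ∀ n, ε ^ (2 * n + 1) = ε ∧ ε ^ (2 * n + 2) = ε ^ 2 := by
    intro n
    induction n with
    | zero => simp
    | succ n ih =>
      constructor
      · calc ε ^ (2 * (n + 1) + 1) = ε ^ (2 * n + 1) * ε ^ 2 := by ring
          _ = ε ^ 3 := by rw [ih.1]; ring
          _ = ε := hε
      · calc ε ^ (2 * (n + 1) + 2) = ε ^ (2 * n + 1) * ε ^ 3 := by ring
          _ = ε ^ 2 := by rw [ih.1, hε]; ring
  rw [coeff_prod_substX, if_pos hm, map_add, map_add, MvPowerSeries.coeff_C_mul,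
    MvPowerSeries.coeff_C_mul, map_sub, MvPowerSeries.coeff_one]
  by_cases h : ∃ m', m = (k : ℕ) • m'
  · obtain ⟨m', rfl⟩ := h
    rw [coeff_expandC_smul, coeff_expandC_smul, coeff_oddH, coeff_evenH]
    have h1 : ∏ j ∈ s, PowerSeries.coeff (((k : ℕ) • m') j) (geomSeries ε k) = ε ^ m'.degree := by
      have h2 : ∀ j ∈ s, PowerSeries.coeff (((k : ℕ) • m') j) (geomSeries ε k) = ε ^ m' j := by
        intro j _
        rw [Finsupp.smul_apply, smul_eq_mul, geomSeries, PowerSeries.coeff_expand_mul,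
          PowerSeries.coeff_mk]
      have hs : m'.support ⊆ s := by
        intro j hj
        refine hm (Finsupp.mem_support_iff.2 ?_)
        rw [Finsupp.smul_apply, smul_eq_mul]
        exact mul_ne_zero k.ne_zero (Finsupp.mem_support_iff.1 hj)
      rw [Finset.prod_congr rfl h2, Finset.prod_pow_eq_pow_sum, Finsupp.degree_apply]
      congr 1
      exact (Finset.sum_subset hs fun j _ hj => Finsupp.notMem_support_iff.1 hj).symm
    rw [h1]
    have h0 : (k : ℕ) • m' = 0 ↔ m'.degree = 0 := by
      rw [Finsupp.degree_eq_zero_iff]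
      exact smul_eq_zero_iff_right k.ne_zero
    simp only [h0]
    generalize m'.degree = e
    rcases Nat.even_or_odd' e with ⟨n, rfl | rfl⟩
    · have ho : ¬ Odd (2 * n) := by rw [Nat.not_odd_iff_even]; exact even_two_mul n
      rw [if_neg ho, if_pos (even_two_mul n)]
      rcases n with _ | n
      · simp
      · have h0 : 2 * (n + 1) ≠ 0 := by omega
        rw [if_neg h0, mul_add, mul_one, (hpow n).2]
        ring
    · have he : ¬ Even (2 * n + 1) := by rw [Nat.not_even_iff_odd]; exact odd_two_mul_add_one n
      have h0 : 2 * n + 1 ≠ 0 := by omega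
      rw [if_pos (odd_two_mul_add_one n), if_neg he, if_neg h0, (hpow n).1]
      ring
  · rw [coeff_expandC_of_not_dvd _ _ _ h, coeff_expandC_of_not_dvd _ _ _ h, if_neg]
    · obtain ⟨i, hi⟩ := not_dvd_of_not_smul h
      rw [Finset.prod_eq_zero (i := i)]
      · simp
      · refine hm (Finsupp.mem_support_iff.2 fun h0 => hi ?_)
        rw [h0]
        exact dvd_zero _
      · exact PowerSeries.coeff_expand_of_not_dvd _ k.ne_zero _ hi
    · rintro rfl
      exact h ⟨0, by rw [smul_zero]⟩

end Variables

/-! ### The coefficients of the trace series -/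

section Coefficients

variable {F : Type*} [Field F] [Finite F]

/-- The degree of a nonconstant polynomial, as a positive integer. -/
noncomputable def degPos (P : F[X]) : ℕ+ := P.natDegree.toPNat'

omit [Finite F] in
theorem degPos_coe {P : F[X]} (hP : Irreducible P) : (degPos P : ℕ) = P.natDegree := by
  rw [degPos, Nat.toPNat'_coe, if_pos hP.natDegree_pos]

/-- The value at `P` of the character `χ_d`, with the sign `(-1) ^ (deg P)`. -/
noncomputable def signedSymbol (d P : F[X]) : ℂ :=
  (-1) ^ P.natDegree * ((residueSymbol d P : ℤ) : ℂ)

omit [Finite F] in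
theorem signedSymbol_pow_three (d P : F[X]) : signedSymbol d P ^ 3 = signedSymbol d P := by
  have h : ((residueSymbol d P : ℤ) : ℂ) ^ 3 = ((residueSymbol d P : ℤ) : ℂ) := by
    by_cases hd : P ∣ d
    · rw [residueSymbol_of_dvd hd]
      norm_num
    · rcases residueSymbol_of_not_dvd hd with h | h <;> rw [h] <;> norm_num
  rw [signedSymbol, mul_pow, h, ← pow_mul, mul_comm _ 3, pow_mul]
  norm_num

/-- This is the Euler product of 𝓛(-t, χ_d). Primes of degree above N do not affect coefficients up
to t^N, and t ↦ -t puts the sign (-1)^{deg P} into the symbol. -/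
theorem coeff_prod_one_add_mul_X (hF : ringChar F ≠ 2) {d : F[X]} (hd : d.Monic)
    (hs : Squarefree d) (h0 : 0 < d.natDegree) {N n : ℕ} (hn : n ≤ N) :
    PowerSeries.coeff n ((inverseRoots d).map
      fun ω => (1 + PowerSeries.C ω * PowerSeries.X : PowerSeries ℂ)).prod =
    PowerSeries.coeff n (∏ P ∈ primesLE F N, geomSeries (signedSymbol d P) (degPos P)) := by
  set w : F[X] → ℂ := fun m => ((chi d m : ℤ) : ℂ) with hw
  have hwm : IsMulWeight w := fun a b ha hb => by
    rw [hw]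
    beta_reduce
    rw [chi_mul_right _ ha.ne_zero hb.ne_zero, Int.cast_mul]
  have hprime : ∀ P ∈ primesLE F N, P.Monic ∧ Irreducible P := fun P hP =>
    isMonicIrreducible_of_mem_primesLE hP
  have h1 := genSeries_mul_prod hwm hprime
  have hL : PowerSeries.map (Int.castRingHom ℂ) (lFunction d) = genSeries w := by
    ext k
    rw [PowerSeries.coeff_map, coeff_lFunction, coeff_genSeries, eq_intCast, Int.cast_sum]
  rw [← hL, (card_inverseRoots_and_map_lFunction hF hd hs h0).2] at h1
  have h2 := congrArg (PowerSeries.rescale (-1 : ℂ)) h1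
  rw [map_mul, map_multiset_prod, Multiset.map_map, map_prod] at h2
  have hC : ∀ c : ℂ, PowerSeries.rescale (-1 : ℂ) (PowerSeries.C c) = PowerSeries.C c := by
    intro c
    ext k
    rw [PowerSeries.coeff_rescale, PowerSeries.coeff_C]
    split_ifs with hk
    · rw [hk, pow_zero, one_mul]
    · rw [mul_zero]
  have hX : PowerSeries.rescale (-1 : ℂ) PowerSeries.X = -PowerSeries.X := by
    ext k
    rw [PowerSeries.coeff_rescale, map_neg, PowerSeries.coeff_X]
    split_ifs with hk
    · rw [hk]
      norm_num
    · simp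
  have h3 : ∀ ω : ℂ, ((PowerSeries.rescale (-1 : ℂ)) ∘ fun ω : ℂ =>
      (1 - PowerSeries.C ω * PowerSeries.X : PowerSeries ℂ)) ω =
      1 + PowerSeries.C ω * PowerSeries.X := by
    intro ω
    rw [Function.comp_apply, map_sub, map_one, map_mul, hC, hX]
    ring
  have h4 : ∀ P ∈ primesLE F N, PowerSeries.rescale (-1 : ℂ)
      (1 - PowerSeries.C (w P) * PowerSeries.X ^ P.natDegree) =
      1 - PowerSeries.C (signedSymbol d P) * PowerSeries.X ^ (degPos P : ℕ) := by
    intro P hP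
    rw [map_sub, map_one, map_mul, map_pow, hC, hX, degPos_coe (hprime P hP).2, signedSymbol,
      hw, neg_pow]
    beta_reduce
    rw [chi_prime _ (hprime P hP), map_mul, map_pow, map_neg, map_one]
    ring
  rw [Multiset.map_congr rfl fun ω _ => h3 ω, Finset.prod_congr rfl h4] at h2
  set f := ((inverseRoots d).map
      fun ω => (1 + PowerSeries.C ω * PowerSeries.X : PowerSeries ℂ)).prod with hf
  set E := ∏ P ∈ primesLE F N, geomSeries (signedSymbol d P) (degPos P) with hE
  have h5 : E * ∏ P ∈ primesLE F N,
      (1 - PowerSeries.C (signedSymbol d P) * PowerSeries.X ^ (degPos P : ℕ)) = 1 := by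
    rw [hE, ← Finset.prod_mul_distrib]
    exact Finset.prod_eq_one fun P _ => geomSeries_mul _ _
  set ν := PowerSeries.rescale (-1 : ℂ) (genSeries (restrictWeight (primesLE F N) w)) with hν
  have h6 : f = E * ν := by
    rw [← h2, mul_left_comm, h5, mul_one]
  have h7 : (PowerSeries.X : PowerSeries ℂ) ^ (N + 1) ∣ ν - 1 := by
    rw [PowerSeries.X_pow_dvd_iff]
    intro k hk
    rw [map_sub, hν, PowerSeries.coeff_rescale, coeff_genSeries_restrict_primesLE (by
      rw [hw]
      beta_reduce
      rw [chi_one_right, Int.cast_one]) (by omega), PowerSeries.coeff_one]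
    split_ifs with h
    · rw [h, pow_zero, one_mul, sub_self]
    · rw [mul_zero, sub_self]
  have h8 : (PowerSeries.X : PowerSeries ℂ) ^ (N + 1) ∣ f - E := by
    rw [h6, show E * ν - E = E * (ν - 1) by ring]
    exact h7.mul_left E
  have h9 := (PowerSeries.X_pow_dvd_iff.1 h8) n (by omega)
  rwa [map_sub, sub_eq_zero] at h9

/-- The odd part of the local factor at `P`. -/
noncomputable def oddPart (P : F[X]) : MvPowerSeries ℕ ℂ :=
  MvPowerSeries.C ((-1) ^ P.natDegree) * expandC (degPos P) oddH

/-- The even part of the local factor at `P`. -/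
noncomputable def evenPart (P : F[X]) : MvPowerSeries ℕ ℂ :=
  expandC (degPos P) (evenH ℂ) - 1

/-- The dual Cauchy product is ∏_j 𝓛(-x_j, χ_d). Replacing each factor by its truncated Euler
product and exchanging the products over j and P leaves one local factor per prime, linear in χ_d(P)
and χ_d(P)². -/
theorem coeff_schurSum_inverseRoots (hF : ringChar F ≠ 2) {d : F[X]} (hd : d.Monic)
    (hs : Squarefree d) (h0 : 0 < d.natDegree) (m : ℕ →₀ ℕ) {N : ℕ} (hN : m.degree ≤ N) :
    MvPowerSeries.coeff m (schurSum fun μ => schurEval μ (inverseRoots d).toList) =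
      MvPowerSeries.coeff m (∏ P ∈ primesLE F N,
        (1 + MvPowerSeries.C ((residueSymbol d P : ℤ) : ℂ) * oddPart P +
          MvPowerSeries.C (((residueSymbol d P : ℤ) : ℂ) ^ 2) * evenPart P)) := by
  classical
  obtain ⟨M, hM⟩ : ∃ M, m.support ⊆ Finset.range M := m.support.exists_nat_subset_range
  rw [coeff_schurSum_schurEval _ m (M := M) fun i hi => Finset.mem_range.1 (hM hi)]
  have h1 : ∀ j ∈ Finset.range M, ((inverseRoots d).toList.map fun ω =>
      (1 + MvPowerSeries.X j * MvPowerSeries.C ω : MvPowerSeries ℕ ℂ)).prod =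
      substX j ((inverseRoots d).map
        fun ω => (1 + PowerSeries.C ω * PowerSeries.X : PowerSeries ℂ)).prod := by
    intro j _
    rw [map_multiset_prod, Multiset.map_map, ← Multiset.prod_coe, ← Multiset.map_coe,
      Multiset.coe_toList]
    congr 1
    refine Multiset.map_congr rfl fun ω _ => ?_
    rw [Function.comp_apply, map_add, map_one (substX j), map_mul, substX_apply, substX_apply,
      PowerSeries.subst_C, PowerSeries.subst_X (PowerSeries.HasSubst.X j), mul_comm]
  rw [Finset.prod_congr rfl h1, coeff_prod_substX, if_pos hM]
  have h2 : ∀ j ∈ Finset.range M, PowerSeries.coeff (m j) ((inverseRoots d).map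
      fun ω => (1 + PowerSeries.C ω * PowerSeries.X : PowerSeries ℂ)).prod =
      PowerSeries.coeff (m j) (∏ P ∈ primesLE F N, geomSeries (signedSymbol d P) (degPos P)) :=
    fun j _ => coeff_prod_one_add_mul_X hF hd hs h0 ((Finsupp.le_degree j m).trans hN)
  have h3 := coeff_prod_substX (Finset.range M)
    (∏ P ∈ primesLE F N, geomSeries (signedSymbol d P) (degPos P)) m
  rw [if_pos hM] at h3
  rw [Finset.prod_congr rfl h2, ← h3]
  simp only [map_prod]
  rw [Finset.prod_comm]
  refine coeff_prod_congr _ (Finset.range M) _ _ (fun P hP m hm => ?_) m hM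
  rw [coeff_prod_substX_geomSeries (signedSymbol_pow_three d P) _ _ m hm]
  congr 1
  rw [oddPart, evenPart, signedSymbol, mul_pow, ← pow_mul, mul_comm _ 2, pow_mul, neg_one_sq,
    one_pow, one_mul, ← mul_assoc, ← map_mul, mul_comm ((-1 : ℂ) ^ P.natDegree)]

theorem coeff_traceSeries (n : ℕ) (m : ℕ →₀ ℕ) :
    MvPowerSeries.coeff m (traceSeries F n) = ((Nat.card F : ℂ) ^ n)⁻¹ *
      ∑ d ∈ squarefreeMonics F n,
        MvPowerSeries.coeff m (schurSum fun μ => schurEval μ (inverseRoots d).toList) := by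
  rw [traceSeries, coeff_schurSum _ m le_rfl le_rfl]
  have h1 : ∀ d ∈ squarefreeMonics F n,
      MvPowerSeries.coeff m (schurSum fun μ => schurEval μ (inverseRoots d).toList) =
      ∑ μ ∈ box m.degree m.degree, schurEval μ (inverseRoots d).toList *
        MvPowerSeries.coeff m (schur ℂ μ.transpose) := fun d _ =>
    coeff_schurSum _ m le_rfl le_rfl
  rw [Finset.sum_congr rfl h1, Finset.sum_comm, Finset.mul_sum]
  refine Finset.sum_congr rfl fun μ _ => ?_
  have h2 : {d : F[X] | d.Monic ∧ Squarefree d ∧ d.natDegree = n} =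
      (squarefreeMonics F n : Set F[X]) := by
    ext d
    rw [Finset.mem_coe, mem_squarefreeMonics]
    rfl
  have h3 : ∑ᶠ (d : F[X]) (_ : d.Monic ∧ Squarefree d ∧ d.natDegree = n),
      schurEval μ (inverseRoots d).toList =
      ∑ d ∈ squarefreeMonics F n, schurEval μ (inverseRoots d).toList := by
    rw [← finsum_mem_coe_finset, ← h2]
    rfl
  rw [traceCoeff, h3, mul_assoc, Finset.sum_mul]

omit [Finite F] in
theorem one_add_C_mul_evenPart {r : ℂ} (hr : ‖r‖ < 1) {P : F[X]} (hP : Irreducible P) :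
    1 + MvPowerSeries.C (1 + r ^ P.natDegree)⁻¹ * evenPart P = localFactor r (degPos P) := by
  have h0 := add_one_ne_zero_of_norm_lt (norm_pow_lt_one hr (degPos P))
  rw [localFactor, baseValue, evenPart, degPos_coe hP, map_add, expandC, MvPowerSeries.expand_C,
    mul_add, ← map_mul]
  rw [degPos_coe hP, add_comm] at h0
  have h1 : (1 + r ^ P.natDegree)⁻¹ * r ^ P.natDegree = 1 - (1 + r ^ P.natDegree)⁻¹ := by
    field_simp
    ring
  rw [h1, map_sub, map_one MvPowerSeries.C]
  ring

theorem prod_localFactor_eq (r : ℂ) (N : ℕ) :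
    ∏ P ∈ primesLE F N, localFactor r (degPos P) =
      Finset.prod (pnatLE N) fun k : ℕ+ => localFactor r k ^ primeCount F k := by
  classical
  rw [← Finset.prod_fiberwise_of_maps_to (g := degPos) (t := pnatLE N) (s := primesLE F N)
    fun P hP => by
      rw [mem_pnatLE, degPos_coe (isMonicIrreducible_of_mem_primesLE hP).2]
      exact (mem_primesLE.1 hP).2]
  refine Finset.prod_congr rfl fun k hk => ?_
  rw [mem_pnatLE] at hk
  rw [Finset.prod_congr rfl (g := fun _ => localFactor r k) fun P hP => by
    rw [(Finset.mem_filter.1 hP).2], Finset.prod_const, primeCount]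
  congr 2
  ext P
  rw [Finset.mem_filter, Finset.mem_filter, mem_monics, mem_primesLE]
  constructor
  · rintro ⟨⟨⟨h1, h2⟩, -⟩, rfl⟩
    exact ⟨⟨h1, (degPos_coe h2).symm⟩, h2⟩
  · rintro ⟨⟨h1, h2⟩, h3⟩
    exact ⟨⟨⟨h1, h3⟩, h2.le.trans hk⟩, PNat.coe_injective ((degPos_coe h3).trans h2)⟩

/-- The finite product over primes is expanded into terms indexed by disjoint B (odd parts) and D
(even parts), whose coefficients `c B D` do not depend on d. The averages are taken termwise; only B
= ∅ survives, and the sum over D refactors into an Euler product. -/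
theorem tendsto_coeff_traceSeries (hF : ringChar F ≠ 2) (m : ℕ →₀ ℕ) {N : ℕ} (hN : m.degree ≤ N) :
    Tendsto (fun n => MvPowerSeries.coeff m (traceSeries F n)) atTop
      (𝓝 (MvPowerSeries.coeff m (eulerProduct (Nat.card F : ℂ)⁻¹ (primeCount F) N))) := by
  classical
  set S := primesLE F N with hS
  set r := (Nat.card F : ℂ)⁻¹ with hr
  have hr1 : ‖r‖ < 1 := by
    rw [hr, norm_inv, Complex.norm_natCast]
    exact inv_lt_one_of_one_lt₀ (one_lt_card_real F)
  have hprime : ∀ P ∈ S, P.Monic ∧ Irreducible P := fun P hP =>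
    isMonicIrreducible_of_mem_primesLE hP
  set c : Finset F[X] → Finset F[X] → ℂ := fun B D =>
    MvPowerSeries.coeff m ((∏ P ∈ B, oddPart P) * ∏ P ∈ D, evenPart P) with hc
  have hexp : ∀ d : F[X], MvPowerSeries.coeff m (∏ P ∈ S,
      (1 + MvPowerSeries.C ((residueSymbol d P : ℤ) : ℂ) * oddPart P +
        MvPowerSeries.C (((residueSymbol d P : ℤ) : ℂ) ^ 2) * evenPart P)) =
      ∑ B ∈ S.powerset, ∑ D ∈ (S \ B).powerset,
        ((∏ P ∈ B, ((residueSymbol d P : ℤ) : ℂ)) *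
          ∏ P ∈ D, ((residueSymbol d P : ℤ) : ℂ) ^ 2) * c B D := by
    intro d
    have h1 : ∀ P ∈ S, (1 + MvPowerSeries.C ((residueSymbol d P : ℤ) : ℂ) * oddPart P +
        MvPowerSeries.C (((residueSymbol d P : ℤ) : ℂ) ^ 2) * evenPart P) =
        MvPowerSeries.C ((residueSymbol d P : ℤ) : ℂ) * oddPart P +
          (1 + MvPowerSeries.C (((residueSymbol d P : ℤ) : ℂ) ^ 2) * evenPart P) := fun P _ => by
      ring
    rw [Finset.prod_congr rfl h1, Finset.prod_add, map_sum]
    refine Finset.sum_congr rfl fun B _ => ?_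
    rw [Finset.prod_one_add, Finset.mul_sum, map_sum]
    refine Finset.sum_congr rfl fun D _ => ?_
    rw [Finset.prod_mul_distrib, Finset.prod_mul_distrib, ← map_prod, ← map_prod, mul_mul_mul_comm,
      ← map_mul, MvPowerSeries.coeff_C_mul]
  have hlim : Tendsto (fun n => ∑ B ∈ S.powerset, ∑ D ∈ (S \ B).powerset,
      (((Nat.card F : ℂ) ^ n)⁻¹ * ∑ d ∈ squarefreeMonics F n,
        (∏ P ∈ B, ((residueSymbol d P : ℤ) : ℂ)) *
          ∏ P ∈ D, ((residueSymbol d P : ℤ) : ℂ) ^ 2) * c B D) atTop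
      (𝓝 (∑ B ∈ S.powerset, ∑ D ∈ (S \ B).powerset, (if B = ∅ then (1 - r) *
        ∏ P ∈ D, (1 + r ^ P.natDegree)⁻¹ else 0) * c B D)) := by
    refine tendsto_finsetSum _ fun B hB => tendsto_finsetSum _ fun D hD => ?_
    rw [Finset.mem_powerset] at hB hD
    exact (tendsto_average hF (fun P hP => hprime P (hB hP))
      fun P hP => hprime P (Finset.sdiff_subset (hD hP))).mul_const _
  have hval : ∑ B ∈ S.powerset, ∑ D ∈ (S \ B).powerset, (if B = ∅ then (1 - r) *
      ∏ P ∈ D, (1 + r ^ P.natDegree)⁻¹ else 0) * c B D =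
      MvPowerSeries.coeff m (eulerProduct r (primeCount F) N) := by
    rw [Finset.sum_eq_single ∅]
    · rw [eulerProduct, ← prod_localFactor_eq, ← Finset.prod_congr rfl fun P hP =>
        one_add_C_mul_evenPart hr1 (hprime P hP).2, Finset.prod_one_add, MvPowerSeries.coeff_C_mul,
        map_sum, Finset.mul_sum, Finset.sdiff_empty]
      refine Finset.sum_congr rfl fun D _ => ?_
      rw [if_pos rfl, hc]
      beta_reduce
      rw [Finset.prod_empty, one_mul, Finset.prod_mul_distrib, ← map_prod,
        MvPowerSeries.coeff_C_mul, mul_assoc]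
    · intro B _ hB
      refine Finset.sum_eq_zero fun D _ => ?_
      rw [if_neg hB, zero_mul]
    · intro h
      exact absurd (Finset.empty_mem_powerset S) h
  rw [← hval]
  refine hlim.congr' ?_
  -- The factorization into inverse roots holds only for d of positive degree.
  filter_upwards [eventually_gt_atTop 0] with n hn
  rw [coeff_traceSeries]
  have h1 : ∀ d ∈ squarefreeMonics F n,
      MvPowerSeries.coeff m (schurSum fun μ => schurEval μ (inverseRoots d).toList) =
      ∑ B ∈ S.powerset, ∑ D ∈ (S \ B).powerset,
        ((∏ P ∈ B, ((residueSymbol d P : ℤ) : ℂ)) *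
          ∏ P ∈ D, ((residueSymbol d P : ℤ) : ℂ) ^ 2) * c B D := by
    intro d hd
    rw [mem_squarefreeMonics] at hd
    rw [coeff_schurSum_inverseRoots hF hd.1 hd.2.1 (by rw [hd.2.2]; exact hn) m hN, hexp]
  rw [Finset.sum_congr rfl h1, Finset.sum_comm, Finset.mul_sum]
  refine Finset.sum_congr rfl fun B _ => ?_
  rw [Finset.sum_comm, Finset.mul_sum]
  refine Finset.sum_congr rfl fun D _ => ?_
  rw [← Finset.sum_mul, mul_assoc]

end Coefficients

end StableTraces

theorem mainTheorem12 (F : Type*) [Field F] [Finite F] (hF : ringChar F ≠ 2) :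
    (∀ d : F[X], d.Monic → Squarefree d → 0 < d.natDegree →
      (StableTraces.inverseRoots d).card = d.natDegree - 1 ∧
      PowerSeries.map (Int.castRingHom ℂ) (StableTraces.lFunction d) =
        ((StableTraces.inverseRoots d).map
          fun ω => (1 - PowerSeries.C ω * PowerSeries.X : PowerSeries ℂ)).prod) ∧
    ∃ Z : MvPowerSeries ℕ ℂ,
      (∀ m : ℕ →₀ ℕ,
        HasSum
          (fun j : ℤ =>
            (((MvPowerSeries.coeff m StableTraces.stableSeries).coeff j : ℚ) : ℂ) *
              ((Nat.card F : ℂ)⁻¹) ^ j)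
          (MvPowerSeries.coeff m Z)) ∧
      Tendsto (fun n : ℕ => StableTraces.traceSeries F n) atTop (𝓝 Z) ∧
      ∃ a : YoungDiagram → ℂ,
        (∀ μ : YoungDiagram,
          Tendsto (fun n : ℕ => StableTraces.traceCoeff F n μ) atTop (𝓝 (a μ))) ∧
        StableTraces.schurSum a = Z := by
  refine ⟨fun d hd hs h0 => StableTraces.card_inverseRoots_and_map_lFunction hF hd hs h0, ?_⟩
  have hq := StableTraces.one_lt_card_real F
  have hr0 : (Nat.card F : ℂ)⁻¹ ≠ 0 :=
    inv_ne_zero (by exact_mod_cast (show (Nat.card F : ℝ) ≠ 0 by linarith))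
  have hr1 : ‖(Nat.card F : ℂ)⁻¹‖ < 1 := by
    rw [norm_inv, Complex.norm_natCast]
    exact inv_lt_one_of_one_lt₀ hq
  -- The infinite Euler product is defined coefficientwise: at m the truncation at |m| already has
  -- the right coefficient.
  let Z : MvPowerSeries ℕ ℂ := fun m => MvPowerSeries.coeff m
    (StableTraces.eulerProduct (Nat.card F : ℂ)⁻¹ (StableTraces.primeCount F) m.degree)
  have hZ : ∀ m, MvPowerSeries.coeff m Z = MvPowerSeries.coeff m
    (StableTraces.eulerProduct (Nat.card F : ℂ)⁻¹ (StableTraces.primeCount F) m.degree) :=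
    fun _ => rfl
  have hlim : ∀ m, Tendsto (fun n => MvPowerSeries.coeff m (StableTraces.traceSeries F n)) atTop
      (𝓝 (MvPowerSeries.coeff m Z)) := fun m => by
    rw [hZ]
    exact StableTraces.tendsto_coeff_traceSeries hF m le_rfl
  refine ⟨Z, fun m => ?_, ?_, ?_⟩
  · rw [hZ]
    exact StableTraces.evalsTo_coeff_stableSeries hr0 hr1 (StableTraces.primeCount F)
      StableTraces.natCast_mul_primeCount m.degree m le_rfl
  · rw [MvPowerSeries.WithPiTopology.tendsto_iff_coeff_tendsto]
    exact hlim
  · choose a ha using StableTraces.tendsto_of_tendsto_coeff_schurSum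
      (StableTraces.traceCoeff F) fun m => ⟨_, hlim m⟩
    refine ⟨a, ha, MvPowerSeries.ext fun m => ?_⟩
    -- Each coefficient of ∑ a_μ s_{μ'} is a fixed finite sum, so the limit may be taken inside it.
    refine tendsto_nhds_unique ?_ (hlim m)
    simp only [StableTraces.traceSeries, StableTraces.coeff_schurSum _ m le_rfl le_rfl]
    exact tendsto_finsetSum _ fun μ _ => (ha μ).mul_const _
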